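/- Let $F$ be a field of prime characteristic $p$, let $(L,[p])$ be a finite-dimensional restricted Lie algebra over $F$, let $S\in L^*$ be a linear form, let $I$ be an ideal of $L$, and let $\lambda\in I^*$ be a linear form with $\lambda(I^{(1)})=0$, where $I^{(1)}=[I,I]$. Put $L^\lambda=\{x\in L \mid \lambda([x,y])=0 \text{ for all } y\in I\}$; this is a $p$-subalgebra of $L$, and it contains $I$. For a $p$-subalgebra $H$ of $L$, an $H$-module $M$ with representation $\rho$ has character $S|_H$ if $\rho(x)^p-\rho(x^{[p]})=S(x)^p\,\mathrm{id}_M$ for all $x\in H$. Let $u(H,S|_H)$ be the quotient of the universal enveloping algebra $U(H)$ by the two-sided ideal generated by all $x^p-x^{[p]}-S(x)^p1$, $x\in H$. For an $H$-module $M$ with character $S|_H$, let $\mathrm{Ind}_H^L(M,S)=u(L,S)\otimes_{u(H,S|_H)}M$, an $L$-module with character $S$. For a module $V$ over $L$ or over $L^\lambda$, put $V^\lambda=\{v\in V\mid y\cdot v=\lambda(y)v \text{ for all } y\in I\}$; $\lambda$ is called an eigenvalue function for $V$ if $V^\lambda\neq 0$. If $V$ is an $L$-module, then $V^\lambda$ is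 an $L^\lambda$-submodule of $V$. Let $A_S^\lambda$ be the set of isomorphism classes of irreducible $L$-modules with character $S$ and eigenvalue function $\lambda$, and let $B_S^\lambda$ be the set of isomorphism classes of irreducible $L^\lambda$-modules with character $S|_{L^\lambda}$ and eigenvalue function $\lambda$. Then $[V]\mapsto[V^\lambda]$ is a well-defined bijection $A_S^\lambda\to B_S^\lambda$, and its inverse is the well-defined map $B_S^\lambda\to A_S^\lambda$, $[M]\mapsto[\mathrm{Ind}_{L^\lambda}^L(M,S)]$. -/

import Mathlib

open scoped TensorProduct

universe u v w

namespace RestrictedLie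

section Basic

variable {F : Type u} {L : Type v} [Field F] [LieRing L] [LieAlgebra F L]

/-- A `p`-mapping `x ↦ x^[p]` on a Lie algebra `L` over a field `F` of characteristic `p`.
In the last axiom `s i` is the element `s_i(a, b)` of `L`: the elements `s_1(a, b), …,
s_{p-1}(a, b)` are uniquely determined by
`(ad (X ⊗ a + 1 ⊗ b))^(p-1) (1 ⊗ a) = ∑_{i=1}^{p-1} i X^(i-1) ⊗ s_i(a, b)` in `F[X] ⊗ L`. -/
structure IsPMapping (p : ℕ) (F : Type u) {L : Type v} [Field F] [LieRing L] [LieAlgebra F L]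
    (φ : L → L) : Prop where
  ad_pow : ∀ a : L, LieAlgebra.ad F L (φ a) = LieAlgebra.ad F L a ^ p
  map_smul : ∀ (c : F) (a : L), φ (c • a) = c ^ p • φ a
  map_add : ∀ a b : L, ∃ s : ℕ → L,
    (LieAlgebra.ad (Polynomial F) (Polynomial F ⊗[F] L)
        ((Polynomial.X : Polynomial F) ⊗ₜ[F] a + (1 : Polynomial F) ⊗ₜ[F] b) ^ (p - 1))
        ((1 : Polynomial F) ⊗ₜ[F] a)
      = ∑ i ∈ Finset.Icc 1 (p - 1),
          ((i : Polynomial F) * Polynomial.X ^ (i - 1)) ⊗ₜ[F] s i ∧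
    φ (a + b) = φ a + φ b + ∑ i ∈ Finset.Icc 1 (p - 1), s i

/-- `H` is a `p`-subalgebra: it is closed under the `p`-mapping `φ`. -/
def IsPSubalgebra (φ : L → L) (H : LieSubalgebra F L) : Prop :=
  ∀ x ∈ H, φ x ∈ H

/-- The restriction of the `p`-mapping to a `p`-subalgebra. -/
def restrictPMap (φ : L → L) (H : LieSubalgebra F L) (hH : IsPSubalgebra φ H) : H → H :=
  fun x => ⟨φ x, hH x x.2⟩

/-- The restriction `S|_H` of a linear form. -/
def restrictForm (S : L →ₗ[F] F) (H : LieSubalgebra F L) : H →ₗ[F] F :=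
  S ∘ₗ H.toSubmodule.subtype

/-- The `L`-module `V` has character `S`: `ρ(x)^p - ρ(x^[p]) = S(x)^p id_V` for all `x`. -/
def HasCharacter (p : ℕ) (φ : L → L) (S : L →ₗ[F] F) (V : Type w) [AddCommGroup V] [Module F V]
    [LieRingModule L V] [LieModule F L V] : Prop :=
  ∀ x : L, LieModule.toEnd F L V x ^ p - LieModule.toEnd F L V (φ x)
    = S x ^ p • (1 : Module.End F V)

/-- `V^λ = {v ∈ V | y v = λ(y) v for all y ∈ I}`. -/
def eigenspace (I : LieIdeal F L) (lam : I →ₗ[F] F) (V : Type w) [AddCommGroup V] [Module F V]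
    [LieRingModule L V] [LieModule F L V] : Submodule F V where
  carrier := {v | ∀ y : I, ⁅(y : L), v⁆ = lam y • v}
  add_mem' := by
    intro a b ha hb y
    rw [lie_add, ha y, hb y, smul_add]
  zero_mem' := by
    intro y
    simp
  smul_mem' := by
    intro c v hv y
    rw [lie_smul, hv y, smul_comm]

/-- `λ` is an eigenvalue function for `V`: `V^λ ≠ 0`. -/
def IsEigenvalueFunction (I : LieIdeal F L) (lam : I →ₗ[F] F) (V : Type w) [AddCommGroup V]
    [Module F V] [LieRingModule L V] [LieModule F L V] : Prop :=
  eigenspace I lam V ≠ ⊥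

/-- `L^λ = {x ∈ L | λ([x, y]) = 0 for all y ∈ I}`. -/
def stabilizer (I : LieIdeal F L) (lam : I →ₗ[F] F) : LieSubalgebra F L where
  carrier := {x | ∀ y : I, lam ⁅x, y⁆ = 0}
  add_mem' := by
    intro a b ha hb y
    rw [add_lie, map_add, ha y, hb y, add_zero]
  zero_mem' := by
    intro y
    simp
  smul_mem' := by
    intro c x hx y
    rw [smul_lie, map_smul, hx y, smul_zero]
  lie_mem' := by
    intro a b ha hb y
    rw [lie_lie, map_sub, ha, hb, sub_zero]

/-- `I` as an ideal of `L^λ` (when `λ` vanishes on `[I, I]`, the whole of `I` lies in `L^λ`). -/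
def stabIdeal (I : LieIdeal F L) (lam : I →ₗ[F] F) : LieIdeal F (stabilizer I lam) :=
  LieIdeal.comap (stabilizer I lam).incl I

/-- `λ` as a linear form on the ideal `I` of `L^λ`. -/
def stabForm (I : LieIdeal F L) (lam : I →ₗ[F] F) : stabIdeal I lam →ₗ[F] F where
  toFun y := lam ⟨((y : stabilizer I lam) : L), y.2⟩
  map_add' a b := map_add lam ⟨((a : stabilizer I lam) : L), a.2⟩
    ⟨((b : stabilizer I lam) : L), b.2⟩
  map_smul' c a := map_smul lam c ⟨((a : stabilizer I lam) : L), a.2⟩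

/-- `V^λ` as an `L^λ`-submodule of `V`. -/
def eigenModule (I : LieIdeal F L) (lam : I →ₗ[F] F) (V : Type w) [AddCommGroup V] [Module F V]
    [LieRingModule L V] [LieModule F L V] : LieSubmodule F (stabilizer I lam) V where
  __ := eigenspace I lam V
  lie_mem := by
    intro x v hv y
    have hv' : ∀ y : I, ⁅(y : L), v⁆ = lam y • v := hv
    have h1 : ⁅(x : L), (y : L)⁆ = ((⁅(x : L), y⁆ : I) : L) := rfl
    have h2 : ⁅⁅(x : L), (y : L)⁆, v⁆ = 0 := by
      rw [h1, hv', x.2 y, zero_smul]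
    have h3 : ⁅(y : L), ⁅(x : L), v⁆⁆ = lam y • ⁅(x : L), v⁆ := by
      rw [lie_lie, sub_eq_zero, hv', lie_smul] at h2
      exact h2.symm
    exact h3

end Basic

section Enveloping

attribute [local instance] LieRing.ofAssociativeRing

variable {F : Type u} {L : Type v} [Field F] [LieRing L] [LieAlgebra F L]

/-- The relations `x^p = x^[p] + S(x)^p 1` in the universal enveloping algebra `U(L)`. -/
inductive ReducedRel (p : ℕ) (φ : L → L) (S : L →ₗ[F] F) :
    UniversalEnvelopingAlgebra F L → UniversalEnvelopingAlgebra F L → Prop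
  | pow (x : L) : ReducedRel p φ S (UniversalEnvelopingAlgebra.ι F x ^ p)
      (UniversalEnvelopingAlgebra.ι F (φ x)
        + algebraMap F (UniversalEnvelopingAlgebra F L) (S x ^ p))

/-- The `S`-reduced universal enveloping algebra `u(L, S)`: the quotient of `U(L)` by the two-sided
ideal generated by the elements `x^p - x^[p] - S(x)^p 1`, `x ∈ L`. -/
abbrev ReducedEnveloping (p : ℕ) (φ : L → L) (S : L →ₗ[F] F) : Type (max u v) :=
  RingQuot (ReducedRel p φ S)

namespace ReducedEnveloping

/-- The canonical map `L → u(L, S)`. -/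
noncomputable def ι (p : ℕ) (φ : L → L) (S : L →ₗ[F] F) : L →ₗ⁅F⁆ ReducedEnveloping p φ S :=
  ((RingQuot.mkAlgHom F (ReducedRel p φ S)).toLieHom).comp (UniversalEnvelopingAlgebra.ι F)

theorem ι_pow (p : ℕ) (φ : L → L) (S : L →ₗ[F] F) (x : L) :
    ι p φ S x ^ p = ι p φ S (φ x) + algebraMap F _ (S x ^ p) := by
  have h := RingQuot.mkAlgHom_rel F (ReducedRel.pow (p := p) (φ := φ) (S := S) x)
  rw [map_pow, map_add, AlgHom.commutes] at h
  exact h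

variable {p : ℕ} {φ : L → L} {S : L →ₗ[F] F} {A : Type w} [Ring A] [Algebra F A]

/-- The universal property of `u(L, S)`. -/
noncomputable def lift (f : L →ₗ⁅F⁆ A)
    (hf : ∀ x, f x ^ p = f (φ x) + algebraMap F A (S x ^ p)) :
    ReducedEnveloping p φ S →ₐ[F] A :=
  RingQuot.liftAlgHom F ⟨UniversalEnvelopingAlgebra.lift F f, by
    intro a b h
    cases h with
    | pow x =>
      rw [map_pow, map_add, AlgHom.commutes, UniversalEnvelopingAlgebra.lift_ι_apply,
        UniversalEnvelopingAlgebra.lift_ι_apply, hf]⟩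

theorem lift_ι (f : L →ₗ⁅F⁆ A)
    (hf : ∀ x, f x ^ p = f (φ x) + algebraMap F A (S x ^ p)) (x : L) :
    lift f hf (ι p φ S x) = f x := by
  change RingQuot.liftAlgHom F _ (RingQuot.mkAlgHom F _ (UniversalEnvelopingAlgebra.ι F x)) = f x
  rw [RingQuot.liftAlgHom_mkAlgHom_apply, UniversalEnvelopingAlgebra.lift_ι_apply]

theorem hom_ext {f g : ReducedEnveloping p φ S →ₐ[F] A}
    (h : ∀ x, f (ι p φ S x) = g (ι p φ S x)) : f = g := by
  apply RingQuot.ringQuot_ext'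
  apply UniversalEnvelopingAlgebra.hom_ext
  ext x
  exact h x

end ReducedEnveloping

/-- The homomorphism `u(H, S|_H) → u(L, S)` induced by the inclusion of a `p`-subalgebra. -/
noncomputable def inclHom (p : ℕ) (φ : L → L) (S : L →ₗ[F] F) (H : LieSubalgebra F L)
    (hH : IsPSubalgebra φ H) :
    ReducedEnveloping p (restrictPMap φ H hH) (restrictForm S H) →ₐ[F] ReducedEnveloping p φ S :=
  ReducedEnveloping.lift ((ReducedEnveloping.ι p φ S).comp H.incl)
    (fun x => ReducedEnveloping.ι_pow p φ S (x : L))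

/-- The action of `u(L, S)` on an `L`-module with character `S`. -/
noncomputable def envAction (p : ℕ) (φ : L → L) (S : L →ₗ[F] F) (V : Type w) [AddCommGroup V]
    [Module F V] [LieRingModule L V] [LieModule F L V] (hV : HasCharacter p φ S V) :
    ReducedEnveloping p φ S →ₐ[F] Module.End F V :=
  ReducedEnveloping.lift (LieModule.toEnd F L V) (fun x => by
    rw [← sub_eq_iff_eq_add', hV x, Algebra.algebraMap_eq_smul_one])

/-- The relations `a b ⊗ m - a ⊗ b m`, with `a ∈ u(L, S)` and `b ∈ u(H, S|_H)`, which define the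
tensor product over `u(H, S|_H)` as a quotient of the one over `F`. The set of relations is stable
under left multiplication by `u(L, S)`, so its `u(L, S)`-span is also its additive span. -/
noncomputable def balancedSubmodule (p : ℕ) (φ : L → L) (S : L →ₗ[F] F) (H : LieSubalgebra F L)
    (hH : IsPSubalgebra φ H) (M : Type w) [AddCommGroup M] [Module F M] [LieRingModule H M]
    [LieModule F H M] (hM : HasCharacter p (restrictPMap φ H hH) (restrictForm S H) M) :
    Submodule (ReducedEnveloping p φ S) (ReducedEnveloping p φ S ⊗[F] M) :=
  Submodule.span _ {t | ∃ (a : ReducedEnveloping p φ S)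
    (b : ReducedEnveloping p (restrictPMap φ H hH) (restrictForm S H)) (m : M),
    t = (a * inclHom p φ S H hH b) ⊗ₜ[F] m
      - a ⊗ₜ[F] (envAction p (restrictPMap φ H hH) (restrictForm S H) M hM b m)}

/-- The induced module `Ind_H^L(M, S) = u(L, S) ⊗_{u(H, S|_H)} M`. -/
def Ind (p : ℕ) (φ : L → L) (S : L →ₗ[F] F) (H : LieSubalgebra F L)
    (hH : IsPSubalgebra φ H) (M : Type w) [AddCommGroup M] [Module F M] [LieRingModule H M]
    [LieModule F H M] (hM : HasCharacter p (restrictPMap φ H hH) (restrictForm S H) M) :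
    Type (max u v w) :=
  (ReducedEnveloping p φ S ⊗[F] M) ⧸ balancedSubmodule p φ S H hH M hM

section IndInstances

variable (p : ℕ) (φ : L → L) (S : L →ₗ[F] F) (H : LieSubalgebra F L)
    (hH : IsPSubalgebra φ H) (M : Type w) [AddCommGroup M] [Module F M] [LieRingModule H M]
    [LieModule F H M] (hM : HasCharacter p (restrictPMap φ H hH) (restrictForm S H) M)

noncomputable instance : AddCommGroup (Ind p φ S H hH M hM) :=
  inferInstanceAs (AddCommGroup
    ((ReducedEnveloping p φ S ⊗[F] M) ⧸ balancedSubmodule p φ S H hH M hM))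

noncomputable instance : Module (ReducedEnveloping p φ S) (Ind p φ S H hH M hM) :=
  inferInstanceAs (Module (ReducedEnveloping p φ S)
    ((ReducedEnveloping p φ S ⊗[F] M) ⧸ balancedSubmodule p φ S H hH M hM))

noncomputable instance : Module F (Ind p φ S H hH M hM) :=
  inferInstanceAs (Module F
    ((ReducedEnveloping p φ S ⊗[F] M) ⧸ balancedSubmodule p φ S H hH M hM))

instance : IsScalarTower F (ReducedEnveloping p φ S) (Ind p φ S H hH M hM) :=
  inferInstanceAs (IsScalarTower F (ReducedEnveloping p φ S)
    ((ReducedEnveloping p φ S ⊗[F] M) ⧸ balancedSubmodule p φ S H hH M hM))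

/-- `x ∈ L` acts on `Ind_H^L(M, S)` through its image in `u(L, S)`. -/
noncomputable instance : LieRingModule L (Ind p φ S H hH M hM) where
  bracket x t := ReducedEnveloping.ι p φ S x • t
  add_lie x y t := by
    change ReducedEnveloping.ι p φ S (x + y) • t = _ • t + _ • t
    rw [map_add, add_smul]
  lie_add x t t' := smul_add _ t t'
  leibniz_lie x y t := by
    change _ • _ • t = ReducedEnveloping.ι p φ S ⁅x, y⁆ • t + _ • _ • t
    rw [LieHom.map_lie, LieRing.of_associative_ring_bracket, sub_smul, mul_smul, mul_smul,
      sub_add_cancel]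

instance : LieModule F L (Ind p φ S H hH M hM) where
  smul_lie c x t := by
    change ReducedEnveloping.ι p φ S (c • x) • t = c • (ReducedEnveloping.ι p φ S x • t)
    rw [map_smul, smul_assoc]
  lie_smul c x t := by
    change ReducedEnveloping.ι p φ S x • (c • t) = c • (ReducedEnveloping.ι p φ S x • t)
    rw [← algebraMap_smul (ReducedEnveloping p φ S) c t,
      ← algebraMap_smul (ReducedEnveloping p φ S) c (ReducedEnveloping.ι p φ S x • t),
      ← mul_smul, ← mul_smul, Algebra.commutes]

theorem ind_lie (x : L) (t : Ind p φ S H hH M hM) :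
    ⁅x, t⁆ = ReducedEnveloping.ι p φ S x • t := rfl

theorem ind_hasCharacter : HasCharacter p φ S (Ind p φ S H hH M hM) := by
  intro x
  have key : ∀ (n : ℕ) (t : Ind p φ S H hH M hM),
      (LieModule.toEnd F L (Ind p φ S H hH M hM) x ^ n) t = ReducedEnveloping.ι p φ S x ^ n • t := by
    intro n t
    induction n with
    | zero => simp
    | succ n ih =>
      rw [pow_succ', pow_succ', Module.End.mul_apply, ih, LieModule.toEnd_apply_apply, ind_lie,
        mul_smul]
  ext t
  rw [LinearMap.sub_apply, key, ReducedEnveloping.ι_pow, LieModule.toEnd_apply_apply, ind_lie,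
    add_smul, add_sub_cancel_left, algebraMap_smul]
  rfl

end IndInstances

theorem equiv_lie {V W : Type w} [AddCommGroup V] [Module F V] [LieRingModule L V]
    [LieModule F L V] [AddCommGroup W] [Module F W] [LieRingModule L W] (e : V ≃ₗ⁅F,L⁆ W) (x : L)
    (v : V) :
    e ⁅x, v⁆ = ⁅x, e v⁆ :=
  e.toLieModuleHom.map_lie x v

theorem envAction_equiv (p : ℕ) (φ : L → L) (S : L →ₗ[F] F) {V W : Type w} [AddCommGroup V]
    [Module F V] [LieRingModule L V] [LieModule F L V] [AddCommGroup W] [Module F W]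
    [LieRingModule L W] [LieModule F L W] (hV : HasCharacter p φ S V) (hW : HasCharacter p φ S W)
    (e : V ≃ₗ⁅F,L⁆ W) (b : ReducedEnveloping p φ S) (v : V) :
    e (envAction p φ S V hV b v) = envAction p φ S W hW b (e v) := by
  have h : ((e.toLinearEquiv.conjAlgEquiv F).toAlgHom).comp (envAction p φ S V hV)
      = envAction p φ S W hW := by
    apply ReducedEnveloping.hom_ext
    intro x
    ext w
    simp only [envAction, AlgHom.comp_apply, ReducedEnveloping.lift_ι]
    change e ⁅x, e.symm w⁆ = ⁅x, w⁆
    rw [equiv_lie, LieModuleEquiv.apply_symm_apply]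
  rw [← h]
  change _ = e (envAction p φ S V hV b (e.symm (e v)))
  rw [LieModuleEquiv.symm_apply_apply]

/-- Isomorphic modules have isomorphic induced modules. -/
theorem ind_equiv (p : ℕ) (φ : L → L) (S : L →ₗ[F] F) (H : LieSubalgebra F L)
    (hH : IsPSubalgebra φ H) {M N : Type w} [AddCommGroup M] [Module F M] [LieRingModule H M]
    [LieModule F H M] [AddCommGroup N] [Module F N] [LieRingModule H N] [LieModule F H N]
    (hM : HasCharacter p (restrictPMap φ H hH) (restrictForm S H) M)
    (hN : HasCharacter p (restrictPMap φ H hH) (restrictForm S H) N) (e : M ≃ₗ⁅F,H⁆ N) :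
    Nonempty (Ind p φ S H hH M hM ≃ₗ⁅F,L⁆ Ind p φ S H hH N hN) := by
  let f : (ReducedEnveloping p φ S ⊗[F] M) ≃ₗ[ReducedEnveloping p φ S]
      (ReducedEnveloping p φ S ⊗[F] N) :=
    TensorProduct.AlgebraTensorModule.congr (LinearEquiv.refl _ _) e.toLinearEquiv
  have hf : ∀ a m, f (a ⊗ₜ[F] m) = a ⊗ₜ[F] (e m) := fun a m => rfl
  have hmap : (balancedSubmodule p φ S H hH M hM).map
      (f : (ReducedEnveloping p φ S ⊗[F] M) →ₗ[ReducedEnveloping p φ S]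
        (ReducedEnveloping p φ S ⊗[F] N)) = balancedSubmodule p φ S H hH N hN := by
    rw [balancedSubmodule, Submodule.map_span, balancedSubmodule]
    congr 1
    ext t
    constructor
    · rintro ⟨_, ⟨a, b, m, rfl⟩, rfl⟩
      refine ⟨a, b, e m, ?_⟩
      rw [LinearEquiv.coe_coe, map_sub, hf, hf, envAction_equiv p _ _ hM hN]
    · rintro ⟨a, b, n, rfl⟩
      refine ⟨_, ⟨a, b, e.symm n, rfl⟩, ?_⟩
      rw [LinearEquiv.coe_coe, map_sub, hf, hf, envAction_equiv p _ _ hM hN,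
        LieModuleEquiv.apply_symm_apply]
  let g : Ind p φ S H hH M hM ≃ₗ[ReducedEnveloping p φ S] Ind p φ S H hH N hN :=
    Submodule.Quotient.equiv _ _ f hmap
  exact ⟨{ g.restrictScalars F with
    map_lie' := fun {x t} => g.map_smul (ReducedEnveloping.ι p φ S x) t }⟩

end Enveloping

section Classes

variable {F : Type u} {L : Type v} [Field F] [LieRing L] [LieAlgebra F L]

/-- An `L`-module with character `S`. -/
structure SModule (p : ℕ) (φ : L → L) (S : L →ₗ[F] F) : Type (max u v (w + 1)) where
  carrier : Type w
  [addCommGroup : AddCommGroup carrier]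
  [module : Module F carrier]
  [lieRingModule : LieRingModule L carrier]
  [lieModule : LieModule F L carrier]
  hasCharacter : HasCharacter p φ S carrier

attribute [instance] SModule.addCommGroup SModule.module SModule.lieRingModule SModule.lieModule

/-- Isomorphism of `L`-modules. -/
instance SModule.setoid (p : ℕ) (φ : L → L) (S : L →ₗ[F] F) : Setoid (SModule.{u, v, w} p φ S) where
  r V W := Nonempty (V.carrier ≃ₗ⁅F,L⁆ W.carrier)
  iseqv := ⟨fun _ => ⟨LieModuleEquiv.refl⟩, fun ⟨e⟩ => ⟨e.symm⟩, fun ⟨e⟩ ⟨f⟩ => ⟨e.trans f⟩⟩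

/-- Isomorphism classes of `L`-modules with character `S`. -/
def IsoClass (p : ℕ) (φ : L → L) (S : L →ₗ[F] F) : Type (max u v (w + 1)) :=
  Quotient (SModule.setoid.{u, v, w} p φ S)

/-- The isomorphism class `[V]`. -/
def SModule.cls {p : ℕ} {φ : L → L} {S : L →ₗ[F] F} (V : SModule.{u, v, w} p φ S) :
    IsoClass.{u, v, w} p φ S :=
  Quotient.mk (SModule.setoid p φ S) V

/-- The isomorphism classes of irreducible `L`-modules with character `S` and eigenvalue function
`λ ∈ I*`. -/
def irreducibleClasses (p : ℕ) (φ : L → L) (S : L →ₗ[F] F) (I : LieIdeal F L) (lam : I →ₗ[F] F) :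
    Set (IsoClass.{u, v, w} p φ S) :=
  {c | ∃ V : SModule.{u, v, w} p φ S, V.cls = c ∧
    LieModule.IsIrreducible F L V.carrier ∧ IsEigenvalueFunction I lam V.carrier}

/-- `V^λ` as an `L^λ`-module with character `S|_{L^λ}`. -/
def SModule.eigen {p : ℕ} {φ : L → L} {S : L →ₗ[F] F} (I : LieIdeal F L) (lam : I →ₗ[F] F)
    (h : IsPSubalgebra φ (stabilizer I lam)) (V : SModule.{u, v, w} p φ S) :
    SModule.{u, v, w} p (restrictPMap φ (stabilizer I lam) h)
      (restrictForm S (stabilizer I lam)) where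
  carrier := eigenModule I lam V.carrier
  hasCharacter := by
    intro x
    have key : ∀ (n : ℕ) (v : eigenModule I lam V.carrier),
        (((LieModule.toEnd F (stabilizer I lam) (eigenModule I lam V.carrier) x ^ n) v :
          eigenModule I lam V.carrier) : V.carrier)
        = (LieModule.toEnd F L V.carrier (x : L) ^ n) (v : V.carrier) := by
      intro n v
      induction n with
      | zero => simp
      | succ n ih =>
        rw [pow_succ', pow_succ', Module.End.mul_apply, Module.End.mul_apply, ← ih]
        rfl
    ext v
    have h1 := LinearMap.congr_fun (V.hasCharacter (x : L)) (v : V.carrier)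
    rw [LinearMap.sub_apply, ← key] at h1
    exact h1

/-- The induced module `Ind_H^L(M, S)` as an `L`-module with character `S`. -/
noncomputable def SModule.ind {p : ℕ} {φ : L → L} {S : L →ₗ[F] F} (H : LieSubalgebra F L)
    (hH : IsPSubalgebra φ H)
    (M : SModule.{u, v, max u v w} p (restrictPMap φ H hH) (restrictForm S H)) :
    SModule.{u, v, max u v w} p φ S where
  carrier := Ind p φ S H hH M.carrier M.hasCharacter
  hasCharacter := ind_hasCharacter p φ S H hH M.carrier M.hasCharacter

/-- Isomorphic modules have isomorphic `λ`-eigenspaces. -/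
theorem eigen_equiv (I : LieIdeal F L) (lam : I →ₗ[F] F) {V W : Type w} [AddCommGroup V]
    [Module F V] [LieRingModule L V] [LieModule F L V] [AddCommGroup W] [Module F W]
    [LieRingModule L W] [LieModule F L W] (e : V ≃ₗ⁅F,L⁆ W) :
    Nonempty (eigenModule I lam V ≃ₗ⁅F,stabilizer I lam⁆ eigenModule I lam W) := by
  have h : ∀ {V W : Type w} [AddCommGroup V] [Module F V] [LieRingModule L V] [LieModule F L V]
      [AddCommGroup W] [Module F W] [LieRingModule L W] [LieModule F L W] (e : V ≃ₗ⁅F,L⁆ W)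
      (v : V), v ∈ eigenModule I lam V → e v ∈ eigenModule I lam W := by
    intro V W _ _ _ _ _ _ _ _ e v hv y
    have hv' : ⁅(y : L), v⁆ = lam y • v := hv y
    rw [← equiv_lie, hv']
    exact e.toLinearEquiv.map_smul _ _
  exact ⟨{
    toFun := fun v => ⟨e v, h e v v.2⟩
    map_add' := fun a b => Subtype.ext (e.toLinearEquiv.map_add _ _)
    map_smul' := fun c a => Subtype.ext (e.toLinearEquiv.map_smul _ _)
    map_lie' := fun {x v} => Subtype.ext (equiv_lie e (x : L) (v : V))
    invFun := fun w => ⟨e.symm w, h e.symm w w.2⟩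
    left_inv := fun v => Subtype.ext (e.symm_apply_apply _)
    right_inv := fun w => Subtype.ext (e.apply_symm_apply _) }⟩

/-- The isomorphism classes of irreducible `L^λ`-modules with character `S|_{L^λ}` and eigenvalue
function `λ`. -/
def irreducibleStabClasses (p : ℕ) (φ : L → L) (S : L →ₗ[F] F) (I : LieIdeal F L)
    (lam : I →ₗ[F] F) (h : IsPSubalgebra φ (stabilizer I lam)) :
    Set (IsoClass.{u, v, w} p (restrictPMap φ (stabilizer I lam) h)
      (restrictForm S (stabilizer I lam))) :=
  irreducibleClasses p (restrictPMap φ (stabilizer I lam) h) (restrictForm S (stabilizer I lam))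
    (stabIdeal I lam) (stabForm I lam)

/-- The map `[V] ↦ [V^λ]`. -/
def eigenMap {p : ℕ} {φ : L → L} (S : L →ₗ[F] F) (I : LieIdeal F L) (lam : I →ₗ[F] F)
    (h : IsPSubalgebra φ (stabilizer I lam)) :
    IsoClass.{u, v, w} p φ S →
      IsoClass.{u, v, w} p (restrictPMap φ (stabilizer I lam) h)
        (restrictForm S (stabilizer I lam)) :=
  Quotient.lift (fun V => (SModule.eigen I lam h V).cls)
    (fun _ _ ⟨e⟩ => Quotient.sound (eigen_equiv I lam e))

/-- The map `[M] ↦ [Ind_H^L(M, S)]`. -/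
noncomputable def indMap {p : ℕ} {φ : L → L} (S : L →ₗ[F] F) (H : LieSubalgebra F L)
    (hH : IsPSubalgebra φ H) :
    IsoClass.{u, v, max u v w} p (restrictPMap φ H hH) (restrictForm S H) →
      IsoClass.{u, v, max u v w} p φ S :=
  Quotient.lift (fun M => (SModule.ind.{u, v, w} H hH M).cls)
    (fun M N ⟨e⟩ => Quotient.sound (ind_equiv p φ S H hH M.hasCharacter N.hasCharacter e))

end Classes

end RestrictedLie

/-! Let `V` be an `L`-module with character `S`, `M ≤ V^λ` an `L^λ`-stable subspace, and `F_1 = M`,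
`F_{n+1} = F_n + L F_n` the filtration that `M` generates. For `y ∈ I` the operator `y - λ(y)`
lowers the filtration by one step. The pairing `λ([x, y])` on `L × I` has left kernel `L^λ`, so
there are `x_1, …, x_k` spanning `L` modulo `L^λ` and dual elements `y_1, …, y_k` of `I`. On the
associated graded space the `x_i` commute, `x_i^p` acts as zero because of the character, and `y_j -
λ(y_j)` acts like `-∂/∂x_j`. The Euler operator `E_j = x_j (y_j - λ(y_j))` therefore multiplies a
monomial by minus its exponent in `x_j`. By Fermat's little theorem `∏ (1 - E_j^(p-1))` annihilates
all monomials of positive degree with exponents below `p`, but it fixes every eigenvector. Hence the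
submodule generated by `M` meets `V^λ` exactly in `M` (`eigenvector_mem`). Moreover, in a module
generated by eigenvectors, a nonzero element of a submodule lying in the lowest possible step is
itself an eigenvector (`exists_eigenvector`).

These two facts make `V^λ` irreducible when `V` is, and reduce submodules of `Ind M` to submodules
of `M`; Schur's lemma then identifies `Ind (V^λ)` with `V`.

What remains is a Poincaré–Birkhoff–Witt statement: `M → Ind M` is injective (`indMk_injective`). In
the free algebra on bases of `L` and `M`, rewriting rules sort the letters of `L`, reduce `p`-th
powers and let the letters in `H` act on those of `M`. The critical pairs resolve by the Jacobi
identity, by `ad (x^[p]) = (ad x)^p`, by the module axiom and by the character of `M`. By Bergman's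
diamond lemma the letters of `M`, being irreducible words, stay linearly independent modulo the
rules. Jacobson's formula extends the power relations from the basis to all of `L`, so the quotient
by the rules is a `u(L, S)`-module and receives a map from `Ind M`. -/

namespace RestrictedLie

set_option linter.unusedSectionVars false

/-! ### Bergman's diamond lemma in a monoid algebra -/

section Rewriting

variable {F : Type*} [Field F] {W : Type*} [Monoid W]

/-- The span of the elements `u (R - ρ) v`, where `R → ρ` is a rewriting rule and the word `u R v`
satisfies `P`. -/
noncomputable def ruleSpan (rule : W → MonoidAlgebra F W → Prop) (P : W → Prop) :
    Submodule F (MonoidAlgebra F W) :=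
  Submodule.span F {t | ∃ u R v ρ, rule R ρ ∧ P (u * R * v) ∧
    t = MonoidAlgebra.of F W u * (MonoidAlgebra.of F W R - ρ) * MonoidAlgebra.of F W v}

/-- The span of the words satisfying `P`. -/
noncomputable def wordSpan (F : Type*) [Field F] {W : Type*} [Monoid W] (P : W → Prop) :
    Submodule F (MonoidAlgebra F W) :=
  Submodule.span F (MonoidAlgebra.of F W '' {w | P w})

theorem of_mem_wordSpan {P : W → Prop} {w : W} (h : P w) :
    MonoidAlgebra.of F W w ∈ wordSpan F P :=
  Submodule.subset_span ⟨w, h, rfl⟩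

theorem mem_wordSpan_true (t : MonoidAlgebra F W) : t ∈ wordSpan F (fun _ : W => True) := by
  induction t using MonoidAlgebra.induction_on with
  | of w => exact of_mem_wordSpan trivial
  | add a b ha hb => exact add_mem ha hb
  | smul c a ha => exact Submodule.smul_mem _ c ha

theorem wordSpan_mono {P Q : W → Prop} (h : ∀ w, P w → Q w) : wordSpan F P ≤ wordSpan F Q :=
  Submodule.span_mono (Set.image_mono fun w hw => h w hw)

theorem mul_mem_wordSpan {P Q R : W → Prop} (h : ∀ a b, P a → Q b → R (a * b))
    {s t : MonoidAlgebra F W} (hs : s ∈ wordSpan F P) (ht : t ∈ wordSpan F Q) :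
    s * t ∈ wordSpan F R := by
  induction hs using Submodule.span_induction with
  | mem x hx =>
    obtain ⟨a, ha, rfl⟩ := hx
    induction ht using Submodule.span_induction with
    | mem y hy =>
      obtain ⟨b, hb, rfl⟩ := hy
      rw [← map_mul]
      exact of_mem_wordSpan (h a b ha hb)
    | zero => simp
    | add y z _ _ hy hz => rw [mul_add]; exact add_mem hy hz
    | smul c y _ hy => rw [mul_smul_comm]; exact Submodule.smul_mem _ c hy
  | zero => simp
  | add y z _ _ hy hz => rw [add_mul]; exact add_mem hy hz
  | smul c y _ hy => rw [smul_mul_assoc]; exact Submodule.smul_mem _ c hy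

variable {rule : W → MonoidAlgebra F W → Prop}

theorem mem_ruleSpan {P : W → Prop} {u R v : W} {ρ : MonoidAlgebra F W} (h : rule R ρ)
    (hP : P (u * R * v)) :
    MonoidAlgebra.of F W u * (MonoidAlgebra.of F W R - ρ) * MonoidAlgebra.of F W v
      ∈ ruleSpan rule P :=
  Submodule.subset_span ⟨u, R, v, ρ, h, hP, rfl⟩

theorem ruleSpan_mono {P Q : W → Prop} (h : ∀ w, P w → Q w) :
    ruleSpan rule P ≤ ruleSpan rule Q := by
  apply Submodule.span_mono
  rintro _ ⟨u, R, v, ρ, hr, hP, rfl⟩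
  exact ⟨u, R, v, ρ, hr, h _ hP, rfl⟩

/-- Multiplying relations by words on both sides. -/
theorem mul_mul_mem_ruleSpan {A P B Q : W → Prop}
    (h : ∀ a w b, A a → P w → B b → Q (a * w * b))
    {s t r : MonoidAlgebra F W} (hs : s ∈ wordSpan F A) (ht : t ∈ ruleSpan rule P)
    (hr : r ∈ wordSpan F B) :
    s * t * r ∈ ruleSpan rule Q := by
  induction hs using Submodule.span_induction with
  | mem x hx =>
    obtain ⟨a, ha, rfl⟩ := hx
    induction hr using Submodule.span_induction with
    | mem y hy =>
      obtain ⟨b, hb, rfl⟩ := hy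
      induction ht using Submodule.span_induction with
      | mem z hz =>
        obtain ⟨u, R, v, ρ, hr, hP, rfl⟩ := hz
        have e : MonoidAlgebra.of F W a * (MonoidAlgebra.of F W u * (MonoidAlgebra.of F W R - ρ) *
            MonoidAlgebra.of F W v) * MonoidAlgebra.of F W b = MonoidAlgebra.of F W (a * u) *
              (MonoidAlgebra.of F W R - ρ) * MonoidAlgebra.of F W (v * b) := by
          simp only [map_mul, mul_assoc]
        rw [e]
        refine mem_ruleSpan hr ?_
        have := h _ _ _ ha hP hb
        simpa only [mul_assoc] using this
      | zero => simp
      | add y z _ _ hy hz => rw [mul_add, add_mul]; exact add_mem hy hz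
      | smul c y _ hy =>
        rw [mul_smul_comm, smul_mul_assoc]; exact Submodule.smul_mem _ c hy
    | zero => simp
    | add y z _ _ hy hz => rw [mul_add]; exact add_mem hy hz
    | smul c y _ hy => rw [mul_smul_comm]; exact Submodule.smul_mem _ c hy
  | zero => simp
  | add y z _ _ hy hz => rw [add_mul, add_mul]; exact add_mem hy hz
  | smul c y _ hy => rw [smul_mul_assoc, smul_mul_assoc]; exact Submodule.smul_mem _ c hy

/-- The linear extension of a map defined on words. -/
noncomputable def wordLift (g : W → MonoidAlgebra F W) :
    MonoidAlgebra F W →ₗ[F] MonoidAlgebra F W :=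
  Finsupp.linearCombination F g ∘ₗ (MonoidAlgebra.coeffLinearEquiv F).toLinearMap

theorem wordLift_of (g : W → MonoidAlgebra F W) (w : W) :
    wordLift g (MonoidAlgebra.of F W w) = g w := by
  simp [wordLift, MonoidAlgebra.of]

/-- The word `w` is irreducible: no rule applies to it. -/
def IsIrreducibleWord (rule : W → MonoidAlgebra F W → Prop) (w : W) : Prop :=
  ∀ u R v ρ, rule R ρ → u * R * v ≠ w

open Classical in
/-- Normal forms, choosing an arbitrary reduction at each step. -/
noncomputable def normalForm (rule : W → MonoidAlgebra F W → Prop) {r : W → W → Prop}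
    (wf : WellFounded r) : W → MonoidAlgebra F W :=
  wf.fix fun w nf =>
    if h : ∃ t, ∃ u R v ρ, rule R ρ ∧ u * R * v = w ∧
        t = MonoidAlgebra.of F W u * ρ * MonoidAlgebra.of F W v then
      wordLift (fun w' => if h' : r w' w then nf w' h' else 0) h.choose
    else MonoidAlgebra.of F W w

theorem normalForm_of_irreducible {r : W → W → Prop} (wf : WellFounded r) {w : W}
    (h : IsIrreducibleWord rule w) : normalForm rule wf w = MonoidAlgebra.of F W w := by
  rw [normalForm, wf.fix_eq, dif_neg]
  rintro ⟨_, u, R, v, ρ, hr, hw, -⟩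
  exact h u R v ρ hr hw

theorem exists_normalForm_eq {r : W → W → Prop} (wf : WellFounded r)
    (hr : ∀ a b u v, r a b → r (u * a * v) (u * b * v))
    (hρ : ∀ R ρ, rule R ρ → ρ ∈ wordSpan F (fun w => r w R)) {w : W}
    (h : ¬ IsIrreducibleWord rule w) : ∃ u R v ρ, rule R ρ ∧ u * R * v = w ∧
      normalForm rule wf w = wordLift (normalForm rule wf)
        (MonoidAlgebra.of F W u * ρ * MonoidAlgebra.of F W v) := by
  have h' : ∃ t, ∃ u R v ρ, rule R ρ ∧ u * R * v = w ∧
        t = MonoidAlgebra.of F W u * ρ * MonoidAlgebra.of F W v := by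
    simp only [IsIrreducibleWord, not_forall, not_not] at h
    obtain ⟨u, R, v, ρ, hr, hw⟩ := h
    exact ⟨_, u, R, v, ρ, hr, hw, rfl⟩
  obtain ⟨u, R, v, ρ, hrule, hw, ht⟩ := h'.choose_spec
  refine ⟨u, R, v, ρ, hrule, hw, ?_⟩
  conv_lhs => rw [normalForm, wf.fix_eq, dif_pos h']
  rw [← ht]
  -- The chosen reduct involves only words below `w`, so the default value 0 in the recursion is
  -- never reached.
  have hmem : h'.choose ∈ wordSpan F (fun x => r x w) := by
    rw [ht, ← hw]
    refine mul_mem_wordSpan (P := fun x => r x (u * R)) (Q := fun x => x = v) ?_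
      (mul_mem_wordSpan (P := fun x => x = u) (Q := fun x => r x R) ?_
        (of_mem_wordSpan rfl) (hρ R ρ hrule)) (of_mem_wordSpan rfl)
    · rintro a _ ha rfl
      simpa using hr _ _ 1 _ ha
    · rintro _ b rfl hb
      simpa using hr _ _ _ 1 hb
  generalize h'.choose = t at hmem
  induction hmem using Submodule.span_induction with
  | mem x hx =>
    obtain ⟨a, ha, rfl⟩ := hx
    rw [wordLift_of, wordLift_of, dif_pos (show r a w from ha)]
    rfl
  | zero => simp
  | add y z _ _ hy hz => rw [map_add, map_add, hy, hz]
  | smul c y _ hy => rw [map_smul, map_smul, hy]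

/-- Bergman's diamond lemma. -/
theorem exists_normalForm {r : W → W → Prop} (wf : WellFounded r)
    (hr : ∀ a b u v, r a b → r (u * a * v) (u * b * v))
    (hρ : ∀ R ρ, rule R ρ → ρ ∈ wordSpan F (fun w => r w R))
    (hconf : ∀ u R v ρ u' R' v' ρ', rule R ρ → rule R' ρ' → u * R * v = u' * R' * v' →
      MonoidAlgebra.of F W u * ρ * MonoidAlgebra.of F W v
        - MonoidAlgebra.of F W u' * ρ' * MonoidAlgebra.of F W v'
          ∈ ruleSpan rule (fun w => r w (u * R * v))) :
    ∃ N : MonoidAlgebra F W →ₗ[F] MonoidAlgebra F W,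
      (∀ w, IsIrreducibleWord rule w →
        N (MonoidAlgebra.of F W w) = MonoidAlgebra.of F W w) ∧
      ∀ t ∈ ruleSpan rule (fun _ => True), N t = 0 := by
  -- Any reduct of `w` differs from the one chosen by `normalForm` by relations at smaller words,
  -- which vanish by induction. So every reduction of `w` yields the same value.
  have key : ∀ w, ∀ u R v ρ, rule R ρ → u * R * v = w →
      wordLift (normalForm rule wf) (MonoidAlgebra.of F W u * (MonoidAlgebra.of F W R - ρ) *
        MonoidAlgebra.of F W v) = 0 := by
    intro w
    induction w using wf.induction with
    | _ w ih =>
    intro u R v ρ hrule hw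
    obtain ⟨u₀, R₀, v₀, ρ₀, hrule₀, hw₀, hnf⟩ :=
      exists_normalForm_eq (rule := rule) (w := w) wf hr hρ fun h => h u R v ρ hrule hw
    have hkill : ∀ t ∈ ruleSpan rule (fun w' => r w' w), wordLift (normalForm rule wf) t = 0 := by
      intro t ht
      induction ht using Submodule.span_induction with
      | mem x hx =>
        obtain ⟨u₁, R₁, v₁, ρ₁, hrule₁, hlt, rfl⟩ := hx
        exact ih _ hlt _ _ _ _ hrule₁ rfl
      | zero => simp
      | add y z _ _ hy hz => rw [map_add, hy, hz, add_zero]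
      | smul c y _ hy => rw [map_smul, hy, smul_zero]
    have h1 := hkill _ (hw₀ ▸ hconf u₀ R₀ v₀ ρ₀ u R v ρ hrule₀ hrule (hw₀.trans hw.symm))
    rw [map_sub, ← hnf, sub_eq_zero] at h1
    rw [mul_sub, sub_mul, map_sub, ← map_mul, ← map_mul, hw, wordLift_of, h1, sub_self]
  refine ⟨wordLift (normalForm rule wf), fun w hw => ?_, fun t ht => ?_⟩
  · rw [wordLift_of, normalForm_of_irreducible wf hw]
  · induction ht using Submodule.span_induction with
    | mem x hx =>
      obtain ⟨u₁, R₁, v₁, ρ₁, hrule₁, -, rfl⟩ := hx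
      exact key _ _ _ _ _ hrule₁ rfl
    | zero => simp
    | add y z _ _ hy hz => rw [map_add, hy, hz, add_zero]
    | smul c y _ hy => rw [map_smul, hy, smul_zero]

end Rewriting

/-! ### Reduction of confluence to overlaps and inclusions -/

section CriticalPairs

variable {F : Type*} [Field F] {X : Type*}

theorem freeMonoid_mul_eq_mul {a b c d : FreeMonoid X} (h : a * b = c * d) :
    (∃ e, c = a * e ∧ b = e * d) ∨ ∃ e, a = c * e ∧ d = e * b :=
  List.append_eq_append_iff.mp h

variable {rule : FreeMonoid X → MonoidAlgebra F (FreeMonoid X) → Prop}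

/-- It suffices to resolve overlap and inclusion ambiguities. -/
theorem confluent_of_criticalPairs {r : FreeMonoid X → FreeMonoid X → Prop}
    (hr : ∀ a b u v, r a b → r (u * a * v) (u * b * v))
    (hρ : ∀ R ρ, rule R ρ → ρ ∈ wordSpan F (fun w => r w R))
    (hover : ∀ c d e ρ ρ', d ≠ 1 → rule (c * d) ρ → rule (d * e) ρ' →
      ρ * MonoidAlgebra.of F _ e - MonoidAlgebra.of F _ c * ρ'
        ∈ ruleSpan rule (fun w => r w (c * d * e)))
    (hincl : ∀ c R e ρ ρ', rule (c * R * e) ρ → rule R ρ' →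
      ρ - MonoidAlgebra.of F _ c * ρ' * MonoidAlgebra.of F _ e
        ∈ ruleSpan rule (fun w => r w (c * R * e)))
    (u R v ρ u' R' v' ρ') (h : rule R ρ) (h' : rule R' ρ') (huv : u * R * v = u' * R' * v') :
    MonoidAlgebra.of F _ u * ρ * MonoidAlgebra.of F _ v
      - MonoidAlgebra.of F _ u' * ρ' * MonoidAlgebra.of F _ v'
        ∈ ruleSpan rule (fun w => r w (u * R * v)) := by
  -- By symmetry the occurrence of `R` may be assumed to start no later than that of `R'`.
  have half : ∀ u R v ρ u' R' v' ρ', rule R ρ → rule R' ρ' → u * R * v = u' * R' * v' →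
      (∃ c, u' = u * c ∧ R * v = c * (R' * v')) →
      MonoidAlgebra.of F _ u * ρ * MonoidAlgebra.of F _ v
      - MonoidAlgebra.of F _ u' * ρ' * MonoidAlgebra.of F _ v'
        ∈ ruleSpan rule (fun w => r w (u * R * v)) := by
    rintro u R v ρ _ R' v' ρ' h h' - ⟨c, rfl, hc⟩
    have ctx : ∀ (a b : FreeMonoid X) (w : FreeMonoid X) (t), 
        t ∈ ruleSpan rule (fun x => r x w) →
        MonoidAlgebra.of F _ a * t * MonoidAlgebra.of F _ b
          ∈ ruleSpan rule (fun x => r x (a * w * b)) := by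
      intro a b w t ht
      refine mul_mul_mem_ruleSpan (A := fun x => x = a) (B := fun x => x = b) ?_
        (of_mem_wordSpan rfl) ht (of_mem_wordSpan rfl)
      rintro _ x _ rfl hx rfl
      exact hr _ _ _ _ hx
    -- Disjoint occurrences: `ρ d R' - R d ρ' = ρ d (R' - ρ') - (R - ρ) d ρ'`, and both terms live
    -- at words below `R d R'` because `ρ` and `ρ'` are below `R` and `R'`.
    have disj : ∀ (R d R' : FreeMonoid X) (ρ ρ'), rule R ρ → rule R' ρ' →
        ρ * MonoidAlgebra.of F _ (d * R') - MonoidAlgebra.of F _ (R * d) * ρ'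
        ∈ ruleSpan rule (fun w => r w (R * d * R')) := by
      intro R d R' ρ ρ' h h'
      have e : ρ * MonoidAlgebra.of F _ (d * R') - MonoidAlgebra.of F _ (R * d) * ρ'
          = ρ * (MonoidAlgebra.of F _ d * (MonoidAlgebra.of F _ R' - ρ')
              * MonoidAlgebra.of F _ 1) * MonoidAlgebra.of F _ 1
            - (MonoidAlgebra.of F _ 1 * (MonoidAlgebra.of F _ 1 *
              (MonoidAlgebra.of F _ R - ρ) * MonoidAlgebra.of F _ d) * ρ') := by
        simp only [map_mul, map_one, mul_one, one_mul, mul_sub, sub_mul, mul_assoc]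
        abel
      rw [e]
      refine sub_mem ?_ ?_
      · refine mul_mul_mem_ruleSpan (A := fun w => r w R) (P := fun w => w = d * R')
          (B := fun w => w = 1) ?_ (hρ _ _ h) (mem_ruleSpan h' (by simp))
          (of_mem_wordSpan rfl)
        rintro a _ _ ha rfl rfl
        simpa [mul_assoc] using hr _ _ 1 (d * R') ha
      · refine mul_mul_mem_ruleSpan (A := fun w => w = 1) (P := fun w => w = R * d)
          (B := fun w => r w R') ?_ (of_mem_wordSpan rfl) (mem_ruleSpan h (by simp))
          (hρ _ _ h')
        rintro _ _ b rfl rfl hb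
        simpa [mul_assoc] using hr _ _ (R * d) 1 hb
    obtain ⟨d, rfl, rfl⟩ | ⟨d, rfl, hd⟩ := freeMonoid_mul_eq_mul hc
    · have := ctx u v' _ _ (disj R d R' ρ ρ' h h')
      simpa only [map_mul, mul_sub, sub_mul, mul_assoc] using this
    · obtain ⟨e, rfl, rfl⟩ | ⟨e, rfl, rfl⟩ := freeMonoid_mul_eq_mul hd
      · have := ctx u v _ _ (hincl c R' e ρ ρ' (by rwa [mul_assoc]) h')
        simpa only [map_mul, mul_sub, sub_mul, mul_assoc] using this
      -- An empty overlap means adjacent occurrences, which are again disjoint.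
      · by_cases hd1 : d = 1
        · subst hd1
          have := ctx u v' _ _ (disj c 1 e ρ ρ' (by simpa using h) (by simpa using h'))
          simpa only [map_mul, mul_sub, sub_mul, mul_assoc, one_mul, mul_one] using this
        · have := ctx u v' _ _ (hover c d e ρ ρ' hd1 h h')
          simpa only [map_mul, mul_sub, sub_mul, mul_assoc] using this
  have huv' := huv
  rw [mul_assoc, mul_assoc] at huv
  obtain ⟨e, he, he'⟩ | ⟨e, he, he'⟩ := freeMonoid_mul_eq_mul huv
  · exact half _ _ _ _ _ _ _ _ h h' huv' ⟨e, he, he'⟩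
  · rw [← neg_mem_iff, neg_sub, huv']
    exact half _ _ _ _ _ _ _ _ h' h huv'.symm ⟨e, he, he'⟩

end CriticalPairs

/-! ### Powers of inner derivations in characteristic `p` -/

section CharPIdentities

/-- Pascal's rule: two consecutive coefficients of row `p - 1` add up to a coefficient of row `p`
that is divisible by `p`, so the signs alternate. -/
theorem choose_pred_prime_cast (F : Type*) [Field F] (p : ℕ) [hp : Fact p.Prime] [CharP F p] (k : ℕ)
    (hk : k < p) : ((p - 1).choose k : F) = (-1) ^ k := by
  induction k with
  | zero => simp
  | succ k ih =>
    have h1 : (p - 1 + 1).choose (k + 1) = (p - 1).choose k + (p - 1).choose (k + 1) :=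
      Nat.choose_succ_succ _ _
    rw [Nat.sub_add_cancel hp.out.one_le] at h1
    have h2 : (p.choose (k + 1) : F) = 0 :=
      (CharP.cast_eq_zero_iff F p _).2 (hp.out.dvd_choose_self (Nat.succ_ne_zero k) hk)
    rw [h1, Nat.cast_add, ih (by omega)] at h2
    rw [pow_succ]
    linear_combination h2

/-- In characteristic `p`, `(x - y)^(p-1) = ∑ x^i y^(p-1-i)` for commuting `x`, `y`. -/
theorem sub_pow_pred_eq_sum (F : Type*) {R : Type*} [Field F] [Ring R] [Algebra F R] (p : ℕ)
    [hp : Fact p.Prime] [CharP F p] {x y : R} (h : Commute x y) :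
    (x - y) ^ (p - 1) = ∑ t ∈ Finset.range p, x ^ t * y ^ (p - 1 - t) := by
  rw [sub_eq_add_neg, (h.neg_right).add_pow, Nat.sub_add_cancel hp.out.one_le]
  refine Finset.sum_congr rfl fun t ht => ?_
  have ht' : t < p := Finset.mem_range.1 ht
  have h1 : ((p - 1).choose t : R) = (-1) ^ (p - 1 - t) := by
    rw [← Nat.choose_symm (by omega)]
    have := congrArg (algebraMap F R) (choose_pred_prime_cast F p (p - 1 - t) (by omega))
    simpa using this
  rw [neg_pow y, h1, mul_assoc, mul_assoc,
    ← ((Commute.neg_one_left y).pow_pow (p - 1 - t) (p - 1 - t)).eq, ← mul_assoc ((-1) ^ _),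
    ← (Commute.refl (-1 : R)).mul_pow, neg_one_mul, neg_neg, one_pow, one_mul]

variable (F : Type*) {A : Type*} [Field F] [Ring A] [Algebra F A]

/-- The inner derivation `a ↦ x a - a x`. -/
noncomputable def innerDer (x : A) : Module.End F A := LinearMap.mulLeft F x - LinearMap.mulRight F x

theorem innerDer_apply (x a : A) : innerDer F x a = x * a - a * x := rfl

/-- Left and right multiplication by `x` commute, so the preceding identity applies to their
difference. -/
theorem innerDer_pow_pred (p : ℕ) [Fact p.Prime] [CharP F p] (x a : A) :
    (innerDer F x ^ (p - 1)) a = ∑ t ∈ Finset.range p, x ^ t * a * x ^ (p - 1 - t) := by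
  rw [innerDer, sub_pow_pred_eq_sum F p (LinearMap.commute_mulLeft_right x x),
    LinearMap.sum_apply]
  refine Finset.sum_congr rfl fun t _ => ?_
  rw [LinearMap.pow_mulLeft, LinearMap.pow_mulRight, Module.End.mul_apply,
    LinearMap.mulLeft_apply, LinearMap.mulRight_apply, mul_assoc]

/-- The sum telescopes. -/
theorem sum_pow_mul_commutator (n : ℕ) (x y : A) :
    ∑ t ∈ Finset.range n, x ^ t * (x * y - y * x) * x ^ (n - 1 - t) = x ^ n * y - y * x ^ n := by
  have h : ∀ t ∈ Finset.range n, x ^ t * (x * y - y * x) * x ^ (n - 1 - t)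
      = x ^ (t + 1) * y * x ^ (n - (t + 1)) - x ^ t * y * x ^ (n - t) := by
    intro t ht
    have ht' := Finset.mem_range.1 ht
    have e1 : n - 1 - t = n - (t + 1) := by omega
    have e2 : n - t = (n - (t + 1)) + 1 := by omega
    rw [e1, e2, pow_succ, pow_succ' x (n - (t + 1))]
    noncomm_ring
  rw [Finset.sum_congr rfl h, Finset.sum_range_sub (fun t => x ^ t * y * x ^ (n - t))]
  simp

end CharPIdentities

/-! ### Shortlex order on words and factorizations of short words -/

section Words

variable {ι κ : Type*} [LinearOrder ι]

/-- The rank of a letter: its index for a basis element of `L`, and bottom for one of `M`. -/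
def letterRank : ι ⊕ κ → WithBot ι := Sum.elim (fun i => i) (fun _ => ⊥)

/-- The length-lexicographic order on words by rank. -/
def wordLT (a b : FreeMonoid (ι ⊕ κ)) : Prop :=
  List.Shortlex (· < ·) (a.toList.map letterRank) (b.toList.map letterRank)

theorem wordLT_wf [WellFoundedLT ι] : WellFounded (wordLT (ι := ι) (κ := κ)) :=
  InvImage.wf (fun a : FreeMonoid (ι ⊕ κ) => a.toList.map letterRank)
    (List.Shortlex.wf (wellFounded_lt (α := WithBot ι)))

theorem wordLT_of_length {a b : FreeMonoid (ι ⊕ κ)} (h : a.length < b.length) : wordLT a b := by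
  apply List.Shortlex.of_length_lt
  rw [List.length_map, List.length_map]
  exact h

/-- Equal lengths exclude the case where `a` is a proper prefix of `b`, the only one in which
appending could reverse the order. -/
theorem list_lex_append_right {α : Type*} {r : α → α → Prop} {a b : List α} (c d : List α)
    (hl : a.length = b.length) (h : List.Lex r a b) : List.Lex r (a ++ c) (b ++ d) := by
  induction h with
  | nil => simp at hl
  | cons _ ih => exact List.Lex.cons (ih (by simpa using hl))
  | rel h => exact List.Lex.rel h

theorem wordLT_mul {a b : FreeMonoid (ι ⊕ κ)} (u v : FreeMonoid (ι ⊕ κ)) (h : wordLT a b) :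
    wordLT (u * a * v) (u * b * v) := by
  unfold wordLT at *
  simp only [FreeMonoid.toList_mul, List.map_append, List.append_assoc]
  apply List.Shortlex.append_left
  rcases List.shortlex_def.1 h with h | ⟨h1, h2⟩
  · apply List.Shortlex.of_length_lt
    simpa using h
  · exact List.Shortlex.of_lex (by simpa using h1) (list_lex_append_right _ _ h1 h2)

theorem wordLT_of_rank {a b : ι ⊕ κ} {u v v' : FreeMonoid (ι ⊕ κ)}
    (h : letterRank a < letterRank b) (hl : v.length = v'.length) :
    wordLT (u * FreeMonoid.of a * v) (u * FreeMonoid.of b * v') := by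
  unfold wordLT
  simp only [FreeMonoid.toList_mul, List.map_append, List.append_assoc]
  apply List.Shortlex.append_left
  refine List.Shortlex.of_lex ?_ (List.Lex.rel h)
  simpa [FreeMonoid.toList_of] using show v.toList.length = v'.toList.length from hl

theorem freeMonoid_toList_of_pow {X : Type*} (x : X) (n : ℕ) :
    (FreeMonoid.of x ^ n).toList = List.replicate n x := by
  induction n with
  | zero => rfl
  | succ n ih => rw [pow_succ', FreeMonoid.toList_mul, ih]; rfl

theorem freeMonoid_length_of_pow {X : Type*} (x : X) (n : ℕ) :
    (FreeMonoid.of x ^ n).length = n := by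
  change (FreeMonoid.of x ^ n).toList.length = n
  rw [freeMonoid_toList_of_pow, List.length_replicate]

theorem freeMonoid_mul_eq_of_pow {X : Type*} {x : X} {n : ℕ} {a b : FreeMonoid X}
    (h : a * b = FreeMonoid.of x ^ n) : 
    a = FreeMonoid.of x ^ a.length ∧ b = FreeMonoid.of x ^ b.length ∧ a.length + b.length = n := by
  have h' := congrArg FreeMonoid.toList h
  rw [freeMonoid_toList_of_pow, FreeMonoid.toList_mul, List.append_eq_replicate_iff] at h'
  obtain ⟨h1, h2, h3⟩ := h'
  refine ⟨FreeMonoid.toList.injective ?_, FreeMonoid.toList.injective ?_, h1⟩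
  · rw [freeMonoid_toList_of_pow]; exact h2
  · rw [freeMonoid_toList_of_pow]; exact h3

theorem freeMonoid_mul_eq_pair {X : Type*} {x y : X} {a b : FreeMonoid X}
    (h : a * b = FreeMonoid.of x * FreeMonoid.of y) :
    (a = 1 ∧ b = FreeMonoid.of x * FreeMonoid.of y) ∨ (a = FreeMonoid.of x ∧ b = FreeMonoid.of y) ∨
      (a = FreeMonoid.of x * FreeMonoid.of y ∧ b = 1) := by
  have h' : a.toList ++ b.toList = [x, y] := congrArg FreeMonoid.toList h
  rcases ha : a.toList with _ | ⟨c, _ | ⟨d, l⟩⟩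
  · left
    rw [ha] at h'
    exact ⟨ha, h'⟩
  · rw [ha] at h'
    simp only [List.cons_append, List.nil_append, List.cons.injEq] at h'
    right; left
    exact ⟨by rw [← h'.1]; exact ha, h'.2⟩
  · rw [ha] at h'
    simp only [List.cons_append, List.cons.injEq, List.append_eq_nil_iff] at h'
    obtain ⟨rfl, rfl, rfl, hb⟩ := h'
    right; right
    exact ⟨ha, hb⟩

theorem freeMonoid_mul_eq_mul_of {X : Type*} {x y : X} {a b : FreeMonoid X}
    (h : FreeMonoid.of x * a = FreeMonoid.of y * b) : x = y ∧ a = b := by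
  have h' : x :: a.toList = y :: b.toList := congrArg FreeMonoid.toList h
  exact ⟨(List.cons.inj h').1, (List.cons.inj h').2⟩

theorem freeMonoid_pair_inj {X : Type*} {x y x' y' : X}
    (h : FreeMonoid.of x * FreeMonoid.of y = FreeMonoid.of x' * FreeMonoid.of y') :
    x = x' ∧ y = y' := by
  have h' : [x, y] = [x', y'] := congrArg FreeMonoid.toList h
  simpa using h'

theorem freeMonoid_pair_eq_of_pow {X : Type*} {x y z : X} {n : ℕ}
    (h : FreeMonoid.of x * FreeMonoid.of y = FreeMonoid.of z ^ n) : x = z ∧ y = z ∧ n = 2 := by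
  obtain ⟨h1, h2, h3⟩ := freeMonoid_mul_eq_of_pow h
  rw [FreeMonoid.length_of, pow_one] at h1 h2
  exact ⟨FreeMonoid.of_injective h1, FreeMonoid.of_injective h2, h3.symm⟩

end Words

/-! ### Rewriting rules of the induced module -/

section PBW

variable {F L M ι κ : Type*} [Field F] [LieRing L] [LieAlgebra F L] (H : LieSubalgebra F L)
  [AddCommGroup M] [Module F M] [LieRingModule H M] [LieModule F H M]
  (p : ℕ) (φ : L → L) (S : L →ₗ[F] F) (e : Module.Basis ι F L) (m : Module.Basis κ F M)

/-- The letter of a basis element of `L`, as a word. -/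
abbrev lieLetter (κ : Type*) {ι : Type*} (i : ι) : FreeMonoid (ι ⊕ κ) := FreeMonoid.of (Sum.inl i)

/-- The letter of a basis element of `M`, as a word. -/
abbrev modLetter (ι : Type*) {κ : Type*} (k : κ) : FreeMonoid (ι ⊕ κ) := FreeMonoid.of (Sum.inr k)

/-- `L` as the span of its letters in the free algebra. -/
noncomputable def lieEmb (κ : Type*) : L →ₗ[F] MonoidAlgebra F (FreeMonoid (ι ⊕ κ)) :=
  e.constr F fun i => MonoidAlgebra.of F _ (lieLetter κ i)

/-- `M` as the span of its letters in the free algebra. -/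
noncomputable def modEmb (ι : Type*) : M →ₗ[F] MonoidAlgebra F (FreeMonoid (ι ⊕ κ)) :=
  m.constr F fun k => MonoidAlgebra.of F _ (modLetter ι k)

theorem lieEmb_basis (i : ι) :
    lieEmb e κ (e i) = MonoidAlgebra.of F _ (lieLetter κ i) := by
  simp [lieEmb]

theorem modEmb_basis (k : κ) :
    modEmb m ι (m k) = MonoidAlgebra.of F _ (modLetter ι k) := by
  simp [modEmb]

/-- The rewriting rules for the induced module of an `H`-module `M`. -/
inductive InducedRule [LinearOrder ι] :
    FreeMonoid (ι ⊕ κ) → MonoidAlgebra F (FreeMonoid (ι ⊕ κ)) → Prop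
  | swap (i j : ι) (h : i < j) : InducedRule (lieLetter κ j * lieLetter κ i)
      (lieEmb e κ (e i) * lieEmb e κ (e j) + lieEmb e κ ⁅e j, e i⁆)
  | pow (i : ι) : InducedRule (lieLetter κ i ^ p)
      (lieEmb e κ (φ (e i)) + algebraMap F _ (S (e i) ^ p))
  | act (i : ι) (h : e i ∈ H) (k : κ) : InducedRule (lieLetter κ i * modLetter ι k)
      (modEmb m ι ⁅(⟨e i, h⟩ : H), m k⁆)

theorem lieEmb_mem (x : L) :
    lieEmb e κ x ∈ wordSpan F (fun w : FreeMonoid (ι ⊕ κ) => w.length = 1) := by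
  induction e.mem_span x using Submodule.span_induction with
  | mem x hx =>
    obtain ⟨i, rfl⟩ := hx
    rw [lieEmb_basis]
    exact of_mem_wordSpan (FreeMonoid.length_of _)
  | zero => simp
  | add x y _ _ hx hy => rw [map_add]; exact add_mem hx hy
  | smul c x _ hx => rw [map_smul]; exact Submodule.smul_mem _ c hx

theorem modEmb_mem (x : M) :
    modEmb m ι x ∈ wordSpan F (fun w : FreeMonoid (ι ⊕ κ) => w.length = 1) := by
  induction m.mem_span x using Submodule.span_induction with
  | mem x hx =>
    obtain ⟨i, rfl⟩ := hx
    rw [modEmb_basis]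
    exact of_mem_wordSpan (FreeMonoid.length_of _)
  | zero => simp
  | add x y _ _ hx hy => rw [map_add]; exact add_mem hx hy
  | smul c x _ hx => rw [map_smul]; exact Submodule.smul_mem _ c hx

theorem algebraMap_mem_wordSpan {W : Type*} [Monoid W] (c : F) :
    algebraMap F (MonoidAlgebra F W) c ∈ wordSpan F (fun w : W => w = 1) := by
  rw [Algebra.algebraMap_eq_smul_one, ← map_one (MonoidAlgebra.of F W)]
  exact Submodule.smul_mem _ c (of_mem_wordSpan rfl)

variable [LinearOrder ι]

/-- Swaps keep the length of their leading word and lower its first letter; every other term of a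
rule is shorter than the left side. For powers this needs `2 ≤ p`. -/
theorem inducedRule_lt (hp : 2 ≤ p) {R : FreeMonoid (ι ⊕ κ)} {ρ}
    (h : InducedRule H p φ S e m R ρ) : ρ ∈ wordSpan F (fun w => wordLT w R) := by
  have short : ∀ w : FreeMonoid (ι ⊕ κ), 1 < R.length → w.length = 1 → wordLT w R :=
    fun w h h' => wordLT_of_length (by omega)
  cases h with
  | swap i j h =>
    have hl : 1 < (lieLetter κ j * lieLetter κ i).length := by
      rw [FreeMonoid.length_mul, FreeMonoid.length_of, FreeMonoid.length_of]; omega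
    refine add_mem ?_ (wordSpan_mono (fun w => short w hl) (lieEmb_mem e _))
    rw [lieEmb_basis, lieEmb_basis, ← map_mul]
    refine of_mem_wordSpan ?_
    have := wordLT_of_rank (a := (Sum.inl i : ι ⊕ κ)) (b := Sum.inl j) (u := 1)
      (v := lieLetter κ j) (v' := lieLetter κ i) (WithBot.coe_lt_coe.2 h) rfl
    simpa using this
  | pow i =>
    have hl : 1 < (lieLetter κ i ^ p).length := by
      rw [freeMonoid_length_of_pow]; omega
    refine add_mem (wordSpan_mono (fun w => short w hl) (lieEmb_mem e _))
      (wordSpan_mono (fun w => ?_) (algebraMap_mem_wordSpan _))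
    rintro rfl
    refine wordLT_of_length ?_
    rw [FreeMonoid.length_one]
    omega
  | act i h k =>
    have hl : 1 < (lieLetter κ i * modLetter ι k).length := by
      rw [FreeMonoid.length_mul, FreeMonoid.length_of, FreeMonoid.length_of]; omega
    exact wordSpan_mono (fun w => short w hl) (modEmb_mem m _)

/-- The three kinds of left sides are disjoint, even for `p = 2`: a swapped pair has two different
letters, and only the action rule contains a letter of `M`. -/
theorem inducedRule_unique {w : FreeMonoid (ι ⊕ κ)} {ρ ρ'}
    (h : InducedRule H p φ S e m w ρ) (h' : InducedRule H p φ S e m w ρ') (hp : 2 ≤ p) :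
    ρ = ρ' := by
  generalize hw : w = w' at h'
  cases h with
  | swap i j h =>
    cases h' with
    | swap i' j' h' =>
      obtain ⟨h1, h2⟩ := freeMonoid_pair_inj hw
      obtain rfl := Sum.inl_injective h1
      obtain rfl := Sum.inl_injective h2
      rfl
    | pow i' =>
      obtain ⟨h1, h2, -⟩ := freeMonoid_pair_eq_of_pow hw
      exact absurd (Sum.inl_injective (h2.trans h1.symm)) h.ne
    | act i' h' k => exact absurd (freeMonoid_pair_inj hw).2 (by simp)
  | pow i =>
    cases h' with
    | swap i' j' h' =>
      obtain ⟨h1, h2, -⟩ := freeMonoid_pair_eq_of_pow hw.symm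
      exact absurd (Sum.inl_injective (h2.trans h1.symm)) h'.ne
    | pow i' =>
      have := congrArg FreeMonoid.toList hw
      rw [freeMonoid_toList_of_pow, freeMonoid_toList_of_pow, List.replicate_inj] at this
      obtain h | h := this.2
      · omega
      · obtain rfl := Sum.inl_injective h
        rfl
    | act i' h' k => exact absurd (freeMonoid_pair_eq_of_pow hw.symm).2.1 (by simp)
  | act i h k =>
    cases h' with
    | swap i' j' h' => exact absurd (freeMonoid_pair_inj hw).2 (by simp)
    | pow i' => exact absurd (freeMonoid_pair_eq_of_pow hw).2.1 (by simp)
    | act i' h' k' =>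
      obtain ⟨h1, h2⟩ := freeMonoid_pair_inj hw
      obtain rfl := Sum.inl_injective h1
      obtain rfl := Sum.inr_injective h2
      rfl

theorem inducedRule_two_le_length {w : FreeMonoid (ι ⊕ κ)} {ρ}
    (h : InducedRule H p φ S e m w ρ) (hp : 2 ≤ p) : 2 ≤ w.length := by
  cases h with
  | swap i j h => rw [FreeMonoid.length_mul, FreeMonoid.length_of, FreeMonoid.length_of]
  | pow i => rwa [freeMonoid_length_of_pow]
  | act i h k => rw [FreeMonoid.length_mul, FreeMonoid.length_of, FreeMonoid.length_of]

/-- A left side of length two has no room for a smaller one, and the factors of `e_i ^ p` are powers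
of `e_i`, among which only the whole word is a left side. -/
theorem inducedRule_no_inclusion {c R d : FreeMonoid (ι ⊕ κ)} {ρ ρ'}
    (h : InducedRule H p φ S e m (c * R * d) ρ) (h' : InducedRule H p φ S e m R ρ') (hp : 2 ≤ p) :
    c = 1 ∧ d = 1 := by
  have key : (c * R * d).length ≤ R.length → c = 1 ∧ d = 1 := by
    intro h
    rw [FreeMonoid.length_mul, FreeMonoid.length_mul] at h
    exact ⟨FreeMonoid.length_eq_zero.1 (by omega), FreeMonoid.length_eq_zero.1 (by omega)⟩
  have h2 := inducedRule_two_le_length H p φ S e m h' hp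
  generalize hw : c * R * d = w at h key
  cases h with
  | swap i j h =>
    refine key ?_
    rwa [FreeMonoid.length_mul, FreeMonoid.length_of, FreeMonoid.length_of]
  | act i h k =>
    refine key ?_
    rwa [FreeMonoid.length_mul, FreeMonoid.length_of, FreeMonoid.length_of]
  | pow i =>
    have hR := (freeMonoid_mul_eq_of_pow (freeMonoid_mul_eq_of_pow hw).1).2.1
    cases h' with
    | swap i' j' h' =>
      obtain ⟨h1, h2, -⟩ := freeMonoid_pair_eq_of_pow hR
      exact absurd (Sum.inl_injective (h2.trans h1.symm)) h'.ne
    | pow i' =>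
      refine key ?_
      rw [freeMonoid_length_of_pow, freeMonoid_length_of_pow]
    | act i' h' k => exact absurd (freeMonoid_pair_eq_of_pow hR).2.1 (by simp)

/-- `x y - y x - [x, y]` is a combination of rules of length at most two. -/
theorem lieEmb_commutator_mem (x y : L) :
    lieEmb e κ x * lieEmb e κ y - lieEmb e κ y * lieEmb e κ x - lieEmb e κ ⁅x, y⁆
      ∈ ruleSpan (InducedRule H p φ S e m) (fun w => w.length ≤ 2) := by
  have basic : ∀ i j, i < j →
      lieEmb e κ (e j) * lieEmb e κ (e i) - lieEmb e κ (e i) * lieEmb e κ (e j)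
        - lieEmb e κ ⁅e j, e i⁆
        ∈ ruleSpan (InducedRule H p φ S e m) (fun w => w.length ≤ 2) := by
    intro i j h
    have := mem_ruleSpan (P := fun w : FreeMonoid (ι ⊕ κ) => w.length ≤ 2) (u := 1) (v := 1)
      (InducedRule.swap (H := H) (p := p) (φ := φ) (S := S) (e := e) (m := m) i j h)
      (by simp [FreeMonoid.length_mul, FreeMonoid.length_of])
    simpa only [map_one, one_mul, mul_one, map_mul, lieEmb_basis, sub_sub] using this
  induction e.mem_span x using Submodule.span_induction with
  | mem x hx =>
    obtain ⟨i, rfl⟩ := hx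
    induction e.mem_span y using Submodule.span_induction with
    | mem y hy =>
      obtain ⟨j, rfl⟩ := hy
      rcases lt_trichotomy i j with h | rfl | h
      · have := neg_mem (basic i j h)
        rw [← lie_skew (e i) (e j), map_neg]
        convert this using 1
        abel
      · simp
      · exact basic j i h
    | zero => simp
    | add y z _ _ hy hz =>
      convert add_mem hy hz using 1
      rw [map_add, lie_add, map_add]; noncomm_ring
    | smul c y _ hy =>
      convert Submodule.smul_mem _ c hy using 1
      rw [map_smul, lie_smul, map_smul, mul_smul_comm, smul_mul_assoc, smul_sub, smul_sub]
  | zero => simp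
  | add y z _ _ hy hz =>
    convert add_mem hy hz using 1
    rw [map_add, add_lie, map_add]; noncomm_ring
  | smul c y _ hy =>
    convert Submodule.smul_mem _ c hy using 1
    rw [map_smul, smul_lie, map_smul, mul_smul_comm, smul_mul_assoc, smul_sub, smul_sub]

/-- `x m - [x, m]` is a combination of rules of length at most two, for `x ∈ H`. -/
theorem lieEmb_mul_modEmb_mem (hH : ∀ x ∈ H, x ∈ Submodule.span F (e '' {i | e i ∈ H}))
    (x : H) (y : M) :
    lieEmb e κ (x : L) * modEmb m ι y - modEmb m ι ⁅x, y⁆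
      ∈ ruleSpan (InducedRule H p φ S e m) (fun w => w.length ≤ 2) := by
  have key : ∀ x ∈ Submodule.span F (e '' {i | e i ∈ H}), ∃ hx : x ∈ H,
      lieEmb e κ x * modEmb m ι y - modEmb m ι ⁅(⟨x, hx⟩ : H), y⁆
      ∈ ruleSpan (InducedRule H p φ S e m) (fun w => w.length ≤ 2) := by
    intro x hx
    induction hx using Submodule.span_induction with
    | mem x hx =>
      obtain ⟨i, hi, rfl⟩ := hx
      refine ⟨hi, ?_⟩
      induction m.mem_span y using Submodule.span_induction with
      | mem y hy =>
        obtain ⟨k, rfl⟩ := hy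
        have := mem_ruleSpan (P := fun w : FreeMonoid (ι ⊕ κ) => w.length ≤ 2) (u := 1) (v := 1)
          (InducedRule.act (H := H) (p := p) (φ := φ) (S := S) (e := e) (m := m) i hi k)
          (by simp [FreeMonoid.length_mul, FreeMonoid.length_of])
        simpa only [map_one, one_mul, mul_one, map_mul, lieEmb_basis, modEmb_basis] using this
      | zero => simp
      | add y z _ _ hy hz =>
        convert add_mem hy hz using 1
        rw [map_add, lie_add, map_add]; noncomm_ring
      | smul c y _ hy =>
        convert Submodule.smul_mem _ c hy using 1
        rw [map_smul, lie_smul, map_smul, mul_smul_comm, smul_sub]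
    | zero =>
      refine ⟨H.zero_mem, ?_⟩
      have : (⟨0, H.zero_mem⟩ : H) = 0 := rfl
      rw [this]; simp
    | add a b _ _ ha hb =>
      obtain ⟨ha, ha'⟩ := ha
      obtain ⟨hb, hb'⟩ := hb
      refine ⟨H.add_mem ha hb, ?_⟩
      have : (⟨a + b, H.add_mem ha hb⟩ : H) = ⟨a, ha⟩ + ⟨b, hb⟩ := rfl
      rw [this]
      convert add_mem ha' hb' using 1
      rw [map_add, add_lie, map_add]; noncomm_ring
    | smul c a _ ha =>
      obtain ⟨ha, ha'⟩ := ha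
      refine ⟨H.smul_mem c ha, ?_⟩
      have : (⟨c • a, H.smul_mem c ha⟩ : H) = c • ⟨a, ha⟩ := rfl
      rw [this]
      convert Submodule.smul_mem _ c ha' using 1
      rw [map_smul, smul_lie, map_smul, smul_mul_assoc, smul_sub]
  exact (key x (hH x x.2)).2

/-- Multiplying short relations by short elements. -/
theorem mul_mem_ruleSpan_length {rule : FreeMonoid (ι ⊕ κ) → MonoidAlgebra F _ → Prop} {a b n k : ℕ}
    {s t r : MonoidAlgebra F (FreeMonoid (ι ⊕ κ))}
    (hs : s ∈ wordSpan F (fun w : FreeMonoid (ι ⊕ κ) => w.length = a))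
    (ht : t ∈ ruleSpan rule (fun w => w.length ≤ n))
    (hr : r ∈ wordSpan F (fun w : FreeMonoid (ι ⊕ κ) => w.length = b)) (h : a + n + b ≤ k) :
    s * t * r ∈ ruleSpan rule (fun w => w.length ≤ k) := by
  refine mul_mul_mem_ruleSpan ?_ hs ht hr
  intro x y z hx hy hz
  rw [FreeMonoid.length_mul, FreeMonoid.length_mul]
  omega

theorem one_mem_wordSpan : (1 : MonoidAlgebra F (FreeMonoid (ι ⊕ κ))) ∈
    wordSpan F (fun w : FreeMonoid (ι ⊕ κ) => w.length = 0) := by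
  rw [← map_one (MonoidAlgebra.of F (FreeMonoid (ι ⊕ κ)))]
  exact of_mem_wordSpan FreeMonoid.length_one

/-- Each commutator with `x` lengthens the relations by one letter. For `q = p - 1` the bound is
`p`, just below the length `p + 1` of the ambiguities between powers and swaps. -/
theorem innerDer_pow_lieEmb_mem (x a : L) (q : ℕ) :
    (innerDer F (lieEmb e κ x) ^ q) (lieEmb e κ a) - lieEmb e κ ((LieAlgebra.ad F L x ^ q) a)
      ∈ ruleSpan (InducedRule H p φ S e m) (fun w => w.length ≤ q + 1) := by
  induction q with
  | zero => simp
  | succ q ih =>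
    set t := (innerDer F (lieEmb e κ x) ^ q) (lieEmb e κ a)
      - lieEmb e κ ((LieAlgebra.ad F L x ^ q) a) with ht
    set b := (LieAlgebra.ad F L x ^ q) a with hb
    have h1 : lieEmb e κ x * t * 1 - 1 * t * lieEmb e κ x
        ∈ ruleSpan (InducedRule H p φ S e m) (fun w => w.length ≤ q + 1 + 1) :=
      sub_mem (mul_mem_ruleSpan_length (lieEmb_mem e x) ih one_mem_wordSpan (by omega))
        (mul_mem_ruleSpan_length one_mem_wordSpan ih (lieEmb_mem e x) (by omega))
    have h2 := ruleSpan_mono (Q := fun w : FreeMonoid (ι ⊕ κ) => w.length ≤ q + 1 + 1)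
      (fun w hw => by omega) (lieEmb_commutator_mem H p φ S e m x b)
    convert add_mem h1 h2 using 1
    rw [pow_succ', pow_succ', Module.End.mul_apply, Module.End.mul_apply, ← hb, LieAlgebra.ad_apply,
      innerDer_apply, ← sub_add_cancel ((innerDer F (lieEmb e κ x) ^ q) (lieEmb e κ a)) (lieEmb e κ b), ← ht]
    noncomm_ring

end PBW

/-! ### Resolution of the critical pairs -/

section Confluence

variable {F L M ι κ : Type*} [Field F] [LieRing L] [LieAlgebra F L] (H : LieSubalgebra F L)
  [AddCommGroup M] [Module F M] [LieRingModule H M] [LieModule F H M]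
  (p : ℕ) (φ : L → L) (S : L →ₗ[F] F) (e : Module.Basis ι F L) (m : Module.Basis κ F M)
  [LinearOrder ι]

theorem swap_mem_ruleSpan {P : FreeMonoid (ι ⊕ κ) → Prop} {i j : ι} (h : i < j)
    (u v : FreeMonoid (ι ⊕ κ)) (hP : P (u * (lieLetter κ j * lieLetter κ i) * v)) :
    MonoidAlgebra.of F _ u * (lieEmb e κ (e j) * lieEmb e κ (e i)
      - lieEmb e κ (e i) * lieEmb e κ (e j) - lieEmb e κ ⁅e j, e i⁆) * MonoidAlgebra.of F _ v
        ∈ ruleSpan (InducedRule H p φ S e m) P := by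
  have := mem_ruleSpan (P := P) (u := u) (v := v)
      (InducedRule.swap (H := H) (p := p) (φ := φ) (S := S) (e := e) (m := m) i j h) hP
  simpa only [map_mul, lieEmb_basis, sub_sub] using this

theorem pow_mem_ruleSpan {P : FreeMonoid (ι ⊕ κ) → Prop} (i : ι)
    (u v : FreeMonoid (ι ⊕ κ)) (hP : P (u * lieLetter κ i ^ p * v)) :
    MonoidAlgebra.of F _ u * (lieEmb e κ (e i) ^ p - (lieEmb e κ (φ (e i))
      + algebraMap F _ (S (e i) ^ p))) * MonoidAlgebra.of F _ v
        ∈ ruleSpan (InducedRule H p φ S e m) P := by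
  have := mem_ruleSpan (P := P) (u := u) (v := v)
      (InducedRule.pow (H := H) (p := p) (φ := φ) (S := S) (e := e) (m := m) i) hP
  simpa only [map_pow, lieEmb_basis] using this

theorem act_mem_ruleSpan {P : FreeMonoid (ι ⊕ κ) → Prop} (i : ι) (hi : e i ∈ H) (k : κ)
    (u v : FreeMonoid (ι ⊕ κ)) (hP : P (u * (lieLetter κ i * modLetter ι k) * v)) :
    MonoidAlgebra.of F _ u * (lieEmb e κ (e i) * modEmb m ι (m k)
      - modEmb m ι ⁅(⟨e i, hi⟩ : H), m k⁆) * MonoidAlgebra.of F _ v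
        ∈ ruleSpan (InducedRule H p φ S e m) P := by
  have := mem_ruleSpan (P := P) (u := u) (v := v)
      (InducedRule.act (H := H) (p := p) (φ := φ) (S := S) (e := e) (m := m) i hi k) hP
  simpa only [map_mul, lieEmb_basis, modEmb_basis] using this

theorem ruleSpan_length_le {rule : FreeMonoid (ι ⊕ κ) → MonoidAlgebra F _ → Prop} {n : ℕ}
    {w : FreeMonoid (ι ⊕ κ)} (h : n < w.length) :
    ruleSpan rule (fun x => x.length ≤ n) ≤ ruleSpan rule (fun x => wordLT x w) :=
  ruleSpan_mono fun _ hx => wordLT_of_length (lt_of_le_of_lt hx h)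

theorem lieEmb_pow_mem (x : L) (n : ℕ) :
    lieEmb e κ x ^ n ∈ wordSpan F (fun w : FreeMonoid (ι ⊕ κ) => w.length = n) := by
  induction n with
  | zero => rw [pow_zero]; exact one_mem_wordSpan
  | succ n ih =>
    rw [pow_succ]
    refine mul_mem_wordSpan ?_ ih (lieEmb_mem e x)
    intro a b ha hb
    rw [FreeMonoid.length_mul, ha, hb]

/-- Both reductions of `e_k e_j e_i` can be sorted to `e_i e_j e_k`. What is left are commutators
with brackets, handled by relations of length two, and their brackets cancel by the Jacobi identity.
-/
theorem swap_swap_resolves {i j k : ι} (hij : i < j) (hjk : j < k) :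
    (lieEmb e κ (e j) * lieEmb e κ (e k) + lieEmb e κ ⁅e k, e j⁆) * lieEmb e κ (e i)
      - lieEmb e κ (e k) * (lieEmb e κ (e i) * lieEmb e κ (e j) + lieEmb e κ ⁅e j, e i⁆)
      ∈ ruleSpan (InducedRule H p φ S e m)
        (fun w => wordLT w (lieLetter κ k * lieLetter κ j * lieLetter κ i)) := by
  have rank : ∀ {a b : ι}, a < b →
      letterRank (Sum.inl a : ι ⊕ κ) < letterRank (Sum.inl b : ι ⊕ κ) :=
    fun h => WithBot.coe_lt_coe.2 h
  have hshort : ruleSpan (InducedRule H p φ S e m) (fun x => x.length ≤ 2)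
      ≤ ruleSpan (InducedRule H p φ S e m)
        (fun w => wordLT w (lieLetter κ k * lieLetter κ j * lieLetter κ i)) :=
    ruleSpan_length_le (by simp [FreeMonoid.length_mul, FreeMonoid.length_of])
  have h1 := swap_mem_ruleSpan H p φ S e m (P := fun w => wordLT w (lieLetter κ k * lieLetter κ j *
    lieLetter κ i)) hij 1 (lieLetter κ k) (by
      have := wordLT_of_rank (u := 1) (v := lieLetter κ i * lieLetter κ k)
        (v' := lieLetter κ j * lieLetter κ i) (rank hjk) rfl
      simpa only [one_mul, mul_assoc] using this)
  have h2 := swap_mem_ruleSpan H p φ S e m (P := fun w => wordLT w (lieLetter κ k * lieLetter κ j *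
    lieLetter κ i)) (hij.trans hjk) (lieLetter κ j) 1 (by
      have := wordLT_of_rank (u := 1) (v := lieLetter κ k * lieLetter κ i)
        (v' := lieLetter κ j * lieLetter κ i) (rank hjk) rfl
      simpa only [one_mul, mul_one, mul_assoc] using this)
  have h3 := swap_mem_ruleSpan H p φ S e m (P := fun w => wordLT w (lieLetter κ k * lieLetter κ j *
    lieLetter κ i)) (hij.trans hjk) 1 (lieLetter κ j) (by
      have := wordLT_of_rank (u := lieLetter κ k) (v := lieLetter κ j)
        (v' := lieLetter κ i) (rank hij) rfl
      simpa only [one_mul, mul_one, mul_assoc] using this)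
  have h4 := swap_mem_ruleSpan H p φ S e m (P := fun w => wordLT w (lieLetter κ k * lieLetter κ j *
    lieLetter κ i)) hjk (lieLetter κ i) 1 (by
      have := wordLT_of_rank (u := 1) (v := lieLetter κ k * lieLetter κ j)
        (v' := lieLetter κ j * lieLetter κ i) (rank (hij.trans hjk)) rfl
      simpa only [one_mul, mul_one, mul_assoc] using this)
  have c1 := hshort (lieEmb_commutator_mem H p φ S e m (e k) ⁅e j, e i⁆)
  have c2 := hshort (lieEmb_commutator_mem H p φ S e m (e j) ⁅e i, e k⁆)
  have c3 := hshort (lieEmb_commutator_mem H p φ S e m (e i) ⁅e k, e j⁆)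
  have jac : lieEmb e κ ⁅e k, ⁅e j, e i⁆⁆ + lieEmb e κ ⁅e j, ⁅e i, e k⁆⁆
      + lieEmb e κ ⁅e i, ⁅e k, e j⁆⁆ = 0 := by
    rw [← map_add, ← map_add, lie_jacobi, map_zero]
  have skew : lieEmb e κ ⁅e i, e k⁆ = - lieEmb e κ ⁅e k, e i⁆ := by
    rw [← lie_skew, map_neg]
  have := sub_mem (sub_mem (add_mem h1 h2) (add_mem h3 h4)) (add_mem (add_mem c1 c2) c3)
  convert this using 1
  simp only [map_one, one_mul, mul_one, ← lieEmb_basis e, skew]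
  -- The two sides differ by the negative of the Jacobi sum, which is substituted for zero.
  rw [← sub_eq_zero, ← neg_zero, ← jac]
  noncomm_ring

/-- The `p`-th power rule for `x` is compatible with commuting past `y`. -/
theorem pow_commutator_mem (hφ : ∀ a, LieAlgebra.ad F L (φ a) = LieAlgebra.ad F L a ^ p)
    (hp : 2 ≤ p) (x y : L) :
    lieEmb e κ (φ x) * lieEmb e κ y - lieEmb e κ y * lieEmb e κ (φ x)
      - (innerDer F (lieEmb e κ x) ^ (p - 1)) (lieEmb e κ ⁅x, y⁆)
      ∈ ruleSpan (InducedRule H p φ S e m) (fun w => w.length ≤ p) := by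
  have h1 := ruleSpan_mono (Q := fun w : FreeMonoid (ι ⊕ κ) => w.length ≤ p)
    (fun w hw => by omega) (lieEmb_commutator_mem H p φ S e m (φ x) y)
  have h2 := ruleSpan_mono (Q := fun w : FreeMonoid (ι ⊕ κ) => w.length ≤ p)
    (fun w hw => by omega) (innerDer_pow_lieEmb_mem H p φ S e m x ⁅x, y⁆ (p - 1))
  -- Here `ad (x^[p]) = (ad x)^p` enters: `(ad x)^(p-1) [x, y] = (ad x)^p y = [x^[p], y]`.
  have h3 : (LieAlgebra.ad F L x ^ (p - 1)) ⁅x, y⁆ = ⁅φ x, y⁆ := by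
    rw [← LieAlgebra.ad_apply F, ← LieAlgebra.ad_apply F, hφ, ← Module.End.mul_apply, ← pow_succ,
      Nat.sub_add_cancel (by omega)]
  rw [h3] at h2
  convert sub_mem h1 h2 using 1
  abel

variable [hp : Fact p.Prime] [CharP F p]

/-- Splitting the commutator relation in the middle factor, the commutators telescope and the
brackets add up to a power of the inner derivation. This writes the passage of `x^p` past `y` as a
sum of single swaps in context. -/
theorem sum_conj_commutator (x y : L) :
    ∑ t ∈ Finset.range p, lieEmb e κ x ^ t * (lieEmb e κ x * lieEmb e κ y
        - lieEmb e κ y * lieEmb e κ x - lieEmb e κ ⁅x, y⁆) * lieEmb e κ x ^ (p - 1 - t)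
      = lieEmb e κ x ^ p * lieEmb e κ y - lieEmb e κ y * lieEmb e κ x ^ p
        - (innerDer F (lieEmb e κ x) ^ (p - 1)) (lieEmb e κ ⁅x, y⁆) := by
  rw [← sum_pow_mul_commutator, innerDer_pow_pred, ← Finset.sum_sub_distrib]
  exact Finset.sum_congr rfl fun t _ => by rw [mul_sub, sub_mul]

/-- Moving `e_i` through `e_j ^ p` letter by letter produces `(ad e_j)^(p-1) [e_j, e_i]`, which by
`pow_commutator_mem` is also what commuting with `e_j^[p]` produces. The scalar `S(e_j)^p` is
central. -/
theorem pow_swap_resolves (hφ : ∀ a, LieAlgebra.ad F L (φ a) = LieAlgebra.ad F L a ^ p)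
    {i j : ι} (hij : i < j) :
    (lieEmb e κ (φ (e j)) + algebraMap F _ (S (e j) ^ p)) * lieEmb e κ (e i)
      - lieEmb e κ (e j) ^ (p - 1)
        * (lieEmb e κ (e i) * lieEmb e κ (e j) + lieEmb e κ ⁅e j, e i⁆)
      ∈ ruleSpan (InducedRule H p φ S e m)
        (fun w => wordLT w (lieLetter κ j ^ p * lieLetter κ i)) := by
  set K := ruleSpan (InducedRule H p φ S e m)
        (fun w => wordLT w (lieLetter κ j ^ p * lieLetter κ i)) with hK
  have hp2 := hp.out.two_le
  have rank : letterRank (Sum.inl i : ι ⊕ κ) < letterRank (Sum.inl j : ι ⊕ κ) :=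
    WithBot.coe_lt_coe.2 hij
  have h1 : _ ∈ K := (ruleSpan_length_le (by
      rw [FreeMonoid.length_mul, freeMonoid_length_of_pow, FreeMonoid.length_of]; omega))
    (pow_commutator_mem H p φ S e m hφ hp2 (e j) (e i))
  have h2 : _ ∈ K := pow_mem_ruleSpan H p φ S e m j (lieLetter κ i) 1 (by
    have := wordLT_of_rank (u := 1) (v := lieLetter κ j ^ p)
        (v' := lieLetter κ j ^ (p - 1) * lieLetter κ i) rank (by
          rw [FreeMonoid.length_mul, freeMonoid_length_of_pow, freeMonoid_length_of_pow,
            FreeMonoid.length_of]; omega)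
    rw [one_mul, one_mul, ← mul_assoc, ← pow_succ', Nat.sub_add_cancel (by omega)] at this
    simpa only [mul_one] using this)
  have h3 : ∀ t ∈ Finset.range (p - 1), lieEmb e κ (e j) ^ t * (lieEmb e κ (e j) * lieEmb e κ (e i)
        - lieEmb e κ (e i) * lieEmb e κ (e j) - lieEmb e κ ⁅e j, e i⁆)
          * lieEmb e κ (e j) ^ (p - 1 - t) ∈ K := by
    intro t ht
    have ht' := Finset.mem_range.1 ht
    have := swap_mem_ruleSpan H p φ S e m
      (P := fun w => wordLT w (lieLetter κ j ^ p * lieLetter κ i)) hij (lieLetter κ j ^ t)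
      (lieLetter κ j ^ (p - 1 - t)) (by
        have := wordLT_of_rank (u := lieLetter κ j ^ (t + 1)) (v := lieLetter κ j ^ (p - 1 - t))
          (v' := lieLetter κ j ^ (p - 1 - t - 1) * lieLetter κ i) rank (by
            rw [FreeMonoid.length_mul, freeMonoid_length_of_pow, freeMonoid_length_of_pow,
              FreeMonoid.length_of]; omega)
        have e : lieLetter κ j ^ p
            = lieLetter κ j ^ (t + 1) * lieLetter κ j * lieLetter κ j ^ (p - 1 - t - 1) := by
          rw [← pow_succ, ← pow_add]; congr 1; omega
        rw [e]
        simpa only [pow_succ, mul_assoc] using this)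
    simpa only [map_pow, ← lieEmb_basis e] using this
  have h4 := sum_conj_commutator (κ := κ) p e (e j) (e i)
  -- The last summand, `t = p - 1`, is the swap at `e_j ^ p * e_i` itself and must be isolated; only
  -- the other summands live at smaller words.
  have hr : Finset.range p = Finset.range (p - 1 + 1) := by rw [Nat.sub_add_cancel (by omega)]
  rw [hr, Finset.sum_range_succ, Nat.sub_self, pow_zero, mul_one] at h4
  have h5 := sub_mem (sub_mem h1 h2) (sum_mem h3)
  rw [eq_sub_of_add_eq h4] at h5
  convert h5 using 1
  simp only [map_one, mul_one, ← lieEmb_basis e]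
  have e1 : algebraMap F (MonoidAlgebra F (FreeMonoid (ι ⊕ κ))) (S (e j) ^ p) * lieEmb e κ (e i)
      = lieEmb e κ (e i) * algebraMap F _ (S (e j) ^ p) := Algebra.commutes _ _
  have e2 : lieEmb e κ (e j) ^ p * lieEmb e κ (e i)
      = lieEmb e κ (e j) ^ (p - 1) * (lieEmb e κ (e j) * lieEmb e κ (e i)) := by
    rw [← mul_assoc, ← pow_succ, Nat.sub_add_cancel (by omega)]
  rw [add_mul, e1, e2]
  noncomm_ring

/-- The mirror image of `pow_swap_resolves`, with the roles of `e_i` and `e_j` exchanged. -/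
theorem swap_pow_resolves (hφ : ∀ a, LieAlgebra.ad F L (φ a) = LieAlgebra.ad F L a ^ p)
    {i j : ι} (hij : i < j) :
    (lieEmb e κ (e i) * lieEmb e κ (e j) + lieEmb e κ ⁅e j, e i⁆) * lieEmb e κ (e i) ^ (p - 1)
      - lieEmb e κ (e j) * (lieEmb e κ (φ (e i)) + algebraMap F _ (S (e i) ^ p))
      ∈ ruleSpan (InducedRule H p φ S e m)
        (fun w => wordLT w (lieLetter κ j * lieLetter κ i ^ p)) := by
  set K := ruleSpan (InducedRule H p φ S e m)
        (fun w => wordLT w (lieLetter κ j * lieLetter κ i ^ p)) with hK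
  have hp2 := hp.out.two_le
  have rank : letterRank (Sum.inl i : ι ⊕ κ) < letterRank (Sum.inl j : ι ⊕ κ) :=
    WithBot.coe_lt_coe.2 hij
  have h1 : _ ∈ K := (ruleSpan_length_le (by
      rw [FreeMonoid.length_mul, freeMonoid_length_of_pow, FreeMonoid.length_of]; omega))
    (pow_commutator_mem H p φ S e m hφ hp2 (e i) (e j))
  have h2 : _ ∈ K := pow_mem_ruleSpan H p φ S e m i 1 (lieLetter κ j) (by
    have := wordLT_of_rank (u := 1) (v := lieLetter κ i ^ (p - 1) * lieLetter κ j)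
        (v' := lieLetter κ i ^ p) rank (by
          rw [FreeMonoid.length_mul, freeMonoid_length_of_pow, freeMonoid_length_of_pow,
            FreeMonoid.length_of]; omega)
    rw [one_mul, one_mul, ← mul_assoc, ← pow_succ', Nat.sub_add_cancel (by omega)] at this
    simpa only [one_mul] using this)
  have h3 : ∀ t ∈ Finset.range (p - 1), lieEmb e κ (e i) ^ (t + 1)
        * (lieEmb e κ (e i) * lieEmb e κ (e j)
        - lieEmb e κ (e j) * lieEmb e κ (e i) - lieEmb e κ ⁅e i, e j⁆)
          * lieEmb e κ (e i) ^ (p - 1 - (t + 1)) ∈ K := by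
    intro t ht
    have ht' := Finset.mem_range.1 ht
    have := swap_mem_ruleSpan H p φ S e m
      (P := fun w => wordLT w (lieLetter κ j * lieLetter κ i ^ p)) hij (lieLetter κ i ^ (t + 1))
      (lieLetter κ i ^ (p - 1 - (t + 1))) (by
        have := wordLT_of_rank (u := 1)
          (v := lieLetter κ i ^ t * (lieLetter κ j * lieLetter κ i)
            * lieLetter κ i ^ (p - 1 - (t + 1)))
          (v' := lieLetter κ i ^ p) rank (by
            simp only [FreeMonoid.length_mul, freeMonoid_length_of_pow,
              FreeMonoid.length_of]; omega)
        simpa only [pow_succ', mul_assoc, one_mul] using this)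
    have h := neg_mem this
    convert h using 1
    simp only [map_pow, ← lieEmb_basis e]
    rw [← lie_skew (e i) (e j), map_neg]
    noncomm_ring
  have h4 := sum_conj_commutator (κ := κ) p e (e i) (e j)
  -- Now the first summand, `t = 0`, is the swap at the ambiguous word `e_j * e_i ^ p`, so the sum
  -- is split at the bottom.
  have hr : Finset.range p = Finset.range (p - 1 + 1) := by rw [Nat.sub_add_cancel (by omega)]
  rw [hr, Finset.sum_range_succ', Nat.sub_zero, pow_zero, one_mul] at h4
  have h5 := sub_mem (add_mem h1 h2) (sum_mem h3)
  rw [eq_sub_of_add_eq h4] at h5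
  convert h5 using 1
  simp only [map_one, one_mul, ← lieEmb_basis e]
  have e1 : lieEmb e κ (e j) * algebraMap F (MonoidAlgebra F (FreeMonoid (ι ⊕ κ))) (S (e i) ^ p)
      = algebraMap F _ (S (e i) ^ p) * lieEmb e κ (e j) := (Algebra.commutes _ _).symm
  have e2 : lieEmb e κ (e j) * lieEmb e κ (e i) * lieEmb e κ (e i) ^ (p - 1)
      = lieEmb e κ (e j) * lieEmb e κ (e i) ^ p := by
    rw [mul_assoc, ← pow_succ', Nat.sub_add_cancel (by omega)]
  rw [mul_add, e1, ← lie_skew (e i) (e j), map_neg]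
  simp only [sub_mul, add_mul, neg_mul, e2]
  abel

/-- `[x^[p], x] = (ad x)^p x = 0`, so `x^[p]` commutes with powers of `x` modulo short relations.
This settles the overlaps of `e_i ^ p` with itself. -/
theorem pow_pow_resolves (hφ : ∀ a, LieAlgebra.ad F L (φ a) = LieAlgebra.ad F L a ^ p)
    (x : L) (n : ℕ) :
    lieEmb e κ (φ x) * lieEmb e κ x ^ n - lieEmb e κ x ^ n * lieEmb e κ (φ x)
      ∈ ruleSpan (InducedRule H p φ S e m) (fun w => w.length ≤ n + 1) := by
  induction n with
  | zero => simp
  | succ n ih =>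
    have h0 : ⁅φ x, x⁆ = 0 := by
      rw [← LieAlgebra.ad_apply F, hφ, ← Nat.sub_add_cancel hp.out.one_le, pow_succ,
        Module.End.mul_apply, LieAlgebra.ad_apply, lie_self, map_zero]
    have h1 := lieEmb_commutator_mem H p φ S e m (φ x) x
    rw [h0, map_zero, sub_zero] at h1
    have h2 := mul_mem_ruleSpan_length (lieEmb_pow_mem e x n) h1 one_mem_wordSpan
      (k := n + 1 + 1) (by omega)
    have h3 := mul_mem_ruleSpan_length one_mem_wordSpan ih (lieEmb_mem e x) (k := n + 1 + 1)
      (by omega)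
    convert add_mem h2 h3 using 1
    rw [pow_succ]
    noncomm_ring

variable (hspan : ∀ x ∈ H, x ∈ Submodule.span F (e '' {i | e i ∈ H}))
include hspan

/-- The module axiom `[x, y] m = x (y m) - y (x m)` for `M`. Both letters must lie in `H`, since
otherwise `e_j` could not act on `M`. -/
theorem swap_act_resolves {i j : ι} (hij : i < j) (hi : e i ∈ H) (hj : e j ∈ H) (k : κ) :
    (lieEmb e κ (e i) * lieEmb e κ (e j) + lieEmb e κ ⁅e j, e i⁆) * modEmb m ι (m k)
      - lieEmb e κ (e j) * modEmb m ι ⁅(⟨e i, hi⟩ : H), m k⁆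
      ∈ ruleSpan (InducedRule H p φ S e m)
        (fun w => wordLT w (lieLetter κ j * lieLetter κ i * modLetter ι k)) := by
  have hshort : ruleSpan (InducedRule H p φ S e m) (fun x => x.length ≤ 2)
      ≤ ruleSpan (InducedRule H p φ S e m)
        (fun w => wordLT w (lieLetter κ j * lieLetter κ i * modLetter ι k)) :=
    ruleSpan_length_le (by simp [FreeMonoid.length_mul, FreeMonoid.length_of])
  have rank : letterRank (Sum.inl i : ι ⊕ κ) < letterRank (Sum.inl j : ι ⊕ κ) :=
    WithBot.coe_lt_coe.2 hij
  have h1 := act_mem_ruleSpan H p φ S e m (P := fun w => wordLT w (lieLetter κ j * lieLetter κ i *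
    modLetter ι k)) j hj k (lieLetter κ i) 1 (by
      have := wordLT_of_rank (u := 1) (v := lieLetter κ j * modLetter ι k)
        (v' := lieLetter κ i * modLetter ι k) rank rfl
      simpa only [one_mul, mul_one, mul_assoc] using this)
  have h2 := hshort (lieEmb_mul_modEmb_mem H p φ S e m hspan ⟨e i, hi⟩ ⁅(⟨e j, hj⟩ : H), m k⁆)
  have h3 := hshort (lieEmb_mul_modEmb_mem H p φ S e m hspan ⁅(⟨e j, hj⟩ : H), ⟨e i, hi⟩⁆ (m k))
  have h4 := hshort (lieEmb_mul_modEmb_mem H p φ S e m hspan ⟨e j, hj⟩ ⁅(⟨e i, hi⟩ : H), m k⁆)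
  convert sub_mem (add_mem (add_mem h1 h2) h3) h4 using 1
  rw [lie_lie, map_sub]
  simp only [map_one, mul_one, ← lieEmb_basis e, LieSubalgebra.coe_bracket]
  noncomm_ring

theorem lieEmb_pow_mul_modEmb_mem (x : H) (y : M) (n : ℕ) :
    lieEmb e κ (x : L) ^ n * modEmb m ι y - modEmb m ι ((LieModule.toEnd F H M x ^ n) y)
      ∈ ruleSpan (InducedRule H p φ S e m) (fun w => w.length ≤ n + 1) := by
  induction n with
  | zero => simp
  | succ n ih =>
    have h1 := mul_mem_ruleSpan_length (lieEmb_mem e (x : L)) ih one_mem_wordSpan (k := n + 1 + 1)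
      (by omega)
    have h2 := ruleSpan_mono (Q := fun w : FreeMonoid (ι ⊕ κ) => w.length ≤ n + 1 + 1)
      (fun w hw => by omega)
      (lieEmb_mul_modEmb_mem H p φ S e m hspan x ((LieModule.toEnd F H M x ^ n) y))
    convert add_mem h1 h2 using 1
    rw [pow_succ', pow_succ', Module.End.mul_apply, LieModule.toEnd_apply_apply]
    noncomm_ring

/-- The character of `M` says that `e_i^[p] + S(e_i)^p` acts on `m_k` as `e_i^p` does; all relations
needed have length at most `p`, below that of the ambiguous word. -/
theorem pow_act_resolves (hH : IsPSubalgebra φ H)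
    (hM : HasCharacter p (restrictPMap φ H hH) (restrictForm S H) M)
    (i : ι) (hi : e i ∈ H) (k : κ) :
    (lieEmb e κ (φ (e i)) + algebraMap F _ (S (e i) ^ p)) * modEmb m ι (m k)
      - lieEmb e κ (e i) ^ (p - 1) * modEmb m ι ⁅(⟨e i, hi⟩ : H), m k⁆
      ∈ ruleSpan (InducedRule H p φ S e m)
        (fun w => wordLT w (lieLetter κ i ^ p * modLetter ι k)) := by
  have hp2 := hp.out.two_le
  refine ruleSpan_length_le (n := p) (by
      rw [FreeMonoid.length_mul, freeMonoid_length_of_pow, FreeMonoid.length_of]; omega) ?_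
  have h1 := ruleSpan_mono (Q := fun w : FreeMonoid (ι ⊕ κ) => w.length ≤ p)
      (fun w hw => by omega)
      (lieEmb_mul_modEmb_mem H p φ S e m hspan (restrictPMap φ H hH ⟨e i, hi⟩) (m k))
  have h2 := ruleSpan_mono (Q := fun w : FreeMonoid (ι ⊕ κ) => w.length ≤ p)
      (fun w hw => by omega)
      (lieEmb_pow_mul_modEmb_mem H p φ S e m hspan ⟨e i, hi⟩ ⁅(⟨e i, hi⟩ : H), m k⁆ (p - 1))
  have h3 := LinearMap.congr_fun (hM ⟨e i, hi⟩) (m k)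
  rw [← LieModule.toEnd_apply_apply F H M, ← Module.End.mul_apply, ← pow_succ,
    Nat.sub_add_cancel (by omega)] at h2
  rw [LinearMap.sub_apply, sub_eq_iff_eq_add] at h3
  rw [h3] at h2
  convert sub_mem h1 h2 using 1
  rw [map_add, LinearMap.smul_apply, map_smul, Algebra.algebraMap_eq_smul_one, add_mul,
    smul_mul_assoc, one_mul]
  change _ + S (e i) ^ p • modEmb m ι (m k) - _ = (lieEmb e κ (φ (e i)) * _ - modEmb m ι
    (LieModule.toEnd F H M (restrictPMap φ H hH ⟨e i, hi⟩) (m k))) -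
    (_ - (S (e i) ^ p • modEmb m ι (m k) + _))
  abel

end Confluence

/-! ### Normal forms for the induced module -/

section NormalForm

variable {F L M ι κ : Type*} [Field F] [LieRing L] [LieAlgebra F L] (H : LieSubalgebra F L)
  [AddCommGroup M] [Module F M] [LieRingModule H M] [LieModule F H M]
  (p : ℕ) (φ : L → L) (S : L →ₗ[F] F) (e : Module.Basis ι F L) (m : Module.Basis κ F M)
  [LinearOrder ι] [hp : Fact p.Prime] [CharP F p]

/-- An action rule ends in a letter of `M`, with which no left side begins, so the proper overlaps
start with a swap or a power. Each of the six resulting kinds is one of the resolutions above. -/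
theorem inducedRule_overlap (hφ : ∀ a, LieAlgebra.ad F L (φ a) = LieAlgebra.ad F L a ^ p)
    (hspan : ∀ x ∈ H, x ∈ Submodule.span F (e '' {i | e i ∈ H}))
    (hup : ∀ i j, i < j → e i ∈ H → e j ∈ H) (hH : IsPSubalgebra φ H)
    (hM : HasCharacter p (restrictPMap φ H hH) (restrictForm S H) M)
    (c d f : FreeMonoid (ι ⊕ κ)) (ρ ρ') (hd : d ≠ 1) (h : InducedRule H p φ S e m (c * d) ρ)
    (h' : InducedRule H p φ S e m (d * f) ρ') :
    ρ * MonoidAlgebra.of F _ f - MonoidAlgebra.of F _ c * ρ'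
      ∈ ruleSpan (InducedRule H p φ S e m) (fun w => wordLT w (c * d * f)) := by
  have hp2 := hp.out.two_le
  -- If the two left sides coincide, so do the rules.
  have whole : c = 1 → f = 1 → ρ * MonoidAlgebra.of F _ f - MonoidAlgebra.of F _ c * ρ'
      ∈ ruleSpan (InducedRule H p φ S e m) (fun w => wordLT w (c * d * f)) := by
    rintro rfl rfl
    rw [one_mul] at h
    rw [mul_one] at h'
    simp only [inducedRule_unique H p φ S e m h h' hp2, map_one, mul_one, one_mul, sub_self]
    exact zero_mem _
  generalize hw : c * d = w at h ⊢
  generalize hw' : d * f = w' at h'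
  cases h with
  | swap i j hij =>
    obtain ⟨hc, hd'⟩ | ⟨hc, hd'⟩ | ⟨-, hd'⟩ := freeMonoid_mul_eq_pair hw
    · rw [← hw]
      refine whole hc ?_
      rw [hd'] at hw'
      cases h' with
      | swap i' j' h' =>
        obtain ⟨h1, -⟩ | ⟨h1, -⟩ | ⟨-, h1⟩ := freeMonoid_mul_eq_pair hw'
        · exact absurd (hd'.trans h1) hd
        · exact absurd (congrArg FreeMonoid.length h1)
            (by simp [FreeMonoid.length_mul, FreeMonoid.length_of])
        · exact h1
      | pow i' =>
        obtain ⟨h1, h2, -⟩ := freeMonoid_pair_eq_of_pow (freeMonoid_mul_eq_of_pow hw').1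
        exact absurd (Sum.inl_injective (h2.trans h1.symm)) hij.ne
      | act i' h' k =>
        obtain ⟨h1, -⟩ | ⟨h1, -⟩ | ⟨-, h1⟩ := freeMonoid_mul_eq_pair hw'
        · exact absurd (hd'.trans h1) hd
        · exact absurd (congrArg FreeMonoid.length h1)
            (by simp [FreeMonoid.length_mul, FreeMonoid.length_of])
        · exact h1
    · subst hc hd'
      cases h' with
      | swap i' j' h' =>
        obtain ⟨h1, rfl⟩ := freeMonoid_mul_eq_mul_of hw'
        obtain rfl := Sum.inl_injective h1
        rw [← lieEmb_basis e, ← lieEmb_basis e]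
        exact swap_swap_resolves H p φ S e m h' hij
      | pow i' =>
        obtain ⟨h1, h2, h3⟩ := freeMonoid_mul_eq_of_pow hw'
        rw [FreeMonoid.length_of, pow_one] at h1
        obtain rfl := Sum.inl_injective (FreeMonoid.of_injective h1)
        have hf : f = lieLetter κ i ^ (p - 1) := by
          rw [h2]; congr 1; rw [FreeMonoid.length_of] at h3; omega
        subst hf
        rw [map_pow (MonoidAlgebra.of F (FreeMonoid (ι ⊕ κ))), ← lieEmb_basis e, ← lieEmb_basis e, mul_assoc, ← pow_succ',
          Nat.sub_add_cancel (by omega)]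
        exact swap_pow_resolves H p φ S e m hφ hij
      | act i' h' k =>
        obtain ⟨h1, rfl⟩ := freeMonoid_mul_eq_mul_of hw'
        obtain rfl := Sum.inl_injective h1
        rw [← lieEmb_basis e, ← modEmb_basis m]
        -- The basis lists `H` last, so `e_i ∈ H` and `i < j` force `e_j ∈ H`.
        exact swap_act_resolves H p φ S e m hspan hij h' (hup _ _ hij h') k
    · exact absurd hd' hd
  | pow i =>
    obtain ⟨hc, hd', hl⟩ := freeMonoid_mul_eq_of_pow hw
    have hdl : d.length ≠ 0 := fun h => hd (FreeMonoid.length_eq_zero.1 h)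
    obtain ⟨n, hn⟩ := Nat.exists_eq_succ_of_ne_zero hdl
    rw [hn] at hd'
    cases h' with
    | swap i' j' h' =>
      rw [hd', pow_succ', mul_assoc] at hw'
      obtain ⟨h1, h2⟩ := freeMonoid_mul_eq_mul_of hw'
      obtain rfl := Sum.inl_injective h1
      rcases n with _ | n
      · rw [pow_zero, one_mul] at h2
        subst h2
        have hc' : c = lieLetter κ i ^ (p - 1) := by
          rw [hc]; congr 1; omega
        subst hc'
        rw [map_pow (MonoidAlgebra.of F (FreeMonoid (ι ⊕ κ))), ← lieEmb_basis e, ← lieEmb_basis e]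
        exact pow_swap_resolves H p φ S e m hφ h'
      · rw [pow_succ', mul_assoc, ← mul_one (lieLetter κ i')] at h2
        obtain ⟨h3, -⟩ := freeMonoid_mul_eq_mul_of h2
        exact absurd (Sum.inl_injective h3) h'.ne'
    | pow i' =>
      rw [hd', pow_succ', mul_assoc] at hw'
      have hw'' := hw'
      rw [← Nat.sub_add_cancel hp.out.one_le, pow_succ' (lieLetter κ i')] at hw''
      obtain rfl := Sum.inl_injective (freeMonoid_mul_eq_mul_of hw'').1
      rw [← mul_assoc, ← pow_succ'] at hw'
      obtain ⟨-, h2, h3⟩ := freeMonoid_mul_eq_of_pow hw'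
      rw [freeMonoid_length_of_pow] at h3
      -- Both words complete `d` to the same power of one letter, on opposite sides, so they agree.
      have hcf : c = f := by
        rw [hc, h2]; congr 1; omega
      subst hcf
      rw [hc, map_pow (MonoidAlgebra.of F (FreeMonoid (ι ⊕ κ))), ← lieEmb_basis e]
      have hlt : c.length + 1 < (lieLetter κ i ^ p * lieLetter κ i ^ c.length).length := by
        rw [FreeMonoid.length_mul, freeMonoid_length_of_pow, freeMonoid_length_of_pow]; omega
      have := ruleSpan_length_le hlt (pow_pow_resolves H p φ S e m hφ (e i) c.length)
      convert this using 1
      rw [add_mul, mul_add, Algebra.commutes]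
      abel
    | act i' h' k =>
      rw [hd', pow_succ', mul_assoc] at hw'
      obtain ⟨h1, h2⟩ := freeMonoid_mul_eq_mul_of hw'
      obtain rfl := Sum.inl_injective h1
      rcases n with _ | n
      · rw [pow_zero, one_mul] at h2
        subst h2
        have hc' : c = lieLetter κ i ^ (p - 1) := by
          rw [hc]; congr 1; omega
        subst hc'
        rw [map_pow (MonoidAlgebra.of F (FreeMonoid (ι ⊕ κ))), ← lieEmb_basis e, ← modEmb_basis m]
        exact pow_act_resolves H p φ S e m hspan hH hM i h' k
      · rw [pow_succ', mul_assoc, ← mul_one (modLetter ι k)] at h2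
        exact absurd (freeMonoid_mul_eq_mul_of h2).1 (by simp)
  | act i hi k =>
    obtain ⟨hc, hd'⟩ | ⟨hc, hd'⟩ | ⟨-, hd'⟩ := freeMonoid_mul_eq_pair hw
    · rw [← hw]
      refine whole hc ?_
      rw [hd', mul_assoc] at hw'
      cases h' with
      | swap i' j' h' =>
        have h2 := (freeMonoid_mul_eq_mul_of hw').2
        rw [← mul_one (lieLetter κ i')] at h2
        exact absurd (freeMonoid_mul_eq_mul_of h2).1 (by simp)
      | pow i' =>
        rw [← mul_assoc] at hw'
        exact absurd (freeMonoid_pair_eq_of_pow (freeMonoid_mul_eq_of_pow hw').1).2.1 (by simp)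
      | act i' h' k' =>
        have h2 := (freeMonoid_mul_eq_mul_of hw').2
        rw [← mul_one (modLetter ι k')] at h2
        exact (freeMonoid_mul_eq_mul_of h2).2
    · subst hd'
      cases h' with
      | swap i' j' h' => exact absurd (freeMonoid_mul_eq_mul_of hw').1 (by simp)
      | pow i' =>
        have h1 := (freeMonoid_mul_eq_of_pow hw').1
        rw [FreeMonoid.length_of, pow_one] at h1
        exact absurd (FreeMonoid.of_injective h1) (by simp)
      | act i' h' k' => exact absurd (freeMonoid_mul_eq_mul_of hw').1 (by simp)
    · exact absurd hd' hd

/-- Every left side has length at least two, so the letters of `M` are irreducible words and the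
normal form fixes them. -/
theorem exists_inducedRule_normalForm [WellFoundedLT ι]
    (hφ : ∀ a, LieAlgebra.ad F L (φ a) = LieAlgebra.ad F L a ^ p)
    (hspan : ∀ x ∈ H, x ∈ Submodule.span F (e '' {i | e i ∈ H}))
    (hup : ∀ i j, i < j → e i ∈ H → e j ∈ H) (hH : IsPSubalgebra φ H)
    (hM : HasCharacter p (restrictPMap φ H hH) (restrictForm S H) M) :
    ∃ N : MonoidAlgebra F (FreeMonoid (ι ⊕ κ)) →ₗ[F] MonoidAlgebra F (FreeMonoid (ι ⊕ κ)),
      (∀ x : M, N (modEmb m ι x) = modEmb m ι x) ∧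
      ∀ t ∈ ruleSpan (InducedRule H p φ S e m) (fun _ => True), N t = 0 := by
  have hp2 := hp.out.two_le
  obtain ⟨N, h1, h2⟩ := exists_normalForm (F := F) (rule := InducedRule H p φ S e m) wordLT_wf
    (fun a b u v => wordLT_mul u v) (fun R ρ h => inducedRule_lt H p φ S e m hp2 h)
    (confluent_of_criticalPairs (fun a b u v => wordLT_mul u v)
      (fun R ρ h => inducedRule_lt H p φ S e m hp2 h)
      (inducedRule_overlap H p φ S e m hφ hspan hup hH hM) (by
        intro c R f ρ ρ' h h'
        obtain ⟨rfl, rfl⟩ := inducedRule_no_inclusion H p φ S e m h h' hp2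
        rw [one_mul, mul_one] at h
        simp only [inducedRule_unique H p φ S e m h h' hp2, map_one, mul_one, one_mul, sub_self]
        exact zero_mem _))
  refine ⟨N, fun x => ?_, h2⟩
  induction m.mem_span x using Submodule.span_induction with
  | mem x hx =>
    obtain ⟨k, rfl⟩ := hx
    rw [modEmb_basis]
    refine h1 _ fun a R b ρ h hw => ?_
    have := inducedRule_two_le_length H p φ S e m h hp2
    have hl := congrArg FreeMonoid.length hw
    rw [FreeMonoid.length_mul, FreeMonoid.length_mul, FreeMonoid.length_of] at hl
    omega
  | zero => simp
  | add x y _ _ hx hy => rw [map_add, map_add, hx, hy]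
  | smul c x _ hx => rw [map_smul, map_smul, hx]

theorem modEmb_injective : Function.Injective (modEmb m ι) := by
  -- A left inverse reads off the one-letter words from `M` and sends all other words to 0.
  let g : FreeMonoid (ι ⊕ κ) → M := fun w => match w.toList with
    | [Sum.inr k] => m k
    | _ => 0
  let G : MonoidAlgebra F (FreeMonoid (ι ⊕ κ)) →ₗ[F] M :=
    Finsupp.linearCombination F g ∘ₗ (MonoidAlgebra.coeffLinearEquiv F).toLinearMap
  have h : G ∘ₗ modEmb m ι = LinearMap.id := by
    refine m.ext fun k => ?_
    rw [LinearMap.comp_apply, modEmb_basis]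
    simp [G, g, MonoidAlgebra.of, FreeMonoid.toList_of]
  exact Function.LeftInverse.injective (g := G) fun x => LinearMap.congr_fun h x

end NormalForm

/-! ### Jacobson's formula for `p`-th powers -/

section Jacobson

open Polynomial

theorem derivative_pow_noncomm {A : Type*} [Semiring A] (P : A[X]) (n : ℕ) :
    derivative (P ^ n) = ∑ t ∈ Finset.range n, P ^ t * derivative P * P ^ (n - 1 - t) := by
  induction n with
  | zero => simp
  | succ n ih =>
    rw [pow_succ, derivative_mul, ih, Finset.sum_range_succ, Finset.sum_mul]
    congr 1
    · refine Finset.sum_congr rfl fun t ht => ?_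
      have ht' := Finset.mem_range.1 ht
      rw [mul_assoc, ← pow_succ]
      congr 2
      omega
    · simp

attribute [local instance] LieRing.ofAssociativeRing

variable {F : Type*} {L : Type*} {A : Type*} [Field F] [LieRing L] [LieAlgebra F L] [Ring A]
  [Algebra F A]

/-- The extension of a map `f : L → A` to `F[X] ⊗ L → A[X]`. -/
noncomputable def polynomialExtension (f : L →ₗ⁅F⁆ A) : F[X] ⊗[F] L →ₗ[F] A[X] :=
  TensorProduct.lift ((LinearMap.mul F A[X]).compl₁₂ (mapAlgHom (Algebra.ofId F A)).toLinearMap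
    (CAlgHom.toLinearMap ∘ₗ (f : L →ₗ[F] A)))

theorem polynomialExtension_tmul (f : L →ₗ⁅F⁆ A) (q : F[X]) (x : L) :
    polynomialExtension f (q ⊗ₜ x) = q.map (algebraMap F A) * C (f x) := rfl

theorem commute_map_algebraMap (q : F[X]) (r : A[X]) : Commute (q.map (algebraMap F A)) r := by
  induction q using Polynomial.induction_on' with
  | add a b ha hb => rw [Polynomial.map_add]; exact ha.add_left hb
  | monomial n a =>
    rw [Polynomial.map_monomial, ← C_mul_X_pow_eq_monomial]
    exact Commute.mul_left (Algebra.commutes a r) ((commute_X r).pow_left n)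

/-- Scalars from `F[X]` become central in `A[X]`, so the extension still turns brackets into
commutators. -/
theorem polynomialExtension_ad (f : L →ₗ⁅F⁆ A) (s t : F[X] ⊗[F] L) :
    polynomialExtension f (LieAlgebra.ad F[X] (F[X] ⊗[F] L) s t)
      = polynomialExtension f s * polynomialExtension f t
        - polynomialExtension f t * polynomialExtension f s := by
  induction s using TensorProduct.induction_on with
  | zero => simp only [map_zero, LinearMap.zero_apply, zero_mul, mul_zero, sub_zero]
  | add a b ha hb =>
    rw [map_add, LinearMap.add_apply, map_add, ha, hb, map_add, add_mul, mul_add]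
    abel
  | tmul q x =>
    induction t using TensorProduct.induction_on with
    | zero => simp only [map_zero, zero_mul, mul_zero, sub_zero]
    | add a b ha hb =>
      rw [map_add, map_add, ha, hb, map_add, add_mul, mul_add]
      abel
    | tmul r y =>
      change polynomialExtension f ((q * r) ⊗ₜ[F] ⁅x, y⁆) = _
      rw [polynomialExtension_tmul, polynomialExtension_tmul,
        polynomialExtension_tmul, LieHom.map_lie, LieRing.of_associative_ring_bracket,
        (commute_map_algebraMap r (C (f x))).symm.mul_mul_mul_comm,
        (commute_map_algebraMap q (C (f y))).symm.mul_mul_mul_comm, C_sub, C_mul, C_mul,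
        Polynomial.map_mul, (commute_map_algebraMap r (q.map (algebraMap F A))).eq, mul_sub]

theorem polynomialExtension_ad_pow (f : L →ₗ⁅F⁆ A) (s t : F[X] ⊗[F] L) (n : ℕ) :
    polynomialExtension f ((LieAlgebra.ad F[X] (F[X] ⊗[F] L) s ^ n) t)
      = (innerDer F (polynomialExtension f s) ^ n) (polynomialExtension f t) := by
  induction n with
  | zero => simp
  | succ n ih =>
    rw [pow_succ', pow_succ', Module.End.mul_apply, Module.End.mul_apply,
      polynomialExtension_ad, ih, innerDer_apply]

/-- Jacobson's formula: `x ↦ f(x)^p - f(x^[p])` is additive. -/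
theorem pow_sub_additive {p : ℕ} [hp : Fact p.Prime] [CharP F p] {φ : L → L}
    (hφ : IsPMapping p F φ) (f : L →ₗ⁅F⁆ A) (a b : L) :
    f (a + b) ^ p - f (φ (a + b)) = (f a ^ p - f (φ a)) + (f b ^ p - f (φ b)) := by
  obtain ⟨s, hs, hadd⟩ := hφ.map_add a b
  -- The derivative of `P ^ p` is `∑ P^t f(a) P^(p-1-t) = (ad P)^(p-1) f(a)`, which the definition
  -- of the `s_i` expands as `∑ i X^(i-1) f(s_i)`. This determines all coefficients of `P ^ p`
  -- except those of degree 0 and `p`; evaluation at 1 then gives `f(a + b)^p`.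
  set P : A[X] := C (f a) * X + C (f b) with hP
  have hP' : polynomialExtension f ((X : F[X]) ⊗ₜ[F] a + (1 : F[X]) ⊗ₜ[F] b) = P := by
    rw [map_add, polynomialExtension_tmul, polynomialExtension_tmul, map_X, Polynomial.map_one,
      one_mul, X_mul]
  have h1 := congrArg (polynomialExtension f) hs
  rw [polynomialExtension_ad_pow, hP', innerDer_pow_pred, polynomialExtension_tmul,
    Polynomial.map_one, one_mul] at h1
  have hder : derivative P = C (f a) := by simp [hP]
  have h2 := derivative_pow_noncomm P p
  rw [hder, h1, map_sum] at h2
  have hcoeff : ∀ i ∈ Finset.Icc 1 (p - 1), (P ^ p).coeff i = f (s i) := by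
    intro i hi
    obtain ⟨hi1, hi2⟩ := Finset.mem_Icc.1 hi
    have h3 := congrArg (fun Q => coeff Q (i - 1)) h2
    simp only [coeff_derivative, finsetSum_coeff, polynomialExtension_tmul] at h3
    rw [Finset.sum_eq_single i] at h3
    -- `0 < i < p`, so the factor `i` brought in by the derivative can be cancelled.
    · have hi0 : (i : F) ≠ 0 := fun h => by
        have := Nat.le_of_dvd hi1 ((CharP.cast_eq_zero_iff F p i).1 h)
        have := hp.out.two_le
        omega
      rw [Nat.sub_add_cancel hi1] at h3
      have h4 : (((i - 1 : ℕ) : A) + 1) = algebraMap F A i := by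
        rw [← Nat.cast_succ, Nat.succ_eq_add_one, Nat.sub_add_cancel hi1, map_natCast]
      have h5 : (Polynomial.map (algebraMap F A) ((i : F[X]) * X ^ (i - 1)) * C (f (s i))).coeff
          (i - 1) = algebraMap F A i * f (s i) := by
        rw [coeff_mul_C, Polynomial.map_mul, Polynomial.map_natCast, Polynomial.map_pow, map_X,
          ← C_eq_natCast, coeff_C_mul, coeff_X_pow_self, mul_one, map_natCast]
      rw [h4, h5, ← Algebra.commutes, ← Algebra.smul_def, ← Algebra.smul_def] at h3
      exact smul_right_injective A hi0 h3
    · intro j hj hji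
      have := (Finset.mem_Icc.1 hj).1
      have : i - 1 ≠ j - 1 := by omega
      rw [coeff_mul_C, Polynomial.map_mul, Polynomial.map_natCast, Polynomial.map_pow, map_X,
        ← C_eq_natCast, coeff_C_mul, coeff_X_pow, if_neg this, mul_zero, zero_mul]
    · exact fun h => absurd hi h
  have hdeg : P.natDegree ≤ 1 := natDegree_linear_le
  have h0 : (P ^ p).coeff 0 = f b ^ p := by
    change constantCoeff (P ^ p) = _
    rw [map_pow]
    simp [hP]
  have hpc : (P ^ p).coeff p = f a ^ p := by
    have := coeff_pow_of_natDegree_le (m := p) hdeg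
    rw [mul_one] at this
    rw [this]
    simp [hP]
  have heval : (P ^ p).eval 1 = f (a + b) ^ p := by
    -- Over the noncommutative ring `A`, evaluation is multiplicative because the point 1 is
    -- central.
    have h6 := map_pow (eval₂RingHom' (RingHom.id A) 1 fun _ => Commute.one_right _) P p
    change (P ^ p).eval 1 = P.eval 1 ^ p at h6
    rw [h6]
    simp [hP]
  have hlt : (P ^ p).natDegree < p + 1 := by
    have := natDegree_pow_le (p := P) (n := p)
    nlinarith
  rw [eval_eq_sum_range' hlt] at heval
  have hrange : ∑ i ∈ Finset.range (p + 1), (P ^ p).coeff i * 1 ^ i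
      = f b ^ p + ∑ i ∈ Finset.Icc 1 (p - 1), f (s i) + f a ^ p := by
    rw [Finset.sum_range_succ, hpc]
    have : Finset.range p = insert 0 (Finset.Icc 1 (p - 1)) := by
      ext i
      have := hp.out.two_le
      simp only [Finset.mem_range, Finset.mem_insert, Finset.mem_Icc]
      omega
    rw [this, Finset.sum_insert (by simp), h0]
    simp only [one_pow, mul_one]
    rw [Finset.sum_congr rfl hcoeff]
  rw [← heval, hrange, hadd, map_add, map_add, map_sum]
  abel

/-- The relations of `u(L, S)` need only be checked on a basis. -/
theorem pow_eq_of_basis {p : ℕ} [hp : Fact p.Prime] [CharP F p] {φ : L → L}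
    (hφ : IsPMapping p F φ) (S : L →ₗ[F] F) (f : L →ₗ⁅F⁆ A) {ι : Type*} (e : Module.Basis ι F L)
    (h : ∀ i, f (e i) ^ p = f (φ (e i)) + algebraMap F A (S (e i) ^ p)) (x : L) :
    f x ^ p = f (φ x) + algebraMap F A (S x ^ p) := by
  rw [← sub_eq_iff_eq_add']
  induction e.mem_span x using Submodule.span_induction with
  | mem x hx =>
    obtain ⟨i, rfl⟩ := hx
    rw [h, add_sub_cancel_left]
  | zero =>
    have h0 : φ 0 = 0 := by
      have := hφ.map_smul 0 0
      rwa [zero_smul, zero_pow hp.out.ne_zero, zero_smul] at this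
    rw [h0, map_zero, map_zero, zero_pow hp.out.ne_zero, zero_pow hp.out.ne_zero, map_zero,
      sub_self]
  | add x y _ _ hx hy =>
    rw [pow_sub_additive hφ, hx, hy, map_add, add_pow_char, map_add]
  | smul c x _ hx =>
    rw [hφ.map_smul, map_smul, map_smul, map_smul, _root_.smul_pow, ← smul_sub, hx, smul_eq_mul, mul_pow,
      map_mul, Algebra.smul_def]

end Jacobson

/-! ### The module defined by the rules, and the embedding of `M` into `Ind M` -/

section Embedding

attribute [local instance] LieRing.ofAssociativeRing

section Representation

variable {F L M ι κ : Type*} [Field F] [LieRing L] [LieAlgebra F L] (H : LieSubalgebra F L)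
  [AddCommGroup M] [Module F M] [LieRingModule H M] [LieModule F H M]
  (p : ℕ) (φ : L → L) (S : L →ₗ[F] F) (e : Module.Basis ι F L) (m : Module.Basis κ F M)
  [LinearOrder ι]

/-- The left ideal of the free algebra generated by the multiples of the rules. -/
noncomputable def ruleIdeal : Submodule (MonoidAlgebra F (FreeMonoid (ι ⊕ κ)))
    (MonoidAlgebra F (FreeMonoid (ι ⊕ κ))) :=
  Submodule.span _ {t | ∃ R ρ v, InducedRule H p φ S e m R ρ ∧
    t = (MonoidAlgebra.of F _ R - ρ) * MonoidAlgebra.of F _ v}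

theorem mem_ruleSpan_of_mem_ruleIdeal {t : MonoidAlgebra F (FreeMonoid (ι ⊕ κ))}
    (h : t ∈ ruleIdeal H p φ S e m) :
    t ∈ ruleSpan (InducedRule H p φ S e m) (fun _ => True) := by
  have hmul : ∀ (s : MonoidAlgebra F (FreeMonoid (ι ⊕ κ))) {t},
      t ∈ ruleSpan (InducedRule H p φ S e m) (fun _ => True) →
      s * t ∈ ruleSpan (InducedRule H p φ S e m) (fun _ => True) := by
    intro s t ht
    have := mul_mul_mem_ruleSpan (Q := fun _ => True) (fun _ _ _ _ _ _ => trivial)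
      (mem_wordSpan_true s) ht (mem_wordSpan_true 1)
    rwa [mul_one] at this
  induction h using Submodule.span_induction with
  | mem x hx =>
    obtain ⟨R, ρ, v, hr, rfl⟩ := hx
    have := mem_ruleSpan (P := fun _ => True) (u := 1) (v := v) hr trivial
    rwa [map_one, one_mul] at this
  | zero => exact zero_mem _
  | add x y _ _ hx hy => exact add_mem hx hy
  | smul a x _ hx => exact hmul a hx

/-- The generators of `ruleIdeal` are closed under right multiplication by words, so the left ideal
is two-sided and relations act as zero on the quotient. -/
theorem lsmul_eq_zero_of_mem_ruleSpan {P : FreeMonoid (ι ⊕ κ) → Prop}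
    {t : MonoidAlgebra F (FreeMonoid (ι ⊕ κ))} (h : t ∈ ruleSpan (InducedRule H p φ S e m) P) :
    Algebra.lsmul F F (MonoidAlgebra F (FreeMonoid (ι ⊕ κ)) ⧸ ruleIdeal H p φ S e m) t = 0 := by
  refine LinearMap.ext fun q => ?_
  obtain ⟨s, rfl⟩ := Submodule.Quotient.mk_surjective _ q
  change t • (ruleIdeal H p φ S e m).mkQ s = 0
  rw [← map_smul, Submodule.mkQ_apply, Submodule.Quotient.mk_eq_zero, smul_eq_mul]
  have hs := mem_wordSpan_true s
  induction h using Submodule.span_induction with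
  | mem x hx =>
    obtain ⟨u, R, v, ρ, hr, -, rfl⟩ := hx
    induction hs using Submodule.span_induction with
    | mem y hy =>
      obtain ⟨w, -, rfl⟩ := hy
      rw [mul_assoc, mul_assoc, ← map_mul]
      exact Submodule.smul_mem _ _ (Submodule.subset_span ⟨R, ρ, v * w, hr, rfl⟩)
    | zero => simp
    | add y z _ _ hy hz => rw [mul_add]; exact add_mem hy hz
    | smul c y _ hy =>
      rw [mul_smul_comm, ← algebraMap_smul (MonoidAlgebra F (FreeMonoid (ι ⊕ κ)))]
      exact Submodule.smul_mem _ _ hy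
  | zero => rw [zero_mul]; exact zero_mem _
  | add y z _ _ hy hz => rw [add_mul]; exact add_mem hy hz
  | smul c y _ hy =>
    rw [smul_mul_assoc, ← algebraMap_smul (MonoidAlgebra F (FreeMonoid (ι ⊕ κ)))]
    exact Submodule.smul_mem _ _ hy

/-- The representation of `L` on the quotient of the free algebra by the rules. -/
noncomputable def inducedRep :
    L →ₗ⁅F⁆ Module.End F (MonoidAlgebra F (FreeMonoid (ι ⊕ κ)) ⧸ ruleIdeal H p φ S e m) where
  __ := (Algebra.lsmul F F _).toLinearMap ∘ₗ lieEmb e κ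
  map_lie' := by
    intro x y
    have := lsmul_eq_zero_of_mem_ruleSpan H p φ S e m (lieEmb_commutator_mem H p φ S e m x y)
    rw [map_sub, map_sub, map_mul, map_mul, sub_eq_zero] at this
    exact this.symm

theorem inducedRep_apply (x : L) : inducedRep H p φ S e m x = Algebra.lsmul F F _ (lieEmb e κ x) :=
  rfl

theorem inducedRep_pow_basis (i : ι) : inducedRep H p φ S e m (e i) ^ p
    = inducedRep H p φ S e m (φ (e i)) + algebraMap F _ (S (e i) ^ p) := by
  have := lsmul_eq_zero_of_mem_ruleSpan H p φ S e m (pow_mem_ruleSpan H p φ S e m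
    (P := fun _ => True) i 1 1 trivial)
  rw [map_one, one_mul, mul_one, map_sub, map_add, map_pow, sub_eq_zero, AlgHom.commutes] at this
  exact this

/-- The map from `M` to the quotient of the free algebra by the rules. -/
noncomputable def inducedEmb :
    M →ₗ[F] MonoidAlgebra F (FreeMonoid (ι ⊕ κ)) ⧸ ruleIdeal H p φ S e m :=
  ((ruleIdeal H p φ S e m).mkQ.restrictScalars F) ∘ₗ modEmb m ι

theorem inducedRep_inducedEmb (hspan : ∀ x ∈ H, x ∈ Submodule.span F (e '' {i | e i ∈ H}))
    (x : H) (y : M) : inducedRep H p φ S e m x (inducedEmb H p φ S e m y)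
      = inducedEmb H p φ S e m ⁅x, y⁆ := by
  have := LinearMap.congr_fun (lsmul_eq_zero_of_mem_ruleSpan H p φ S e m
    (lieEmb_mul_modEmb_mem H p φ S e m hspan x y)) ((ruleIdeal H p φ S e m).mkQ 1)
  change (_ : MonoidAlgebra F (FreeMonoid (ι ⊕ κ))) • (ruleIdeal H p φ S e m).mkQ 1 = 0 at this
  rw [← map_smul, smul_eq_mul, mul_one, map_sub, sub_eq_zero] at this
  rw [inducedRep_apply, Algebra.lsmul_coe]
  change lieEmb e κ (x : L) • (ruleIdeal H p φ S e m).mkQ (modEmb m ι y) = _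
  rw [← map_smul, smul_eq_mul, this]
  rfl

/-- The normal form vanishes on `ruleIdeal` but fixes the image of `M` in the free algebra. -/
theorem inducedEmb_injective [Fact p.Prime] [CharP F p] [WellFoundedLT ι]
    (hφ : ∀ a, LieAlgebra.ad F L (φ a) = LieAlgebra.ad F L a ^ p)
    (hspan : ∀ x ∈ H, x ∈ Submodule.span F (e '' {i | e i ∈ H}))
    (hup : ∀ i j, i < j → e i ∈ H → e j ∈ H) (hH : IsPSubalgebra φ H)
    (hM : HasCharacter p (restrictPMap φ H hH) (restrictForm S H) M) :
    Function.Injective (inducedEmb H p φ S e m) := by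
  obtain ⟨N, h1, h2⟩ := exists_inducedRule_normalForm H p φ S e m hφ hspan hup hH hM
  rw [injective_iff_map_eq_zero]
  intro y hy
  have h3 : modEmb m ι y ∈ ruleIdeal H p φ S e m := (Submodule.Quotient.mk_eq_zero _).1 hy
  have h4 := h2 _ (mem_ruleSpan_of_mem_ruleIdeal H p φ S e m h3)
  rw [h1] at h4
  exact modEmb_injective m (ι := ι) (by rw [h4, map_zero])

end Representation

/-! ### A basis of `L` adapted to `H` -/

section AdaptedBasis

variable {F L : Type*} [Field F] [LieRing L] [LieAlgebra F L] [FiniteDimensional F L]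

/-- A basis of a complement is followed by a basis of `H`. No vector of the first kind lies in `H`,
so the indices with `e i ∈ H` form an upper set, as the overlap of swap and action requires. -/
theorem exists_adapted_basis (H : LieSubalgebra F L) :
    ∃ (n k : ℕ) (e : Module.Basis (Fin n ⊕ₗ Fin k) F L),
      (∀ x ∈ H, x ∈ Submodule.span F (e '' {i | e i ∈ H})) ∧
      ∀ i j, i < j → e i ∈ H → e j ∈ H := by
  obtain ⟨C, hC⟩ := Submodule.exists_isCompl H.toSubmodule
  let bC := Module.finBasis F C
  let bH := Module.finBasis F H.toSubmodule
  let e := ((bC.prod bH).map (Submodule.prodEquivOfIsCompl C H.toSubmodule hC.symm)).reindex toLex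
  have hl : ∀ i, e (Sum.inlₗ i) = bC i := fun i => by
    simp [e, Sum.inlₗ]
  have hr : ∀ i, e (Sum.inrₗ i) = bH i := fun i => by
    simp [e, Sum.inrₗ]
  have hrH : ∀ i, e (Sum.inrₗ i) ∈ H := fun i => by
    rw [hr]; exact (bH i).2
  refine ⟨_, _, e, fun x hx => ?_, fun i j hij hi => ?_⟩
  · have h1 := bH.mem_span ⟨x, hx⟩
    have h2 := Submodule.mem_map_of_mem (f := H.toSubmodule.subtype) h1
    rw [Submodule.map_span] at h2
    refine Submodule.span_mono ?_ h2
    rintro _ ⟨_, ⟨i, rfl⟩, rfl⟩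
    exact ⟨Sum.inrₗ i, hrH i, hr i⟩
  · induction i using Lex.rec with | _ i =>
    induction j using Lex.rec with | _ j =>
    rcases j with j | j
    · rcases i with i | i
      · exfalso
        have h0 : ((bC i : C) : L) = 0 := by
          have h1 : ((bC i : C) : L) ∈ H.toSubmodule := by
            have := hl i
            rw [← this]
            exact hi
          exact (Submodule.disjoint_def.1 hC.disjoint) _ h1 (bC i).2
        exact bC.ne_zero i (Subtype.ext h0)
      · exact absurd hij Sum.Lex.not_inr_lt_inl
    · exact hrH j

end AdaptedBasis

/-! ### Universal property of the induced module -/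

section Induced

/-- The universal property gives a map from `u(L, S)` to `s` whose composite with the inclusion is
the identity. It serves as an induction principle for `u(L, S)`. -/
theorem ReducedEnveloping.subalgebra_eq_top {F L : Type*} [Field F] [LieRing L] [LieAlgebra F L]
    {p : ℕ} {φ : L → L} {S : L →ₗ[F] F} (s : Subalgebra F (ReducedEnveloping p φ S))
    (hs : ∀ x, ReducedEnveloping.ι p φ S x ∈ s) : s = ⊤ := by
  let f : L →ₗ⁅F⁆ s :=
    { toFun := fun x => ⟨ReducedEnveloping.ι p φ S x, hs x⟩
      map_add' := fun x y => Subtype.ext (map_add _ x y)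
      map_smul' := fun c x => Subtype.ext (map_smul _ c x)
      map_lie' := fun {x y} => Subtype.ext (LieHom.map_lie _ x y) }
  have hf : ∀ x, f x ^ p = f (φ x) + algebraMap F s (S x ^ p) := fun x =>
    Subtype.ext (ReducedEnveloping.ι_pow p φ S x)
  have h : s.val.comp (ReducedEnveloping.lift f hf) = AlgHom.id F _ := by
    apply ReducedEnveloping.hom_ext
    intro x
    rw [AlgHom.comp_apply, ReducedEnveloping.lift_ι]
    rfl
  rw [eq_top_iff]
  intro b _
  have := AlgHom.congr_fun h b
  rw [AlgHom.comp_apply, AlgHom.id_apply] at this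
  rw [← this]
  exact (ReducedEnveloping.lift f hf b).2

variable {F : Type u} {L : Type v} [Field F] [LieRing L] [LieAlgebra F L]
  (p : ℕ) (φ : L → L) (S : L →ₗ[F] F) (H : LieSubalgebra F L)
  (hH : IsPSubalgebra φ H) (M : Type w) [AddCommGroup M] [Module F M] [LieRingModule H M]
  [LieModule F H M] (hM : HasCharacter p (restrictPMap φ H hH) (restrictForm S H) M)

theorem inclHom_ι (x : H) : inclHom p φ S H hH (ReducedEnveloping.ι p _ _ x)
    = ReducedEnveloping.ι p φ S x :=
  ReducedEnveloping.lift_ι _ _ x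

theorem envAction_ι {V : Type*} [AddCommGroup V] [Module F V] [LieRingModule L V] [LieModule F L V]
    (hV : HasCharacter p φ S V) (x : L) :
    envAction p φ S V hV (ReducedEnveloping.ι p φ S x) = LieModule.toEnd F L V x :=
  ReducedEnveloping.lift_ι _ _ x

/-- The canonical map `m ↦ 1 ⊗ m` from `M` to the induced module. -/
noncomputable def indMk : M →ₗ[F] Ind p φ S H hH M hM :=
  ((balancedSubmodule p φ S H hH M hM).mkQ.restrictScalars F) ∘ₗ
    TensorProduct.mk F (ReducedEnveloping p φ S) M 1

theorem mk_tmul_eq (a : ReducedEnveloping p φ S) (y : M) :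
    (balancedSubmodule p φ S H hH M hM).mkQ (a ⊗ₜ[F] y) = a • indMk p φ S H hH M hM y := by
  change _ = a • (balancedSubmodule p φ S H hH M hM).mkQ (1 ⊗ₜ[F] y)
  rw [← map_smul, TensorProduct.smul_tmul', smul_eq_mul, mul_one]

theorem lie_indMk (x : H) (y : M) :
    ⁅(x : L), indMk p φ S H hH M hM y⁆ = indMk p φ S H hH M hM ⁅x, y⁆ := by
  rw [ind_lie]
  refine (mk_tmul_eq p φ S H hH M hM _ y).symm.trans ((Submodule.Quotient.eq _).2 ?_)
  refine Submodule.subset_span ⟨1, ReducedEnveloping.ι p _ _ x, y, ?_⟩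
  rw [one_mul]
  congr 2
  · exact (inclHom_ι p φ S H hH x).symm
  · rw [envAction_ι]
    rfl

/-- The universal property of the induced module. -/
theorem exists_indLift {V : Type*} [AddCommGroup V] [Module F V]
    (f : ReducedEnveloping p φ S →ₐ[F] Module.End F V) (g : M →ₗ[F] V)
    (hg : ∀ (x : H) (y : M), f (ReducedEnveloping.ι p φ S x) (g y) = g ⁅x, y⁆) :
    ∃ T : Ind p φ S H hH M hM →ₗ[F] V, (∀ y, T (indMk p φ S H hH M hM y) = g y) ∧
      ∀ a t, T (a • t) = f a (T t) := by
  let T₀ : ReducedEnveloping p φ S ⊗[F] M →ₗ[F] V :=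
    TensorProduct.lift ((LinearMap.lcomp F V g) ∘ₗ f.toLinearMap)
  have hT₀ : ∀ a y, T₀ (a ⊗ₜ y) = f a (g y) := fun a y => rfl
  have hsmul : ∀ (a : ReducedEnveloping p φ S) t, T₀ (a • t) = f a (T₀ t) := by
    intro a t
    induction t using TensorProduct.induction_on with
    | zero => simp
    | add s t hs ht => rw [smul_add, map_add, hs, ht, map_add, map_add]
    | tmul b y =>
      rw [TensorProduct.smul_tmul', hT₀, hT₀, smul_eq_mul, map_mul, Module.End.mul_apply]
  have hbal : ∀ (b : ReducedEnveloping p (restrictPMap φ H hH) (restrictForm S H)) (y : M),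
      f (inclHom p φ S H hH b) (g y) = g (envAction p _ _ M hM b y) := by
    -- The elements compatible with `g` form a subalgebra, so compatibility with the generators is
    -- enough.
    let s : Subalgebra F (ReducedEnveloping p (restrictPMap φ H hH) (restrictForm S H)) :=
      { carrier := {b | ∀ y : M, f (inclHom p φ S H hH b) (g y) = g (envAction p _ _ M hM b y)}
        mul_mem' := by
          intro a b ha hb y
          rw [map_mul, map_mul, map_mul, Module.End.mul_apply, Module.End.mul_apply, hb y, ha]
        add_mem' := by
          intro a b ha hb y
          rw [map_add, map_add, map_add, LinearMap.add_apply, LinearMap.add_apply, ha y, hb y,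
            map_add]
        algebraMap_mem' := by
          intro c y
          rw [AlgHom.commutes, AlgHom.commutes, AlgHom.commutes, Module.algebraMap_end_apply,
            Module.algebraMap_end_apply, map_smul] }
    have hs : s = ⊤ := ReducedEnveloping.subalgebra_eq_top s fun x y => by
      rw [inclHom_ι, envAction_ι]
      exact hg x y
    intro b
    have : b ∈ s := hs ▸ Algebra.mem_top
    exact this
  have hker : ∀ t ∈ balancedSubmodule p φ S H hH M hM, T₀ t = 0 := by
    intro t ht
    induction ht using Submodule.span_induction with
    | mem x hx =>
      obtain ⟨a, b, y, rfl⟩ := hx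
      rw [map_sub, hT₀, hT₀, map_mul, Module.End.mul_apply, hbal, sub_self]
    | zero => simp
    | add x y _ _ hx hy => rw [map_add, hx, hy, add_zero]
    | smul a x _ hx => rw [hsmul, hx, map_zero]
  let T : Ind p φ S H hH M hM →ₗ[F] V :=
    Submodule.liftQ ((balancedSubmodule p φ S H hH M hM).restrictScalars F) T₀ hker
  have hT : ∀ t, T ((balancedSubmodule p φ S H hH M hM).mkQ t) = T₀ t := fun t => rfl
  refine ⟨T, fun y => ?_, fun a t => ?_⟩
  · change T ((balancedSubmodule p φ S H hH M hM).mkQ (1 ⊗ₜ[F] y)) = _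
    rw [hT, hT₀, map_one, Module.End.one_apply]
  · obtain ⟨t, rfl⟩ := Submodule.mkQ_surjective _ t
    change T (a • (balancedSubmodule p φ S H hH M hM).mkQ t) = _
    rw [← map_smul, hT, hT, hsmul]

/-- The canonical map from a module to its induced module is injective. -/
theorem indMk_injective [FiniteDimensional F L] [Fact p.Prime] [CharP F p]
    (hφ : IsPMapping p F φ) : Function.Injective (indMk p φ S H hH M hM) := by
  obtain ⟨n, k, e, hspan, hup⟩ := exists_adapted_basis H
  let m := Module.Basis.ofVectorSpace F M
  -- `inducedEmb` factors through `M → Ind M` by the universal property, so its injectivity is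
  -- inherited.
  obtain ⟨T, hT, -⟩ := exists_indLift p φ S H hH M hM
    (ReducedEnveloping.lift (inducedRep H p φ S e m)
      (pow_eq_of_basis hφ S _ e (inducedRep_pow_basis H p φ S e m)))
    (inducedEmb H p φ S e m) (fun x y => by
      rw [ReducedEnveloping.lift_ι, inducedRep_inducedEmb H p φ S e m hspan])
  have : Finite (Fin n ⊕ₗ Fin k) := inferInstanceAs (Finite (Fin n ⊕ Fin k))
  have hinj := inducedEmb_injective H p φ S e m hφ.ad_pow hspan hup hH hM
  intro y z hyz
  apply hinj
  rw [← hT, ← hT, hyz]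

end Induced

end Embedding

/-! ### The filtration generated by a space of eigenvectors -/

section Filtration

variable {F L V : Type*} [Field F] [LieRing L] [LieAlgebra F L] [AddCommGroup V] [Module F V]
  [LieRingModule L V] [LieModule F L V]

/-- The filtration of the `L`-submodule generated by `M`, shifted by one: `0`, `M`, `M + L M`, … -/
def lieFiltration (L : Type*) [LieRing L] [LieAlgebra F L] [LieRingModule L V] [LieModule F L V]
    (M : Submodule F V) : ℕ → Submodule F V
  | 0 => ⊥
  | 1 => M
  | n + 2 => lieFiltration L M (n + 1) ⊔
      Submodule.span F {w | ∃ x : L, ∃ v ∈ lieFiltration L M (n + 1), ⁅x, v⁆ = w}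

variable {M : Submodule F V}

theorem lieFiltration_le_succ (n : ℕ) : lieFiltration L M n ≤ lieFiltration L M (n + 1) := by
  rcases n with _ | n
  · exact bot_le
  · exact le_sup_left

theorem lieFiltration_mono : Monotone (lieFiltration L M) :=
  monotone_nat_of_le_succ lieFiltration_le_succ

theorem lie_mem_lieFiltration (x : L) {n : ℕ} {v : V} (hv : v ∈ lieFiltration L M n) :
    ⁅x, v⁆ ∈ lieFiltration L M (n + 1) := by
  rcases n with _ | n
  · have : v = 0 := hv
    rw [this, lie_zero]
    exact zero_mem _
  · exact Submodule.mem_sup_right (Submodule.subset_span ⟨x, v, hv, rfl⟩)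

theorem lieFiltration_induction {n : ℕ} {P : V → Prop}
    (h1 : ∀ v ∈ lieFiltration L M (n + 1), P v)
    (h2 : ∀ (x : L), ∀ v ∈ lieFiltration L M (n + 1), P ⁅x, v⁆)
    (hadd : ∀ v w, P v → P w → P (v + w)) (hsmul : ∀ (c : F) v, P v → P (c • v)) {v : V}
    (hv : v ∈ lieFiltration L M (n + 2)) : P v := by
  obtain ⟨a, ha, b, hb, rfl⟩ := Submodule.mem_sup.1 hv
  refine hadd _ _ (h1 a ha) ?_
  clear hv
  induction hb using Submodule.span_induction with
  | mem x hx =>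
    obtain ⟨x, v, hv, rfl⟩ := hx
    exact h2 x v hv
  | zero => exact h1 0 (zero_mem _)
  | add x y _ _ hx hy => exact hadd _ _ hx hy
  | smul c x _ hx => exact hsmul c _ hx

theorem lie_lie_sub_mem_lieFiltration (x y : L) {n : ℕ} {v : V} (hv : v ∈ lieFiltration L M n) :
    ⁅x, ⁅y, v⁆⁆ - ⁅y, ⁅x, v⁆⁆ ∈ lieFiltration L M (n + 1) := by
  rw [← lie_lie]
  exact lie_mem_lieFiltration _ hv

variable {I : LieIdeal F L} {lam : I →ₗ[F] F}

/-- Induction on `y x v = x y v - [x, y] v`: the bracket `[x, y]` is again in `I`, so on `v` it acts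
as a scalar modulo lower terms. The shift of the filtration, with step 0 equal to zero, accounts for
`y - λ(y)` vanishing on `M`. -/
theorem lie_sub_smul_mem_lieFiltration (hM : M ≤ eigenspace I lam V) (y : I) {n : ℕ} {v : V}
    (hv : v ∈ lieFiltration L M (n + 1)) :
    ⁅(y : L), v⁆ - lam y • v ∈ lieFiltration L M n := by
  induction n generalizing v y with
  | zero =>
    have h : ⁅(y : L), v⁆ = lam y • v := hM hv y
    rw [h, sub_self]
    exact zero_mem _
  | succ n ih =>
    refine lieFiltration_induction (P := fun v => ⁅(y : L), v⁆ - lam y • v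
      ∈ lieFiltration L M (n + 1)) ?_ ?_ ?_ ?_ hv
    · exact fun v hv => lieFiltration_le_succ n (ih y hv)
    · intro x v hv
      have h1 : ⁅(y : L), ⁅x, v⁆⁆ - lam y • ⁅x, v⁆
          = ⁅x, ⁅(y : L), v⁆ - lam y • v⁆ - (⁅((⁅x, y⁆ : I) : L), v⁆ - lam ⁅x, y⁆ • v)
            - lam ⁅x, y⁆ • v := by
        have : ((⁅x, y⁆ : I) : L) = ⁅x, (y : L)⁆ := rfl
        rw [this, lie_lie, lie_sub, lie_smul]
        abel
      rw [h1]
      exact sub_mem (sub_mem (lie_mem_lieFiltration x (ih y hv))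
        (lieFiltration_le_succ n (ih _ hv))) (Submodule.smul_mem _ _ hv)
    · intro v w hv hw
      rw [lie_add, smul_add, add_sub_add_comm]
      exact add_mem hv hw
    · intro c v hv
      rw [lie_smul, smul_comm, ← smul_sub]
      exact Submodule.smul_mem _ c hv

/-- `x y v = [x, y] v + y x v` for `x ∈ H`: the first term raises the step of `v` only by one, and
`x v` stays in that step by induction. -/
theorem stabilizer_lie_mem_lieFiltration {H : LieSubalgebra F L}
    (hH : ∀ x ∈ H, ∀ v ∈ M, ⁅x, v⁆ ∈ M) {x : L} (hx : x ∈ H) {n : ℕ} {v : V}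
    (hv : v ∈ lieFiltration L M n) : ⁅x, v⁆ ∈ lieFiltration L M n := by
  rcases n with _ | n
  · have : v = 0 := hv
    rw [this, lie_zero]
    exact zero_mem _
  induction n generalizing v with
  | zero => exact hH x hx v hv
  | succ n ih =>
    refine lieFiltration_induction (P := fun v => ⁅x, v⁆ ∈ lieFiltration L M (n + 2))
      ?_ ?_ ?_ ?_ hv
    · exact fun v hv => lieFiltration_le_succ _ (ih hv)
    · intro y v hv
      rw [leibniz_lie]
      exact add_mem (lie_mem_lieFiltration _ hv) (lie_mem_lieFiltration _ (ih hv))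
    · intro v w hv hw
      rw [lie_add]
      exact add_mem hv hw
    · intro c v hv
      rw [lie_smul]
      exact Submodule.smul_mem _ c hv

/-- The action of a word in the elements `x i`. -/
def wordAct {ι : Type*} (x : ι → L) (l : List ι) (v : V) : V := l.foldr (fun i w => ⁅x i, w⁆) v

theorem wordAct_mem {ι : Type*} (x : ι → L) (l : List ι) {v : V} (hv : v ∈ M) :
    wordAct x l v ∈ lieFiltration L M (l.length + 1) := by
  induction l with
  | nil => exact hv
  | cons i l ih => exact lie_mem_lieFiltration _ ih

theorem wordAct_append {ι : Type*} (x : ι → L) (l l' : List ι) (v : V) :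
    wordAct x (l ++ l') v = wordAct x l (wordAct x l' v) := by
  simp [wordAct]

theorem wordAct_replicate {ι : Type*} (x : ι → L) (i : ι) (n : ℕ) (v : V) :
    wordAct x (List.replicate n i) v = (LieModule.toEnd F L V (x i) ^ n) v := by
  induction n with
  | zero => rfl
  | succ n ih =>
    rw [pow_succ', Module.End.mul_apply, ← ih]
    rfl

/-- Exchanging two neighbouring letters costs a commutator, which is a single element of `L` and
hence has lower degree. -/
theorem wordAct_perm {ι : Type*} (x : ι → L) {l l' : List ι} (h : l.Perm l') {v : V} (hv : v ∈ M) :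
    wordAct x l v - wordAct x l' v ∈ lieFiltration L M l.length := by
  induction h with
  | nil => simp
  | cons i _ ih =>
    change ⁅x i, _⁆ - ⁅x i, _⁆ ∈ _
    rw [← lie_sub]
    exact lie_mem_lieFiltration _ ih
  | swap i j l => exact lie_lie_sub_mem_lieFiltration (x j) (x i) (wordAct_mem x l hv)
  | trans h1 _ ih1 ih2 =>
    rw [← h1.length_eq] at ih2
    convert add_mem ih1 ih2 using 1
    abel

/-- Collect `p` copies of the letter in front. By the character, `x^p` acts as `x^[p] + S(x)^p`, of
degree at most `1 < p`. -/
theorem wordAct_mem_of_count {ι : Type*} [DecidableEq ι] {p : ℕ} (hp : 2 ≤ p) {φ : L → L}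
    {S : L →ₗ[F] F} (hV : HasCharacter p φ S V) (x : ι → L) (l : List ι) (i : ι)
    (h : p ≤ l.count i) {v : V} (hv : v ∈ M) : wordAct x l v ∈ lieFiltration L M l.length := by
  obtain ⟨l', hl'⟩ := (List.replicate_sublist_iff.2 h).exists_perm_append
  have h1 := wordAct_perm x hl' hv
  have h2 : wordAct x (List.replicate p i ++ l') v ∈ lieFiltration L M l.length := by
    have hc := LinearMap.congr_fun (hV (x i)) (wordAct x l' v)
    rw [LinearMap.sub_apply, sub_eq_iff_eq_add] at hc
    rw [wordAct_append, wordAct_replicate (F := F), hc]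
    have hlen := hl'.length_eq
    rw [List.length_append, List.length_replicate] at hlen
    refine add_mem (Submodule.smul_mem _ _ ?_) ?_
    · exact lieFiltration_mono (by omega) (wordAct_mem x l' hv)
    · exact lieFiltration_mono (by omega) (lie_mem_lieFiltration _ (wordAct_mem x l' hv))
  have := add_mem h1 h2
  rwa [sub_add_cancel] at this

/-- The lowering operator followed by the raising operator. -/
noncomputable def eulerOp (V : Type*) [AddCommGroup V] [Module F V] [LieRingModule L V]
    [LieModule F L V] (lam : I →ₗ[F] F) (x : L) (y : I) : Module.End F V :=
  LieModule.toEnd F L V x * (LieModule.toEnd F L V (y : L) - lam y • 1)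

theorem eulerOp_apply (x : L) (y : I) (v : V) :
    eulerOp V lam x y v = ⁅x, ⁅(y : L), v⁆ - lam y • v⁆ := rfl

theorem eulerOp_mem (hM : M ≤ eigenspace I lam V) (x : L) (y : I) {n : ℕ} {v : V}
    (hv : v ∈ lieFiltration L M n) : eulerOp V lam x y v ∈ lieFiltration L M n := by
  rcases n with _ | n
  · have : v = 0 := hv
    rw [this, map_zero]
    exact zero_mem _
  · exact lie_mem_lieFiltration x (lie_sub_smul_mem_lieFiltration hM y hv)

/-- Moving `y_j - λ(y_j)` through the word contributes `-λ([x_i, y_j])` for each letter `x_i`, that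
is, `-1` for each occurrence of `x_j`; then `x_j` restores the deleted letter, up to order. -/
theorem eulerOp_wordAct {ι : Type*} [DecidableEq ι] (hM : M ≤ eigenspace I lam V) (x : ι → L)
    (y : ι → I) (hxy : ∀ i j, lam ⁅x i, y j⁆ = if i = j then 1 else 0) (j : ι) (l : List ι)
    {v : V} (hv : v ∈ M) :
    eulerOp V lam (x j) (y j) (wordAct x l v) + (l.count j : F) • wordAct x l v
      ∈ lieFiltration L M l.length := by
  induction l with
  | nil =>
    have h : ⁅(y j : L), v⁆ = lam (y j) • v := hM hv (y j)
    change eulerOp V lam (x j) (y j) v + ((List.count j [] : ℕ) : F) • v ∈ _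
    rw [eulerOp_apply, h, sub_self, lie_zero]
    simp
  | cons i l ih =>
    set w := wordAct x l v with hw
    have hwm : w ∈ lieFiltration L M (l.length + 1) := wordAct_mem x l hv
    set t := ⁅(y j : L), w⁆ - lam (y j) • w with ht
    have htm : t ∈ lieFiltration L M l.length := lie_sub_smul_mem_lieFiltration hM (y j) hwm
    set r := ⁅((⁅x i, y j⁆ : I) : L), w⁆ - lam ⁅x i, y j⁆ • w with hr
    have hrm : r ∈ lieFiltration L M l.length := lie_sub_smul_mem_lieFiltration hM _ hwm
    have h1 : ⁅(y j : L), ⁅x i, w⁆⁆ - lam (y j) • ⁅x i, w⁆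
        = ⁅x i, t⁆ - r - lam ⁅x i, y j⁆ • w := by
      have : ((⁅x i, y j⁆ : I) : L) = ⁅x i, (y j : L)⁆ := rfl
      rw [hr, ht, this, lie_lie, lie_sub, lie_smul]
      abel
    change eulerOp V lam (x j) (y j) ⁅x i, w⁆ + ((List.count j (i :: l) : ℕ) : F) • ⁅x i, w⁆
      ∈ lieFiltration L M (l.length + 1)
    rw [eulerOp_apply, ← ht] at ih
    have h2 : lam ⁅x i, y j⁆ • ⁅x j, w⁆ = (if i = j then (1 : F) else 0) • ⁅x i, w⁆ := by
      rw [hxy]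
      split_ifs with h
      · rw [h]
      · rw [zero_smul, zero_smul]
    have h3 : ((List.count j (i :: l) : ℕ) : F) = (l.count j : F) + if i = j then 1 else 0 := by
      rw [List.count_cons]
      by_cases h : i = j <;> simp [h]
    rw [eulerOp_apply, h1, lie_sub, lie_sub, lie_smul, h2, h3]
    have h4 := add_mem (sub_mem (lie_lie_sub_mem_lieFiltration (x j) (x i) htm)
      (lie_mem_lieFiltration (x j) hrm)) (lie_mem_lieFiltration (x i) ih)
    convert h4 using 1
    rw [lie_add, lie_smul, add_smul]
    abel

theorem mem_of_eulerOp_pow {T : Module.End F V} {N : Submodule F V} (hT : ∀ v ∈ N, T v ∈ N) {w : V}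
    {c : F} (h : T w + c • w ∈ N) (n : ℕ) : (T ^ n) w - (-c) ^ n • w ∈ N := by
  induction n with
  | zero => simp
  | succ n ih =>
    have := add_mem (hT _ ih) (Submodule.smul_mem _ ((-c) ^ n) h)
    rw [pow_succ', pow_succ, Module.End.mul_apply]
    convert this using 1
    rw [map_sub, map_smul, smul_add, smul_smul, mul_neg, neg_smul]
    abel

theorem list_prod_sub_smul_mem {ι : Type*} {T : ι → Module.End F V} {N : Submodule F V}
    (hT : ∀ i, ∀ v ∈ N, T i v ∈ N) {w : V} {c : ι → F} (h : ∀ i, T i w - c i • w ∈ N)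
    (s : List ι) : (s.map T).prod w - (s.map c).prod • w ∈ N := by
  induction s with
  | nil => simp
  | cons i s ih =>
    rw [List.map_cons, List.map_cons, List.prod_cons, List.prod_cons, Module.End.mul_apply]
    convert add_mem (hT i _ ih) (Submodule.smul_mem _ ((s.map c).prod) (h i)) using 1
    rw [map_sub, map_smul, smul_sub, smul_smul, mul_comm]
    abel

/-- Fermat's little theorem: Frobenius fixes the images of natural numbers. -/
theorem natCast_pow_pred {p : ℕ} [hp : Fact p.Prime] [CharP F p] {c : ℕ} (h0 : c ≠ 0)
    (h : c < p) : (-(c : F)) ^ (p - 1) = 1 := by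
  have hc : (-(c : F)) ≠ 0 := by
    rw [neg_ne_zero]
    intro h'
    have := Nat.le_of_dvd (Nat.pos_of_ne_zero h0) ((CharP.cast_eq_zero_iff F p c).1 h')
    omega
  have h1 : (-(c : F)) ^ p = -(c : F) := by
    have := map_natCast (frobenius F p) c
    have h2 := map_neg (frobenius F p) (c : F)
    rw [this] at h2
    exact h2
  apply mul_right_cancel₀ hc
  rw [← pow_succ, Nat.sub_add_cancel hp.out.one_le, h1, one_mul]

variable {ι : Type*} [Finite ι] {x : ι → L} {y : ι → I} {p : ℕ} {φ : L → L} {S : L →ₗ[F] F}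

/-- `L^λ` preserves every step, so only the `x_i` can produce something new in the next one. -/
theorem lieFiltration_le_sup_words
    (hstab : ∀ z ∈ stabilizer I lam, ∀ v ∈ M, ⁅z, v⁆ ∈ M)
    (hx : ∀ z : L, ∃ a ∈ Submodule.span F (Set.range x), z - a ∈ stabilizer I lam) (n : ℕ) :
    lieFiltration L M (n + 1) ≤ lieFiltration L M n ⊔
      Submodule.span F {w | ∃ l : List ι, l.length = n ∧ ∃ v ∈ M, wordAct x l v = w} := by
  induction n with
  | zero =>
    intro v hv
    exact Submodule.mem_sup_right (Submodule.subset_span ⟨[], rfl, v, hv, rfl⟩)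
  | succ n ih =>
    intro v hv
    refine lieFiltration_induction (P := fun v => v ∈ lieFiltration L M (n + 1) ⊔
      Submodule.span F {w | ∃ l : List ι, l.length = n + 1 ∧ ∃ v ∈ M, wordAct x l v = w})
      (fun v hv => Submodule.mem_sup_left hv) ?_ (fun v w => add_mem)
      (fun c v => Submodule.smul_mem _ c) hv
    intro z v hv
    obtain ⟨a, ha, hz⟩ := hx z
    rw [← sub_add_cancel z a, add_lie]
    refine add_mem (Submodule.mem_sup_left (stabilizer_lie_mem_lieFiltration hstab hz hv)) ?_
    obtain ⟨b, hb, c, hc, rfl⟩ := Submodule.mem_sup.1 (ih hv)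
    rw [lie_add]
    refine add_mem (Submodule.mem_sup_left (lie_mem_lieFiltration _ hb)) ?_
    clear hz
    induction ha using Submodule.span_induction with
    | mem a ha =>
      obtain ⟨i, rfl⟩ := ha
      clear hv
      induction hc using Submodule.span_induction with
      | mem c hc =>
        obtain ⟨l, hl, v, hv, rfl⟩ := hc
        exact Submodule.mem_sup_right
          (Submodule.subset_span ⟨i :: l, by rw [List.length_cons, hl], v, hv, rfl⟩)
      | zero => rw [lie_zero]; exact zero_mem _
      | add s t _ _ hs ht => rw [lie_add]; exact add_mem hs ht
      | smul k s _ hs => rw [lie_smul]; exact Submodule.smul_mem _ k hs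
    | zero => rw [zero_lie]; exact zero_mem _
    | add s t _ _ hs ht => rw [add_lie]; exact add_mem hs ht
    | smul k s _ hs => rw [smul_lie]; exact Submodule.smul_mem _ k hs

/-- An eigenvector in the `n + 2`-nd step of the filtration lies in the previous step. -/
theorem eigenvector_mem_lieFiltration [hp : Fact p.Prime] [CharP F p] (hV : HasCharacter p φ S V)
    (hM : M ≤ eigenspace I lam V) (hstab : ∀ z ∈ stabilizer I lam, ∀ v ∈ M, ⁅z, v⁆ ∈ M)
    [DecidableEq ι] (hxy : ∀ i j, lam ⁅x i, y j⁆ = if i = j then 1 else 0)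
    (hx : ∀ z : L, ∃ a ∈ Submodule.span F (Set.range x), z - a ∈ stabilizer I lam) {n : ℕ} {v : V}
    (hv : v ∈ lieFiltration L M (n + 2)) (hv' : v ∈ eigenspace I lam V) :
    v ∈ lieFiltration L M (n + 1) := by
  have hp2 := hp.out.two_le
  have := Fintype.ofFinite ι
  -- Modulo lower terms, `1 - E_j^(p-1)` is the projection onto the words whose number of letters
  -- `x_j` is divisible by `p`.
  let Q : ι → Module.End F V := fun j => 1 - eulerOp V lam (x j) (y j) ^ (p - 1)
  have hEN : ∀ j, ∀ k : ℕ, ∀ v ∈ lieFiltration L M (n + 1),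
      (eulerOp V lam (x j) (y j) ^ k) v ∈ lieFiltration L M (n + 1) := by
    intro j k v hv
    induction k with
    | zero => exact hv
    | succ k ih => rw [pow_succ']; exact eulerOp_mem hM _ _ ih
  have hQN : ∀ j, ∀ v ∈ lieFiltration L M (n + 1), Q j v ∈ lieFiltration L M (n + 1) :=
    fun j v hv => sub_mem hv (hEN j _ v hv)
  let s := (Finset.univ : Finset ι).toList
  -- An eigenvector is killed by each `y_j - λ(y_j)`, hence by `E_j^(p-1)`, as `p - 1 > 0`.
  have hfix : (s.map Q).prod v = v := by
    induction s with
    | nil => rfl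
    | cons j s ih =>
      rw [List.map_cons, List.prod_cons, Module.End.mul_apply, ih]
      have h : ⁅(y j : L), v⁆ = lam (y j) • v := hv' (y j)
      have h1 : eulerOp V lam (x j) (y j) v = 0 := by
        rw [eulerOp_apply, h, sub_self, lie_zero]
      have h2 : p - 1 = (p - 2) + 1 := by omega
      change v - (eulerOp V lam (x j) (y j) ^ (p - 1)) v = v
      rw [h2, pow_succ, Module.End.mul_apply, h1, map_zero, sub_zero]
  have hkill : ∀ w ∈ lieFiltration L M (n + 2), (s.map Q).prod w ∈ lieFiltration L M (n + 1) := by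
    intro w hw
    have hN : ∀ w ∈ lieFiltration L M (n + 1), (s.map Q).prod w ∈ lieFiltration L M (n + 1) := by
      intro w hw
      induction s with
      | nil => exact hw
      | cons j s ih =>
        rw [List.map_cons, List.prod_cons, Module.End.mul_apply]
        exact hQN j _ ih
    obtain ⟨a, ha, b, hb, rfl⟩ := Submodule.mem_sup.1 (lieFiltration_le_sup_words hstab hx _ hw)
    rw [map_add]
    refine add_mem (hN a ha) ?_
    clear hw
    induction hb using Submodule.span_induction with
    | zero => rw [map_zero]; exact zero_mem _
    | add s t _ _ hs ht => rw [map_add]; exact add_mem hs ht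
    | smul k s _ hs => rw [map_smul]; exact Submodule.smul_mem _ k hs
    | mem b hb =>
      obtain ⟨l, hl, u, hu, rfl⟩ := hb
      by_cases hcount : ∃ j, p ≤ l.count j
      · obtain ⟨j, hj⟩ := hcount
        refine hN _ ?_
        rw [← hl]
        exact wordAct_mem_of_count hp2 hV x l j hj hu
      · push Not at hcount
        have hc : ∀ j, Q j (wordAct x l u) - (1 - (-(l.count j : F)) ^ (p - 1)) • wordAct x l u
            ∈ lieFiltration L M (n + 1) := by
          intro j
          have h1 := eulerOp_wordAct hM x y hxy j l hu
          rw [hl] at h1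
          have h2 := mem_of_eulerOp_pow (fun v hv => eulerOp_mem hM (x j) (y j) hv) h1 (p - 1)
          convert neg_mem h2 using 1
          change wordAct x l u - (eulerOp V lam (x j) (y j) ^ (p - 1)) (wordAct x l u) - _ = _
          rw [sub_smul, one_smul]
          abel
        have h3 := list_prod_sub_smul_mem hQN hc s
        -- The word has length `n + 1 > 0`; a letter occurring in it, fewer than `p` times, gives a
        -- vanishing factor.
        obtain ⟨j, hj⟩ : ∃ j, j ∈ l := List.exists_mem_of_length_pos (by omega)
        have h4 : (s.map fun j => (1 - (-(l.count j : F)) ^ (p - 1))).prod = 0 := by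
          apply List.prod_eq_zero
          rw [List.mem_map]
          refine ⟨j, Finset.mem_toList.2 (Finset.mem_univ j), ?_⟩
          rw [natCast_pow_pred (List.count_pos_iff.2 hj).ne' (hcount j), sub_self]
        rwa [h4, zero_smul, sub_zero] at h3
  rw [← hfix]
  exact hkill v hv

end Filtration

/-! ### Dual families for the pairing of `L` with `I` -/

section DualFamily

/-- A linear map into a space with enough linear forms `e w` is dual to a finite family. -/
theorem exists_dual_family_of_surjective {F V W D : Type*} [Field F] [AddCommGroup V] [Module F V]
    [AddCommGroup D] [Module F D] [FiniteDimensional F D] (B : V →ₗ[F] D)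
    (e : W → D →ₗ[F] F) (he : Function.Surjective e) :
    ∃ (n : ℕ) (x : Fin n → V) (y : Fin n → W),
      (∀ i j, e (y j) (B (x i)) = if i = j then 1 else 0) ∧
      ∀ z : V, ∃ a ∈ Submodule.span F (Set.range x), B (z - a) = 0 := by
  let b := Module.finBasis F (LinearMap.range B)
  -- Forms on the range of `B` extend to `D`, so the coordinate forms of a basis of the range are
  -- all represented by elements of `W`.
  have hsurj : Function.Surjective fun w => (e w) ∘ₗ (LinearMap.range B).subtype :=
    (LinearMap.dualMap_surjective_of_injective
      (Submodule.subtype_injective (LinearMap.range B))).comp he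
  choose y hy using fun i => hsurj (b.coord i)
  choose x hx using fun i => (b i).2
  refine ⟨_, x, y, fun i j => ?_, fun z => ?_⟩
  · have h1 := LinearMap.congr_fun (hy j) (b i)
    change e (y j) (b i : D) = _ at h1
    rw [hx, h1, Module.Basis.coord_apply, b.repr_self, Finsupp.single_apply]
  · refine ⟨∑ i, b.repr ⟨B z, z, rfl⟩ i • x i,
      sum_mem fun i _ => Submodule.smul_mem _ _ (Submodule.subset_span ⟨i, rfl⟩), ?_⟩
    have h1 := congrArg (LinearMap.range B).subtype (b.sum_repr ⟨B z, z, rfl⟩)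
    rw [map_sum] at h1
    simp only [map_smul, Submodule.subtype_apply] at h1
    rw [map_sub, map_sum, sub_eq_zero]
    simp only [map_smul, hx]
    exact h1.symm

variable {F L : Type*} [Field F] [LieRing L] [LieAlgebra F L] [FiniteDimensional F L]

/-- A basis of `L` modulo `L^λ`, and a dual family in `I`. -/
theorem exists_dual_family (I : LieIdeal F L) (lam : I →ₗ[F] F) :
    ∃ (n : ℕ) (x : Fin n → L) (y : Fin n → I),
      (∀ i j, lam ⁅x i, y j⁆ = if i = j then 1 else 0) ∧
      ∀ z : L, ∃ a ∈ Submodule.span F (Set.range x), z - a ∈ stabilizer I lam := by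
  have : FiniteDimensional F I := inferInstanceAs (FiniteDimensional F I.toSubmodule)
  -- The map `x ↦ λ([x, ·])` from `L` to the dual of `I` has kernel `L^λ`, and every form on that
  -- dual is evaluation at an element of `I`.
  obtain ⟨n, x, y, hxy, hz⟩ := exists_dual_family_of_surjective (W := I)
    (D := Module.Dual F I) (LinearMap.mk₂ F (fun (x : L) (y : I) => lam ⁅x, y⁆) (fun x x' y => by rw [add_lie, map_add])
      (fun c x y => by rw [smul_lie, map_smul]) (fun x y y' => by rw [lie_add, map_add])
      (fun c x y => by rw [lie_smul, map_smul])) (Module.Dual.eval F I)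
    (Module.evalEquiv F I).surjective
  refine ⟨n, x, y, hxy, fun z => ?_⟩
  obtain ⟨a, ha, h⟩ := hz z
  exact ⟨a, ha, fun t => LinearMap.congr_fun h t⟩

end DualFamily

/-! ### Eigenvectors in the submodule generated by `M` -/

section Generated

variable {F L V : Type*} [Field F] [LieRing L] [LieAlgebra F L] [FiniteDimensional F L]
  [AddCommGroup V] [Module F V] [LieRingModule L V] [LieModule F L V] {M : Submodule F V}
  {I : LieIdeal F L} {lam : I →ₗ[F] F} {p : ℕ} {φ : L → L} {S : L →ₗ[F] F}

/-- An eigenvector in the `L`-submodule generated by an `L^λ`-submodule `M` of `V^λ` lies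
in `M`. -/
theorem eigenvector_mem [hp : Fact p.Prime] [CharP F p] (hV : HasCharacter p φ S V)
    (hM : M ≤ eigenspace I lam V) (hstab : ∀ z ∈ stabilizer I lam, ∀ v ∈ M, ⁅z, v⁆ ∈ M)
    {n : ℕ} {v : V} (hv : v ∈ lieFiltration L M n) (hv' : v ∈ eigenspace I lam V) : v ∈ M := by
  obtain ⟨k, x, y, hxy, hx⟩ := exists_dual_family I lam
  rcases n with _ | n
  · have : v = 0 := hv
    rw [this]
    exact zero_mem _
  induction n with
  | zero => exact hv
  | succ n ih => exact ih (eigenvector_mem_lieFiltration hV hM hstab hxy hx hv hv')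

variable (L M) in
/-- The `L`-submodule generated by `M`. -/
def lieGenerated : LieSubmodule F L V where
  carrier := {v | ∃ n, v ∈ lieFiltration L M n}
  add_mem' := by
    rintro a b ⟨n, hn⟩ ⟨k, hk⟩
    exact ⟨max n k, add_mem (lieFiltration_mono (le_max_left n k) hn)
      (lieFiltration_mono (le_max_right n k) hk)⟩
  zero_mem' := ⟨0, zero_mem _⟩
  smul_mem' := by
    rintro c a ⟨n, hn⟩
    exact ⟨n, Submodule.smul_mem _ c hn⟩
  lie_mem := by
    rintro x a ⟨n, hn⟩
    exact ⟨n + 1, lie_mem_lieFiltration x hn⟩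

theorem mem_lieGenerated {v : V} (hv : v ∈ M) : v ∈ lieGenerated L M := ⟨1, hv⟩

/-- A nonzero `L`-submodule of the module generated by eigenvectors contains an eigenvector. -/
theorem exists_eigenvector (hM : M ≤ eigenspace I lam V) (hgen : lieGenerated L M = ⊤)
    (N : LieSubmodule F L V) (hN : N ≠ ⊥) : ∃ v ∈ N, v ≠ 0 ∧ v ∈ eigenspace I lam V := by
  classical
  have hex : ∃ n, ∃ v ∈ N, v ≠ 0 ∧ v ∈ lieFiltration L M n := by
    obtain ⟨v, hv, hv0⟩ : ∃ v ∈ N, v ≠ 0 := by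
      by_contra! h
      exact hN ((LieSubmodule.eq_bot_iff N).2 h)
    have : v ∈ lieGenerated L M := hgen ▸ LieSubmodule.mem_top v
    obtain ⟨n, hn⟩ := this
    exact ⟨n, v, hv, hv0, hn⟩
  -- For `v` in the lowest step that meets `N` nontrivially, `y v - λ(y) v` lies in `N` and in the
  -- step before, so it vanishes.
  obtain ⟨v, hv, hv0, hvn⟩ := Nat.find_spec hex
  rcases hn : Nat.find hex with _ | n
  · rw [hn] at hvn
    exact absurd hvn hv0
  · rw [hn] at hvn
    refine ⟨v, hv, hv0, fun y => ?_⟩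
    by_contra hne
    refine Nat.find_min hex (m := n) (by omega) ⟨⁅(y : L), v⁆ - lam y • v, ?_, ?_, ?_⟩
    · exact sub_mem (N.lie_mem hv) (N.smul_mem _ hv)
    · exact sub_ne_zero.2 hne
    · exact lie_sub_smul_mem_lieFiltration hM y hvn

end Generated

/-! ### The stabilizer `L^λ` and its irreducible modules -/

section Stabilizer

variable {F L : Type*} [Field F] [LieRing L] [LieAlgebra F L] {I : LieIdeal F L} {lam : I →ₗ[F] F}

theorem mem_stabilizer_of_mem (hlam : ∀ y ∈ LieAlgebra.derivedSeries F I 1, lam y = 0) (y : I) :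
    (y : L) ∈ stabilizer I lam := by
  intro z
  apply hlam
  exact LieSubmodule.lie_mem_lie (LieSubmodule.mem_top y) (LieSubmodule.mem_top z)

/-- `ad (x^[p]) = (ad x)^p` gives `λ([x^[p], y]) = λ([x, (ad x)^(p-1) y])`, and `(ad x)^(p-1) y` is
still in `I`. -/
theorem isPSubalgebra_stabilizer {p : ℕ} (hp : p ≠ 0) {φ : L → L} (hφ : IsPMapping p F φ) :
    IsPSubalgebra φ (stabilizer I lam) := by
  intro x hx y
  have key : ∀ n : ℕ, (((LieModule.toEnd F L I x ^ n) y : I) : L)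
      = (LieAlgebra.ad F L x ^ n) (y : L) := by
    intro n
    induction n with
    | zero => simp
    | succ n ih =>
      rw [pow_succ', pow_succ', Module.End.mul_apply, Module.End.mul_apply, ← ih]
      rfl
  have h : ⁅φ x, y⁆ = (LieModule.toEnd F L I x ^ p) y := by
    apply Subtype.ext
    rw [key, ← hφ.ad_pow]
    rfl
  obtain ⟨n, rfl⟩ := Nat.exists_eq_succ_of_ne_zero hp
  rw [h, Nat.succ_eq_add_one, pow_succ', Module.End.mul_apply]
  exact hx _

/-- The eigenspace of `λ` in an `L^λ`-module is a submodule. -/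
def stabEigenModule (I : LieIdeal F L) (lam : I →ₗ[F] F) (M : Type*) [AddCommGroup M] [Module F M]
    [LieRingModule (stabilizer I lam) M] [LieModule F (stabilizer I lam) M] :
    LieSubmodule F (stabilizer I lam) M where
  __ := eigenspace (stabIdeal I lam) (stabForm I lam) M
  lie_mem := by
    intro x v hv y
    have hv' : ∀ y : stabIdeal I lam, ⁅(y : stabilizer I lam), v⁆ = stabForm I lam y • v := hv
    have h1 : stabForm I lam ⁅x, y⁆ = 0 := x.2 ⟨_, y.2⟩
    have h2 := hv' ⁅x, y⁆
    rw [h1, zero_smul, LieSubmodule.coe_bracket, lie_lie, sub_eq_zero, hv', lie_smul] at h2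
    exact h2.symm

/-- `I` acts by `λ` on an irreducible `L^λ`-module with eigenvalue function `λ`. -/
theorem lie_eq_smul_of_isIrreducible {M : Type*} [AddCommGroup M] [Module F M]
    [LieRingModule (stabilizer I lam) M] [LieModule F (stabilizer I lam) M]
    (hM : LieModule.IsIrreducible F (stabilizer I lam) M)
    (h : IsEigenvalueFunction (stabIdeal I lam) (stabForm I lam) M) {y : stabilizer I lam}
    (hy : (y : L) ∈ I) (m : M) : ⁅y, m⁆ = lam ⟨y, hy⟩ • m := by
  have htop : stabEigenModule I lam M = ⊤ := by
    refine (eq_bot_or_eq_top _).resolve_left fun hbot => h ?_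
    exact congrArg LieSubmodule.toSubmodule hbot
  have hm : m ∈ stabEigenModule I lam M := htop ▸ LieSubmodule.mem_top m
  exact hm ⟨y, hy⟩

end Stabilizer

/-! ### Irreducibility of `V^λ` -/

section Eigenspace

variable {F L V : Type*} [Field F] [LieRing L] [LieAlgebra F L] [FiniteDimensional F L]
  [AddCommGroup V] [Module F V] [LieRingModule L V] [LieModule F L V] {I : LieIdeal F L}
  {lam : I →ₗ[F] F} {p : ℕ} {φ : L → L} {S : L →ₗ[F] F}

/-- A nonzero `L^λ`-submodule of `V^λ` generates `V`, and by `eigenvector_mem` this adds no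
eigenvectors to it. -/
theorem eigenModule_isIrreducible [Fact p.Prime] [CharP F p] (hV : HasCharacter p φ S V)
    (hirr : LieModule.IsIrreducible F L V) (h : IsEigenvalueFunction I lam V) :
    LieModule.IsIrreducible F (stabilizer I lam) (eigenModule I lam V) := by
  have : Nontrivial (eigenModule I lam V) := Submodule.nontrivial_iff_ne_bot.2 h
  refine LieModule.IsIrreducible.mk fun N hN => ?_
  let M : Submodule F V := N.toSubmodule.map (eigenModule I lam V).incl.toLinearMap
  have hM : M ≤ eigenspace I lam V := by
    rintro _ ⟨v, -, rfl⟩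
    exact v.2
  have hstab : ∀ z ∈ stabilizer I lam, ∀ v ∈ M, ⁅z, v⁆ ∈ M := by
    rintro z hz _ ⟨v, hv, rfl⟩
    exact ⟨⁅(⟨z, hz⟩ : stabilizer I lam), v⁆, N.lie_mem hv, rfl⟩
  have hgen : lieGenerated L M = ⊤ := by
    refine (eq_bot_or_eq_top _).resolve_left fun hbot => hN ?_
    refine (LieSubmodule.eq_bot_iff N).2 fun v hv => Subtype.ext ?_
    have h1 : (v : V) ∈ lieGenerated L M := mem_lieGenerated ⟨v, hv, rfl⟩
    rwa [hbot] at h1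
  rw [eq_top_iff]
  intro v _
  obtain ⟨n, hn⟩ : (v : V) ∈ lieGenerated L M := hgen ▸ LieSubmodule.mem_top _
  obtain ⟨w, hw, hwv⟩ := eigenvector_mem hV hM hstab hn v.2
  have : w = v := Subtype.ext hwv
  exact this ▸ hw

theorem eigenModule_isEigenvalueFunction (h : IsEigenvalueFunction I lam V) :
    IsEigenvalueFunction (stabIdeal I lam) (stabForm I lam) (eigenModule I lam V) := by
  obtain ⟨v, hv, hv0⟩ := (Submodule.ne_bot_iff _).1 h
  refine (Submodule.ne_bot_iff _).2 ⟨⟨v, hv⟩, fun y => Subtype.ext ?_, fun h0 => hv0 ?_⟩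
  · exact hv ⟨_, y.2⟩
  · exact congrArg Subtype.val h0

end Eigenspace

/-! ### Schur's lemma -/

section Schur

variable {F L V W : Type*} [Field F] [LieRing L] [LieAlgebra F L] [AddCommGroup V] [Module F V]
  [LieRingModule L V] [LieModule F L V] [AddCommGroup W] [Module F W] [LieRingModule L W]
  [LieModule F L W]

theorem nonempty_equiv_of_bijective (f : V →ₗ⁅F,L⁆ W) (hf : Function.Bijective f) :
    Nonempty (V ≃ₗ⁅F,L⁆ W) :=
  ⟨{ LinearEquiv.ofBijective (f : V →ₗ[F] W) hf with
    map_lie' := fun {x v} => f.map_lie x v }⟩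

/-- Schur's lemma. -/
theorem bijective_of_isIrreducible (hV : LieModule.IsIrreducible F L V)
    (hW : LieModule.IsIrreducible F L W) (f : V →ₗ⁅F,L⁆ W) (hf : ∃ v, f v ≠ 0) :
    Function.Bijective f := by
  obtain ⟨v, hv⟩ := hf
  constructor
  · rw [← LieModuleHom.ker_eq_bot]
    refine (eq_bot_or_eq_top _).resolve_right fun h => hv ?_
    exact (LieModuleHom.mem_ker (f := f)).1 (h ▸ LieSubmodule.mem_top v)
  · rw [← LieModuleHom.range_eq_top]
    refine (eq_bot_or_eq_top _).resolve_left fun h => hv ?_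
    have : f v ∈ f.range := (LieModuleHom.mem_range f _).2 ⟨v, rfl⟩
    rw [h] at this
    exact this

end Schur

/-! ### Irreducibility of `Ind M` and the two inverse constructions -/

section Induced

variable {F : Type u} {L : Type v} [Field F] [LieRing L] [LieAlgebra F L] {p : ℕ} {φ : L → L}
  {S : L →ₗ[F] F}

section General

variable {H : LieSubalgebra F L} {hH : IsPSubalgebra φ H} {M : Type w} [AddCommGroup M]
  [Module F M] [LieRingModule H M] [LieModule F H M]
  {hM : HasCharacter p (restrictPMap φ H hH) (restrictForm S H) M}

/-- The elements of `u(L, S)` that preserve `N` form a subalgebra containing the image of `L`. -/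
theorem smul_mem_of_lieSubmodule (N : LieSubmodule F L (Ind p φ S H hH M hM))
    (a : ReducedEnveloping p φ S) {t : Ind p φ S H hH M hM} (ht : t ∈ N) : a • t ∈ N := by
  let s : Subalgebra F (ReducedEnveloping p φ S) :=
    { carrier := {a | ∀ t ∈ N, a • t ∈ N}
      mul_mem' := by
        intro a b ha hb t ht
        rw [mul_smul]
        exact ha _ (hb t ht)
      add_mem' := by
        intro a b ha hb t ht
        rw [add_smul]
        exact add_mem (ha t ht) (hb t ht)
      algebraMap_mem' := by
        intro c t ht
        rw [algebraMap_smul]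
        exact N.smul_mem c ht }
  have hs : s = ⊤ := ReducedEnveloping.subalgebra_eq_top s fun x t ht => N.lie_mem (x := x) ht
  have : a ∈ s := hs ▸ Algebra.mem_top
  exact this t ht

theorem lieSubmodule_eq_top (N : LieSubmodule F L (Ind p φ S H hH M hM))
    (hN : ∀ y, indMk p φ S H hH M hM y ∈ N) : N = ⊤ := by
  rw [eq_top_iff]
  intro t _
  obtain ⟨t, rfl⟩ := Submodule.mkQ_surjective (balancedSubmodule p φ S H hH M hM) t
  induction t using TensorProduct.induction_on with
  | zero =>
    rw [map_zero]
    exact N.zero_mem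
  | add s t hs ht =>
    rw [map_add]
    exact N.add_mem (hs trivial) (ht trivial)
  | tmul a y =>
    rw [mk_tmul_eq]
    exact smul_mem_of_lieSubmodule N a (hN y)

end General

variable [FiniteDimensional F L] [Fact p.Prime] [CharP F p] {I : LieIdeal F L} {lam : I →ₗ[F] F}
  {hH : IsPSubalgebra φ (stabilizer I lam)} {M : Type w} [AddCommGroup M] [Module F M]
  [LieRingModule (stabilizer I lam) M] [LieModule F (stabilizer I lam) M]
  {hM : HasCharacter p (restrictPMap φ (stabilizer I lam) hH)
    (restrictForm S (stabilizer I lam)) M}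

/-- The condition `λ([I, I]) = 0` puts `I` inside `L^λ`, so `y (1 ⊗ m) = 1 ⊗ y m` for `y ∈ I`, and
`I` acts on the irreducible module `M` through `λ`. -/
theorem indMk_mem_eigenspace (hlam : ∀ y ∈ LieAlgebra.derivedSeries F I 1, lam y = 0)
    (hirr : LieModule.IsIrreducible F (stabilizer I lam) M)
    (h : IsEigenvalueFunction (stabIdeal I lam) (stabForm I lam) M) (m : M) :
    indMk p φ S _ hH M hM m ∈ eigenspace I lam (Ind p φ S _ hH M hM) := by
  intro y
  have h1 := lie_indMk p φ S _ hH M hM ⟨y, mem_stabilizer_of_mem hlam y⟩ m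
  rw [lie_eq_smul_of_isIrreducible hirr h y.2, map_smul] at h1
  exact h1

theorem lieGenerated_range_indMk :
    lieGenerated L (LinearMap.range (indMk p φ S _ hH M hM)) = ⊤ :=
  lieSubmodule_eq_top _ fun m => mem_lieGenerated ⟨m, rfl⟩

/-- `(Ind M)^λ` is the image of `M`. -/
theorem mem_range_indMk (hlam : ∀ y ∈ LieAlgebra.derivedSeries F I 1, lam y = 0)
    (hirr : LieModule.IsIrreducible F (stabilizer I lam) M)
    (h : IsEigenvalueFunction (stabIdeal I lam) (stabForm I lam) M)
    {t : Ind p φ S _ hH M hM} (ht : t ∈ eigenspace I lam (Ind p φ S _ hH M hM)) :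
    t ∈ LinearMap.range (indMk p φ S _ hH M hM) := by
  obtain ⟨n, hn⟩ : t ∈ lieGenerated L (LinearMap.range (indMk p φ S _ hH M hM)) :=
    lieGenerated_range_indMk (hM := hM) ▸ LieSubmodule.mem_top t
  refine eigenvector_mem (ind_hasCharacter p φ S _ hH M hM) ?_ ?_ hn ht
  · rintro _ ⟨m, rfl⟩
    exact indMk_mem_eigenspace hlam hirr h m
  · rintro z hz _ ⟨m, rfl⟩
    exact ⟨⁅(⟨z, hz⟩ : stabilizer I lam), m⁆, (lie_indMk p φ S _ hH M hM ⟨z, hz⟩ m).symm⟩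

/-- A nonzero submodule contains an eigenvector, which lies in the image of `M`. Its preimage in `M`
is then nonzero, hence all of `M`, and `M` generates `Ind M`. Injectivity of `M → Ind M` ensures
that `Ind M` is nonzero. -/
theorem ind_isIrreducible (hφ : IsPMapping p F φ)
    (hlam : ∀ y ∈ LieAlgebra.derivedSeries F I 1, lam y = 0)
    (hirr : LieModule.IsIrreducible F (stabilizer I lam) M)
    (h : IsEigenvalueFunction (stabIdeal I lam) (stabForm I lam) M) :
    LieModule.IsIrreducible F L (Ind p φ S _ hH M hM) := by
  have : Nontrivial M := LieSubmodule.nontrivial_iff F (stabilizer I lam) M |>.1 inferInstance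
  have : Nontrivial (Ind p φ S _ hH M hM) := (indMk_injective p φ S _ hH M hM hφ).nontrivial
  refine LieModule.IsIrreducible.mk fun N hN => ?_
  obtain ⟨v, hvN, hv0, hv⟩ := exists_eigenvector
    (M := LinearMap.range (indMk p φ S _ hH M hM)) (by
      rintro _ ⟨m, rfl⟩
      exact indMk_mem_eigenspace hlam hirr h m) lieGenerated_range_indMk N hN
  obtain ⟨m, rfl⟩ := mem_range_indMk hlam hirr h hv
  let K : LieSubmodule F (stabilizer I lam) M :=
    { N.toSubmodule.comap (indMk p φ S _ hH M hM) with
      lie_mem := by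
        intro x y hy
        change indMk p φ S _ hH M hM ⁅x, y⁆ ∈ N
        rw [← lie_indMk]
        exact N.lie_mem hy }
  have hK : K = ⊤ := by
    refine (eq_bot_or_eq_top _).resolve_left fun hbot => hv0 ?_
    have hm : m ∈ K := hvN
    rw [(LieSubmodule.eq_bot_iff K).1 hbot m hm, map_zero]
  exact lieSubmodule_eq_top N fun y => (hK ▸ LieSubmodule.mem_top y : y ∈ K)

theorem ind_isEigenvalueFunction (hφ : IsPMapping p F φ)
    (hlam : ∀ y ∈ LieAlgebra.derivedSeries F I 1, lam y = 0)
    (hirr : LieModule.IsIrreducible F (stabilizer I lam) M)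
    (h : IsEigenvalueFunction (stabIdeal I lam) (stabForm I lam) M) :
    IsEigenvalueFunction I lam (Ind p φ S _ hH M hM) := by
  obtain ⟨m, -, hm0⟩ := (Submodule.ne_bot_iff _).1 h
  refine (Submodule.ne_bot_iff _).2 ⟨_, indMk_mem_eigenspace hlam hirr h m, fun h0 => hm0 ?_⟩
  exact indMk_injective p φ S _ hH M hM hφ (h0.trans (map_zero _).symm)

/-- `m ↦ 1 ⊗ m` is injective by the Poincaré–Birkhoff–Witt argument and onto the eigenspace by
`mem_range_indMk`. -/
theorem eigenModule_ind_equiv (hφ : IsPMapping p F φ)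
    (hlam : ∀ y ∈ LieAlgebra.derivedSeries F I 1, lam y = 0)
    (hirr : LieModule.IsIrreducible F (stabilizer I lam) M)
    (h : IsEigenvalueFunction (stabIdeal I lam) (stabForm I lam) M) :
    Nonempty (M ≃ₗ⁅F,stabilizer I lam⁆ eigenModule I lam (Ind p φ S _ hH M hM)) := by
  refine nonempty_equiv_of_bijective
    { (indMk p φ S _ hH M hM).codRestrict (eigenspace I lam (Ind p φ S _ hH M hM))
        (indMk_mem_eigenspace hlam hirr h) with
      map_lie' := fun {x m} => Subtype.ext (lie_indMk p φ S _ hH M hM x m).symm } ⟨?_, ?_⟩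
  · intro a b hab
    exact indMk_injective p φ S _ hH M hM hφ (congrArg Subtype.val hab)
  · rintro ⟨t, ht⟩
    obtain ⟨m, rfl⟩ := mem_range_indMk hlam hirr h ht
    exact ⟨m, rfl⟩

/-- The inclusion `V^λ → V` extends to `Ind (V^λ) → V`, a nonzero map between irreducible modules.
-/
theorem ind_eigenModule_equiv {V : Type w} [AddCommGroup V] [Module F V] [LieRingModule L V]
    [LieModule F L V] (hφ : IsPMapping p F φ)
    (hlam : ∀ y ∈ LieAlgebra.derivedSeries F I 1, lam y = 0) (hV : HasCharacter p φ S V)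
    (hirr : LieModule.IsIrreducible F L V) (h : IsEigenvalueFunction I lam V)
    (hE : HasCharacter p (restrictPMap φ (stabilizer I lam) hH)
      (restrictForm S (stabilizer I lam)) (eigenModule I lam V)) :
    Nonempty (Ind p φ S _ hH (eigenModule I lam V) hE ≃ₗ⁅F,L⁆ V) := by
  obtain ⟨T, hT, hsmul⟩ := exists_indLift p φ S _ hH (eigenModule I lam V) hE
    (envAction p φ S V hV) (eigenModule I lam V).toSubmodule.subtype (fun x y => by
      rw [envAction_ι]
      rfl)
  let f : Ind p φ S _ hH (eigenModule I lam V) hE →ₗ⁅F,L⁆ V :=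
    { T with
      map_lie' := fun {x t} => by
        refine (hsmul (ReducedEnveloping.ι p φ S x) t).trans ?_
        rw [envAction_ι]
        rfl }
  refine nonempty_equiv_of_bijective f (bijective_of_isIrreducible
    (ind_isIrreducible hφ hlam (eigenModule_isIrreducible hV hirr h)
      (eigenModule_isEigenvalueFunction h)) hirr f ?_)
  obtain ⟨v, hv, hv0⟩ := (Submodule.ne_bot_iff _).1 h
  exact ⟨_, fun h0 => hv0 ((hT ⟨v, hv⟩).symm.trans h0)⟩

end Induced

end RestrictedLie

/-- Modules are taken in the universe `max u v w`, large enough to hold `u(L, S)`, so that induction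
does not leave it. -/
theorem mainTheorem1 {F : Type u} {L : Type v} [Field F] [LieRing L] [LieAlgebra F L]
    [FiniteDimensional F L] (p : ℕ) [Fact p.Prime] [CharP F p]
    (φ : L → L) (hφ : RestrictedLie.IsPMapping p F φ)
    (S : L →ₗ[F] F) (I : LieIdeal F L) (lam : I →ₗ[F] F)
    (hlam : ∀ y ∈ LieAlgebra.derivedSeries F I 1, lam y = 0) :
    ∃ h : RestrictedLie.IsPSubalgebra φ (RestrictedLie.stabilizer I lam),
      Set.BijOn
        (RestrictedLie.eigenMap.{u, v, max u v w} S I lam h)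
        (RestrictedLie.irreducibleClasses p φ S I lam)
        (RestrictedLie.irreducibleStabClasses p φ S I lam h) ∧
      Set.MapsTo
        (RestrictedLie.indMap.{u, v, w} S (RestrictedLie.stabilizer I lam) h)
        (RestrictedLie.irreducibleStabClasses p φ S I lam h)
        (RestrictedLie.irreducibleClasses p φ S I lam) ∧
      Set.InvOn
        (RestrictedLie.indMap.{u, v, w} S (RestrictedLie.stabilizer I lam) h)
        (RestrictedLie.eigenMap.{u, v, max u v w} S I lam h)
        (RestrictedLie.irreducibleClasses p φ S I lam)
        (RestrictedLie.irreducibleStabClasses p φ S I lam h) := by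
  have h : RestrictedLie.IsPSubalgebra φ (RestrictedLie.stabilizer I lam) :=
    RestrictedLie.isPSubalgebra_stabilizer (Fact.out : p.Prime).ne_zero hφ
  have hmaps : Set.MapsTo (RestrictedLie.eigenMap.{u, v, max u v w} S I lam h)
      (RestrictedLie.irreducibleClasses p φ S I lam)
      (RestrictedLie.irreducibleStabClasses p φ S I lam h) := by
    rintro _ ⟨V, rfl, hirr, hev⟩
    exact ⟨V.eigen I lam h, rfl, RestrictedLie.eigenModule_isIrreducible V.hasCharacter hirr hev,
      RestrictedLie.eigenModule_isEigenvalueFunction hev⟩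
  have hmaps' : Set.MapsTo
      (RestrictedLie.indMap.{u, v, w} S (RestrictedLie.stabilizer I lam) h)
      (RestrictedLie.irreducibleStabClasses p φ S I lam h)
      (RestrictedLie.irreducibleClasses p φ S I lam) := by
    rintro _ ⟨M, rfl, hirr, hev⟩
    exact ⟨RestrictedLie.SModule.ind.{u, v, w} _ h M, rfl,
      RestrictedLie.ind_isIrreducible hφ hlam hirr hev,
      RestrictedLie.ind_isEigenvalueFunction hφ hlam hirr hev⟩
  have hinv : Set.InvOn
      (RestrictedLie.indMap.{u, v, w} S (RestrictedLie.stabilizer I lam) h)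
      (RestrictedLie.eigenMap.{u, v, max u v w} S I lam h)
      (RestrictedLie.irreducibleClasses p φ S I lam)
      (RestrictedLie.irreducibleStabClasses p φ S I lam h) := by
    constructor
    · rintro _ ⟨V, rfl, hirr, hev⟩
      exact Quotient.sound
        (RestrictedLie.ind_eigenModule_equiv hφ hlam V.hasCharacter hirr hev _)
    · rintro _ ⟨M, rfl, hirr, hev⟩
      obtain ⟨e⟩ := RestrictedLie.eigenModule_ind_equiv (hM := M.hasCharacter) hφ hlam hirr hev
      exact Quotient.sound ⟨e.symm⟩
  exact ⟨h, hinv.bijOn hmaps hmaps', hmaps', hinv⟩
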